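/- **Setting.** Consider on $\Omega=(0,1)$ the two-parameter problem $$-\varepsilon_1u''+\varepsilon_2b(x)u'+c(x)u=f(x)\ \text{ in }\Omega,\qquad u(0)=u(1)=0,$$ where $b,c,f$ are sufficiently smooth on $[0,1]$ (of class $C^q([0,1])$ for some absolute integer $q$), $0<\varepsilon_1,\varepsilon_2\le 1$, and, on $[0,1]$, $b\ge\lambda>0$, $c\ge\beta>0$, $c-\frac12\varepsilon_2b'\ge\gamma>0$ with constants $\lambda,\beta,\gamma$. Its weak solution $u\in H_0^1(\Omega)$ satisfies $a(u,v)=(f,v)$ for all $v\in H^1_0(\Omega)$, where $(\cdot,\cdot)$ is the scalar product of $L^2(\Omega)$ and $a(u,v)=\varepsilon_1(u',v')+\varepsilon_2(bu',v)+(cu,v)$. Let $g_0(x)<0<g_1(x)$ be the two roots $g$ of $-\varepsilon_1g^2+\varepsilon_2b(x)g+c(x)=0$, and put $\mu_0=-\max_{[0,1]}g_0$, $\mu_1=\min_{[0,1]}g_1$. Let $p\in(0,1)$ and $\tau>0$ be fixed, put $\sigma_j=\frac{\tau}{p\mu_j}\ln\mu_j$ for $j=0,1$, let $N\ge16$ be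 an integer divisible by $4$, and assume that $\sigma_0,\sigma_1\le\frac14$ and $\mu_0^{-1}\le N^{-1}$. With $t_i=i/N$, $\varphi_0(t)=-\ln(1-4(1-\mu_0^{-1})t)$ and $\varphi_1(t)=-\ln(1-4(1-\mu_1^{-1})(1-t))$, the Bakhvalov-type mesh is $$x_i=\begin{cases}\frac{\tau}{p\mu_0}\varphi_0(t_i), & 0\le i\le \frac N4,\\ \sigma_0+2\left(t_i-\frac14\right)(1-\sigma_0-\sigma_1), & \frac N4\le i\le\frac{3N}4,\\ 1-\frac{\tau}{p\mu_1}\varphi_1(t_i), & \frac{3N}4\le i\le N.\end{cases}$$ Let $V^N$ be the space of all $w\in C([0,1])$ with $w(0)=w(1)=0$ that are affine on each $[x_i,x_{i+1}]$, $0\le i<N$. The linear finite element solution $u^N\in V^N$ satisfies $a(u^N,v)=(f,v)$ for all $v\in V^N$. Let $u^I$ be the continuous piecewise linear Lagrange interpolant of $u$ at $x_0,\dots,x_N$, and let $\|v\|_E^2=\varepsilon_1\|v'\|_{L^2(\Omega)}^2+\|v\|_{L^2(\Omega)}^2$. **Theorem.** Assume $\tau\ge\frac52$. Then there is a constant $C>0$,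 depending only on $b,c,f,\lambda,\beta,\gamma,p,\tau$ and not on $\varepsilon_1,\varepsilon_2,N$, such that, for all $\varepsilon_1,\varepsilon_2,N$ as above, $$\|u^I-u^N\|_E\le C\varepsilon_2^{1/2}N^{-2}\ln^{1/2}N+CN^{-2}.$$ -/

import Mathlib

open Set MeasureTheory

noncomputable section

namespace TwoParam

/-- Negative root `g₀(x)` of the characteristic equation `-ε₁ g² + ε₂ b(x) g + c(x) = 0`. -/
def charRoot0 (ε₁ ε₂ : ℝ) (b c : ℝ → ℝ) (x : ℝ) : ℝ :=
  (ε₂ * b x - √(ε₂ ^ 2 * b x ^ 2 + 4 * ε₁ * c x)) / (2 * ε₁)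

/-- Positive root `g₁(x)` of the characteristic equation `-ε₁ g² + ε₂ b(x) g + c(x) = 0`. -/
def charRoot1 (ε₁ ε₂ : ℝ) (b c : ℝ → ℝ) (x : ℝ) : ℝ :=
  (ε₂ * b x + √(ε₂ ^ 2 * b x ^ 2 + 4 * ε₁ * c x)) / (2 * ε₁)

theorem charRoot_spec {ε₁ ε₂ : ℝ} {b c : ℝ → ℝ} {x : ℝ} (h₁ : 0 < ε₁) (hc : 0 < c x) (g : ℝ) :
    -ε₁ * g ^ 2 + ε₂ * b x * g + c x = 0 ↔
      g = charRoot0 ε₁ ε₂ b c x ∨ g = charRoot1 ε₁ ε₂ b c x := by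
  have hs : √(ε₂ ^ 2 * b x ^ 2 + 4 * ε₁ * c x) ^ 2 = ε₂ ^ 2 * b x ^ 2 + 4 * ε₁ * c x :=
    Real.sq_sqrt (by positivity)
  have key : -ε₁ * g ^ 2 + ε₂ * b x * g + c x
      = -ε₁ * ((g - charRoot0 ε₁ ε₂ b c x) * (g - charRoot1 ε₁ ε₂ b c x)) := by
    unfold charRoot0 charRoot1
    generalize √(ε₂ ^ 2 * b x ^ 2 + 4 * ε₁ * c x) = s at hs ⊢
    field_simp
    linear_combination (-1 : ℝ) * hs
  rw [key]
  simp [h₁.ne', sub_eq_zero]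

theorem charRoot_sign {ε₁ ε₂ : ℝ} {b c : ℝ → ℝ} {x : ℝ} (h₁ : 0 < ε₁) (hc : 0 < c x) :
    charRoot0 ε₁ ε₂ b c x < 0 ∧ 0 < charRoot1 ε₁ ε₂ b c x := by
  have h : |ε₂ * b x| < √(ε₂ ^ 2 * b x ^ 2 + 4 * ε₁ * c x) := by
    rw [← Real.sqrt_sq_eq_abs]
    apply Real.sqrt_lt_sqrt (sq_nonneg _)
    nlinarith [mul_pos h₁ hc]
  have h' := abs_lt.mp h
  exact ⟨div_neg_of_neg_of_pos (by linarith) (by linarith),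
    div_pos (by linarith) (by linarith)⟩

/-- `μ₀ = - max_{[0,1]} g₀`. -/
def mu0 (ε₁ ε₂ : ℝ) (b c : ℝ → ℝ) : ℝ :=
  -sSup (charRoot0 ε₁ ε₂ b c '' Icc 0 1)

/-- `μ₁ = min_{[0,1]} g₁`. -/
def mu1 (ε₁ ε₂ : ℝ) (b c : ℝ → ℝ) : ℝ :=
  sInf (charRoot1 ε₁ ε₂ b c '' Icc 0 1)

/-- `σ = τ / (p μ) · ln μ`: the mesh changes character at `σ₀` and at `1 - σ₁`. -/
def sigma (τ p μ : ℝ) : ℝ := τ / (p * μ) * Real.log μ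

/-- Mesh generating function at `x = 0`. -/
def phi0 (μ₀ t : ℝ) : ℝ := -Real.log (1 - 4 * (1 - μ₀⁻¹) * t)

/-- Mesh generating function at `x = 1`. -/
def phi1 (μ₁ t : ℝ) : ℝ := -Real.log (1 - 4 * (1 - μ₁⁻¹) * (1 - t))

/-- The points `x_i`, `i = 0, …, N`, of the Bakhvalov-type mesh (`N` divisible by `4`). -/
def meshPoint (τ p μ₀ μ₁ : ℝ) (N i : ℕ) : ℝ :=
  if 4 * i ≤ N then
    τ / (p * μ₀) * phi0 μ₀ ((i : ℝ) / N)
  else if 4 * i ≤ 3 * N then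
    sigma τ p μ₀ + 2 * ((i : ℝ) / N - 1 / 4) * (1 - sigma τ p μ₀ - sigma τ p μ₁)
  else
    1 - τ / (p * μ₁) * phi1 μ₁ ((i : ℝ) / N)

/-- The hat function `θ_i`, `0 ≤ i ≤ N`, on the mesh `x 0 < x 1 < ⋯ < x N`: the continuous
piecewise linear function with `θ_i (x j) = δ_{ij}`. -/
def hat (x : ℕ → ℝ) (N i : ℕ) (t : ℝ) : ℝ :=
  if 1 ≤ i ∧ x (i - 1) ≤ t ∧ t ≤ x i then (t - x (i - 1)) / (x i - x (i - 1))
  else if i < N ∧ x i ≤ t ∧ t ≤ x (i + 1) then (x (i + 1) - t) / (x (i + 1) - x i)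
  else 0

/-- The Lagrange interpolant `v^I = ∑_{i=0}^N v(x_i) θ_i`. -/
def lagrangeInterp (x : ℕ → ℝ) (N : ℕ) (v : ℝ → ℝ) (t : ℝ) : ℝ :=
  ∑ i ∈ Finset.range (N + 1), v (x i) * hat x N i t

/-- `v ∈ H¹₀(0,1)`, for the continuous representative: `v` is absolutely continuous on `[0,1]`,
its (almost everywhere, equivalently weak) derivative is in `L²(0,1)`, and `v` vanishes at
both end points. Only the values of `v` on `[0,1]` matter. -/
structure MemH10 (v : ℝ → ℝ) : Prop where
  absCont : AbsolutelyContinuousOnInterval v 0 1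
  deriv_memLp : MemLp (deriv v) 2 (volume.restrict (Ioo 0 1))
  left_eq_zero : v 0 = 0
  right_eq_zero : v 1 = 0

/-- The linear finite element space `V^N` on the mesh `x 0 < x 1 < ⋯ < x N`. -/
structure MemVN (x : ℕ → ℝ) (N : ℕ) (w : ℝ → ℝ) : Prop where
  continuousOn : ContinuousOn w (Icc 0 1)
  left_eq_zero : w 0 = 0
  right_eq_zero : w 1 = 0
  affine : ∀ i < N, ∃ m k : ℝ, ∀ t ∈ Icc (x i) (x (i + 1)), w t = m * t + k

/-- The scalar product of `L²(0,1)`. -/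
def l2Inner (v w : ℝ → ℝ) : ℝ := ∫ t in (0 : ℝ)..1, v t * w t

/-- `a(v,w) = ε₁ (v',w') + ε₂ (b v',w) + (c v,w)`. -/
def bilin (ε₁ ε₂ : ℝ) (b c v w : ℝ → ℝ) : ℝ :=
  ε₁ * l2Inner (deriv v) (deriv w) + ε₂ * l2Inner (fun t => b t * deriv v t) w
    + l2Inner (fun t => c t * v t) w

/-- `u ∈ H¹₀(0,1)` solves `-ε₁ u'' + ε₂ b u' + c u = f`, `u(0) = u(1) = 0`, in the weak form. -/
def IsWeakSolution (ε₁ ε₂ : ℝ) (b c f u : ℝ → ℝ) : Prop :=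
  MemH10 u ∧ ∀ v : ℝ → ℝ, MemH10 v → bilin ε₁ ε₂ b c u v = l2Inner f v

/-- `uN ∈ V^N` is the linear finite element solution on the mesh `x`. -/
def IsFEMSolution (ε₁ ε₂ : ℝ) (b c f : ℝ → ℝ) (x : ℕ → ℝ) (N : ℕ) (uN : ℝ → ℝ) : Prop :=
  MemVN x N uN ∧ ∀ v : ℝ → ℝ, MemVN x N v → bilin ε₁ ε₂ b c uN v = l2Inner f v

/-- The energy norm, `‖v‖_E² = ε₁ ‖v'‖² + ‖v‖²` with norms of `L²(0,1)`. -/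
def energyNorm (ε₁ : ℝ) (v : ℝ → ℝ) : ℝ :=
  √(ε₁ * l2Inner (deriv v) (deriv v) + l2Inner v v)

end TwoParam

end

open Set MeasureTheory

noncomputable section

namespace TwoParam


/-! The proof gives the stronger bound `C N⁻²`; the logarithmic term is only added at the end. Put
`δ = √(ε₂² + ε₁)`. Then `μ₀` is comparable to `1/δ`, and `μ₁` is at least a constant times `δ/ε₁`.

The solution is compared with an explicit function `g = S + E + F`: a two-term outer expansion with
a tiny linear correction, plus a WKB layer at each end point. Its residual `r` is `O(δ²) = O(μ₀⁻²)`,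
hence `O(N⁻²)` because `N ≤ μ₀` (`exists_decomposition`). So `u - g` is `O(N⁻²)` in the maximum norm
by a truncation argument (`abs_le_of_bilin_eq`), and its weighted derivative is `O(N⁻²)` by
coercivity (`energy_le_of_bilin_eq`). Its interpolant inherits both bounds
(`nodalEnergy_sample_le`), so no derivative estimates for `u` itself are needed.

For `χ = g^I - u^N`, coercivity bounds `‖χ‖_E²` by a multiple of `a(g^I - g, χ) - (r, χ)`. The
diffusion part of `a(g^I - g, χ)` vanishes on every cell (`bilin_interp_error`), and the reaction
part is controlled by `|g^I - g| = O(N⁻²)`. The convective part `ε₂ (b (g^I - g)', χ)` is the crux.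

For `S` one power of `N` is lost to the derivative and regained from `ε₂ ≤ K/μ₀ ≤ K/N`. For `F`,
integration by parts puts the derivative on `χ`, and Cauchy-Schwarz against `ε₁‖χ'‖²` is affordable
because `ε₂ ≤ K ε₁ μ₁` (`right_conv_inner_le`). This fails for `E`, where `ε₂` need not be small
compared with `ε₁ μ₀`. There the slopes of `χ` are summed by parts. The weighted cell means of `E^I
- E` on neighbouring cells of the graded mesh almost cancel: they differ by `O(N^(-5/2))`
(`left_mean_diff_le`), while `ε₂ ∑ |χ(x_i)| ≤ C √N ‖χ‖_E` (`e2_sum_abs_nodal_le`). The exponent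
`5/2` is where `τ ≥ 5/2` enters. Most of the cells where a layer is already negligible are handled
by the nodal bounds `ε₂ |χ(x_i)| ≤ C ‖χ‖_E` (`e2_abs_nodal_le`, `e2_abs_nodal_right_le`). -/

/-! ### Extension of the coefficients from `[0,1]` to the line. -/

/-- A `C^n` function on `[0,1]` extends to a `C^n` function on the line. -/
theorem exists_contDiff_extension (n : ℕ) : ∀ {f : ℝ → ℝ}, ContDiffOn ℝ n f (Icc 0 1) →
    ∃ g : ℝ → ℝ, ContDiff ℝ n g ∧ EqOn f g (Icc 0 1) := by
  induction n with
  | zero =>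
    intro f hf
    have hc : ContinuousOn f (Icc 0 1) := by simpa using hf
    refine ⟨IccExtend zero_le_one ((Icc (0 : ℝ) 1).domRestrict f), ?_, ?_⟩
    · have := (continuousOn_iff_continuous_domRestrict.mp hc).Icc_extend' (h := zero_le_one)
      simpa [contDiff_zero] using this
    · intro x hx
      rw [IccExtend_of_mem _ _ hx]; rfl
  | succ n ih =>
    intro f hf
    have hu : UniqueDiffOn ℝ (Icc (0 : ℝ) 1) := uniqueDiffOn_Icc zero_lt_one
    push_cast at hf
    have hf' := (contDiffOn_succ_iff_derivWithin hu).mp hf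
    obtain ⟨h, hh, heq⟩ := ih hf'.2.2
    -- The extension is an antiderivative of an extension `h` of the derivative, normalised at `0`.
    have hder : ∀ x, HasDerivAt (fun x => f 0 + ∫ t in (0 : ℝ)..x, h t) (h x) x := fun x =>
      (intervalIntegral.integral_hasDerivAt_right (hh.continuous.intervalIntegrable _ _)
        hh.continuous.stronglyMeasurable.stronglyMeasurableAtFilter
        hh.continuous.continuousAt).const_add _
    refine ⟨fun x => f 0 + ∫ t in (0 : ℝ)..x, h t, ?_, ?_⟩
    · push_cast
      rw [contDiff_succ_iff_deriv]
      refine ⟨fun x => (hder x).differentiableAt, by simp, ?_⟩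
      have e : deriv (fun x => f 0 + ∫ t in (0 : ℝ)..x, h t) = h := funext fun x => (hder x).deriv
      rwa [e]
    · intro x hx
      have hsub : Icc (0 : ℝ) x ⊆ Icc 0 1 := Icc_subset_Icc_right hx.2
      have key : ∫ t in (0 : ℝ)..x, h t = f x - f 0 := by
        apply intervalIntegral.integral_eq_sub_of_hasDerivAt_of_le hx.1
          (hf.continuousOn.mono hsub) _ (hh.continuous.intervalIntegrable _ _)
        intro t ht
        have ht1 : t ∈ Icc (0 : ℝ) 1 := hsub (Ioo_subset_Icc_self ht)
        have := (hf'.1 t ht1).hasDerivWithinAt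
        rw [heq ht1] at this
        exact this.hasDerivAt (Icc_mem_nhds ht.1 (ht.2.trans_le hx.2))
      simp [key]

/-- A positive `C^n` function on `[0,1]` extends to a positive `C^n` function on the line. -/
theorem exists_pos_contDiff_extension (n : ℕ) {f : ℝ → ℝ} (hf : ContDiffOn ℝ n f (Icc 0 1))
    (hpos : ∀ x ∈ Icc (0 : ℝ) 1, 0 < f x) :
    ∃ g : ℝ → ℝ, ContDiff ℝ n g ∧ (∀ x, 0 < g x) ∧ EqOn f g (Icc 0 1) := by
  -- Extending `log f` and exponentiating preserves positivity on the whole line.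
  obtain ⟨g, hg, he⟩ := exists_contDiff_extension n (hf.log fun x hx => (hpos x hx).ne')
  refine ⟨fun x => Real.exp (g x), hg.exp, fun x => Real.exp_pos _, fun x hx => ?_⟩
  simp only
  rw [← he hx, Real.exp_log (hpos x hx)]

/-! ### Families of functions that are smooth uniformly in the parameters. -/

variable {I : Type*}

/-- A family of functions is bounded on `[0,1]` uniformly in the index. -/
def UnifBdd (F : I → ℝ → ℝ) : Prop := ∃ M : ℝ, ∀ i, ∀ x ∈ Icc (0 : ℝ) 1, |F i x| ≤ M

/-- A family of `C^n` functions whose derivatives up to the order `n` are bounded on `[0,1]`,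
uniformly in the index. -/
def UnifC : ℕ → (I → ℝ → ℝ) → Prop
  | 0, F => (∀ i, Continuous (F i)) ∧ UnifBdd F
  | n + 1, F => (∀ i, Differentiable ℝ (F i)) ∧ UnifBdd F ∧ UnifC n (fun i => deriv (F i))

namespace UnifC

theorem bdd {n : ℕ} {F : I → ℝ → ℝ} (h : UnifC n F) : UnifBdd F := by
  cases n with
  | zero => exact h.2
  | succ n => exact h.2.1

theorem continuous {n : ℕ} {F : I → ℝ → ℝ} (h : UnifC n F) (i : I) : Continuous (F i) := by
  cases n with
  | zero => exact h.1 i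
  | succ n => exact (h.1 i).continuous

theorem hasDerivAt {n : ℕ} {F : I → ℝ → ℝ} (h : UnifC (n + 1) F) (i : I) (x : ℝ) :
    HasDerivAt (F i) (deriv (F i) x) x := (h.1 i x).hasDerivAt

theorem deriv {n : ℕ} {F : I → ℝ → ℝ} (h : UnifC (n + 1) F) : UnifC n (fun i => deriv (F i)) :=
  h.2.2

theorem pred {n : ℕ} : ∀ {F : I → ℝ → ℝ}, UnifC (n + 1) F → UnifC n F := by
  induction n with
  | zero => intro F h; exact ⟨fun i => (h.1 i).continuous, h.2.1⟩
  | succ n ih => intro F h; exact ⟨h.1, h.2.1, ih h.2.2⟩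

theorem add {n : ℕ} : ∀ {F G : I → ℝ → ℝ}, UnifC n F → UnifC n G →
    UnifC n (fun i x => F i x + G i x) := by
  have hb : ∀ {F G : I → ℝ → ℝ}, UnifBdd F → UnifBdd G → UnifBdd (fun i x => F i x + G i x) := by
    rintro F G ⟨M, hM⟩ ⟨K, hK⟩
    exact ⟨M + K, fun i x hx => (abs_add_le _ _).trans (add_le_add (hM i x hx) (hK i x hx))⟩
  induction n with
  | zero => intro F G hF hG; exact ⟨fun i => (hF.1 i).add (hG.1 i), hb hF.2 hG.2⟩
  | succ n ih =>
    intro F G hF hG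
    refine ⟨fun i => (hF.1 i).add (hG.1 i), hb hF.bdd hG.bdd, ?_⟩
    convert ih hF.deriv hG.deriv using 3 with i x
    exact deriv_fun_add (hF.1 i x) (hG.1 i x)

theorem mul {n : ℕ} : ∀ {F G : I → ℝ → ℝ}, UnifC n F → UnifC n G →
    UnifC n (fun i x => F i x * G i x) := by
  have hb : ∀ {F G : I → ℝ → ℝ}, UnifBdd F → UnifBdd G → UnifBdd (fun i x => F i x * G i x) := by
    rintro F G ⟨M, hM⟩ ⟨K, hK⟩
    refine ⟨M * K, fun i x hx => ?_⟩
    rw [abs_mul]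
    exact mul_le_mul (hM i x hx) (hK i x hx) (abs_nonneg _) ((abs_nonneg _).trans (hM i x hx))
  induction n with
  | zero => intro F G hF hG; exact ⟨fun i => (hF.1 i).mul (hG.1 i), hb hF.2 hG.2⟩
  | succ n ih =>
    intro F G hF hG
    refine ⟨fun i => (hF.1 i).mul (hG.1 i), hb hF.bdd hG.bdd, ?_⟩
    convert (ih hF.deriv hG.pred).add (ih hF.pred hG.deriv) using 3 with i x
    exact deriv_fun_mul (hF.1 i x) (hG.1 i x)

theorem const {n : ℕ} {k : I → ℝ} {M : ℝ} (hk : ∀ i, |k i| ≤ M) :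
    UnifC n (fun i _ => k i) := by
  have h0 : ∀ n, UnifC n (fun (_ : I) (_ : ℝ) => (0 : ℝ)) := by
    intro n
    induction n with
    | zero => exact ⟨fun i => continuous_const, 0, by simp⟩
    | succ n ih => exact ⟨fun i => differentiable_const _, ⟨0, by simp⟩, by simpa using ih⟩
  cases n with
  | zero => exact ⟨fun i => continuous_const, M, fun i x _ => hk i⟩
  | succ n =>
    exact ⟨fun i => differentiable_const _, ⟨M, fun i x _ => hk i⟩, by simpa using h0 n⟩

theorem neg {n : ℕ} {F : I → ℝ → ℝ} (h : UnifC n F) : UnifC n (fun i x => -F i x) := by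
  have := (const (I := I) (n := n) (k := fun _ => (-1 : ℝ)) (M := 1) (by simp)).mul h
  simpa using this

theorem of_contDiff {n : ℕ} : ∀ {f : ℝ → ℝ}, ContDiff ℝ n f → UnifC n (fun (_ : I) => f) := by
  have hb : ∀ {f : ℝ → ℝ}, Continuous f → UnifBdd (fun (_ : I) => f) := by
    intro f hf
    obtain ⟨M, hM⟩ := isCompact_Icc.exists_bound_of_continuousOn (s := Icc (0 : ℝ) 1) hf.continuousOn
    exact ⟨M, fun _ x hx => hM x hx⟩
  induction n with
  | zero => intro f hf; exact ⟨fun _ => hf.continuous, hb hf.continuous⟩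
  | succ n ih =>
    intro f hf
    push_cast at hf
    have h := contDiff_succ_iff_deriv.mp hf
    exact ⟨fun _ => h.1, hb hf.continuous, ih h.2.2⟩

/-- Positivity on the line gives differentiability everywhere; the lower bound `κ`, needed only on
`[0,1]`, gives uniformity in the index. -/
theorem inv {n : ℕ} {κ : ℝ} (hκ : 0 < κ) : ∀ {F : I → ℝ → ℝ}, UnifC n F → (∀ i x, 0 < F i x) →
    (∀ i, ∀ x ∈ Icc (0 : ℝ) 1, κ ≤ F i x) → UnifC n (fun i x => (F i x)⁻¹) := by
  have hb : ∀ {F : I → ℝ → ℝ}, (∀ i, ∀ x ∈ Icc (0 : ℝ) 1, κ ≤ F i x) →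
      UnifBdd (fun i x => (F i x)⁻¹) := by
    intro F hF
    refine ⟨κ⁻¹, fun i x hx => ?_⟩
    rw [abs_of_pos (inv_pos.mpr (hκ.trans_le (hF i x hx)))]
    exact inv_anti₀ hκ (hF i x hx)
  induction n with
  | zero => intro F hF hp hl; exact ⟨fun i => (hF.1 i).inv₀ fun x => (hp i x).ne', hb hl⟩
  | succ n ih =>
    intro F hF hp hl
    refine ⟨fun i => (hF.1 i).inv fun x => (hp i x).ne', hb hl, ?_⟩
    convert (hF.deriv.mul ((ih hF.pred hp hl).mul (ih hF.pred hp hl))).neg using 3 with i x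
    rw [deriv_fun_inv'' (hF.1 i x) (hp i x).ne']
    field_simp

theorem sqrt {n : ℕ} {κ : ℝ} (hκ : 0 < κ) : ∀ {F : I → ℝ → ℝ}, UnifC n F → (∀ i x, 0 < F i x) →
    (∀ i, ∀ x ∈ Icc (0 : ℝ) 1, κ ≤ F i x) → UnifC n (fun i x => √(F i x)) := by
  have hb : ∀ {F : I → ℝ → ℝ}, UnifBdd F → UnifBdd (fun i x => √(F i x)) := by
    rintro F ⟨M, hM⟩
    refine ⟨√M, fun i x hx => ?_⟩
    rw [abs_of_nonneg (Real.sqrt_nonneg _)]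
    exact Real.sqrt_le_sqrt ((le_abs_self _).trans (hM i x hx))
  induction n with
  | zero => intro F hF hp hl; exact ⟨fun i => (hF.1 i).sqrt, hb hF.2⟩
  | succ n ih =>
    intro F hF hp hl
    refine ⟨fun i => (hF.1 i).sqrt fun x => (hp i x).ne', hb hF.bdd, ?_⟩
    have hs := ih hF.pred hp hl
    have hi := hs.inv (κ := √κ) (Real.sqrt_pos.mpr hκ) (fun i x => Real.sqrt_pos.mpr (hp i x))
      (fun i x hx => Real.sqrt_le_sqrt (hl i x hx))
    convert (hF.deriv.mul hi).mul (const (k := fun _ => (2 : ℝ)⁻¹) (M := 2⁻¹) (by simp [abs_of_pos])) using 3 with i x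
    rw [deriv_sqrt (hF.1 i x) (hp i x).ne']
    field_simp

end UnifC


/-! ### The scaled parameters. -/

/-- Pairs of perturbation parameters in `(0,1]`. -/
def Params : Type := {e : ℝ × ℝ // (0 < e.1 ∧ e.1 ≤ 1) ∧ 0 < e.2 ∧ e.2 ≤ 1}

namespace Params

def e1 (i : Params) : ℝ := i.1.1
def e2 (i : Params) : ℝ := i.1.2
def delta (i : Params) : ℝ := √(i.e2 ^ 2 + i.e1)
def th2 (i : Params) : ℝ := i.e2 / i.delta
def th1 (i : Params) : ℝ := i.e1 / i.delta ^ 2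

theorem e1_pos (i : Params) : 0 < i.e1 := i.2.1.1
theorem e2_pos (i : Params) : 0 < i.e2 := i.2.2.1
theorem e1_le (i : Params) : i.e1 ≤ 1 := i.2.1.2
theorem e2_le (i : Params) : i.e2 ≤ 1 := i.2.2.2

theorem delta_sq (i : Params) : i.delta ^ 2 = i.e2 ^ 2 + i.e1 :=
  Real.sq_sqrt (add_nonneg (sq_nonneg _) i.e1_pos.le)

theorem delta_pos (i : Params) : 0 < i.delta :=
  Real.sqrt_pos.mpr (add_pos_of_nonneg_of_pos (sq_nonneg _) i.e1_pos)

theorem e2_le_delta (i : Params) : i.e2 ≤ i.delta :=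
  Real.le_sqrt_of_sq_le (by linarith [i.e1_pos])

theorem delta_le (i : Params) : i.delta ≤ 2 := by
  have h := i.delta_sq
  nlinarith [i.e1_le, i.e2_le, i.e2_pos, i.delta_pos]

theorem e1_le_delta_sq (i : Params) : i.e1 ≤ i.delta ^ 2 := by
  rw [i.delta_sq]; linarith [sq_nonneg i.e2]

theorem th1_pos (i : Params) : 0 < i.th1 := div_pos i.e1_pos (pow_pos i.delta_pos 2)
theorem th2_pos (i : Params) : 0 < i.th2 := div_pos i.e2_pos i.delta_pos

theorem th1_le (i : Params) : i.th1 ≤ 1 :=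
  (div_le_one (pow_pos i.delta_pos 2)).mpr i.e1_le_delta_sq

theorem th2_le (i : Params) : i.th2 ≤ 1 := (div_le_one i.delta_pos).mpr i.e2_le_delta

/-- The purpose of the scaling by `δ`: the pair `(th2, th1)` stays on a compact arc and its entries
cannot both be small, so scaled quantities are bounded above and below uniformly in `ε₁, ε₂`. -/
theorem th_add (i : Params) : i.th2 ^ 2 + i.th1 = 1 := by
  have h := i.delta_pos
  rw [th2, th1, div_pow, ← add_div, ← i.delta_sq, div_self (pow_pos h 2).ne']

theorem e2_eq (i : Params) : i.e2 = i.delta * i.th2 := by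
  rw [th2, mul_div_cancel₀ _ i.delta_pos.ne']

theorem e1_eq (i : Params) : i.e1 = i.delta ^ 2 * i.th1 := by
  rw [th1, mul_div_cancel₀ _ (pow_pos i.delta_pos 2).ne']

theorem unifC_const {n : ℕ} {k : Params → ℝ} {M : ℝ} (h0 : ∀ i, 0 < k i) (h1 : ∀ i, k i ≤ M) :
    UnifC n (fun i (_ : ℝ) => k i) :=
  UnifC.const (M := M) fun i => (abs_of_pos (h0 i)).trans_le (h1 i)

end Params

/-! ### Characteristic roots and layer rates. -/

/-- The discriminant of the characteristic equation, scaled to size one. -/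
def scaledDisc (b c : ℝ → ℝ) (i : Params) (x : ℝ) : ℝ :=
  √(i.th2 ^ 2 * b x ^ 2 + 4 * i.th1 * c x)

section Roots

variable {b c : ℝ → ℝ}

theorem scaledDisc_arg_pos (hb : ∀ x, 0 < b x) (hc : ∀ x, 0 < c x) (i : Params) (x : ℝ) :
    0 < i.th2 ^ 2 * b x ^ 2 + 4 * i.th1 * c x := by
  have := hb x; have := hc x; have := i.th1_pos; positivity

theorem scaledDisc_pos (hb : ∀ x, 0 < b x) (hc : ∀ x, 0 < c x) (i : Params) (x : ℝ) :
    0 < scaledDisc b c i x := Real.sqrt_pos.mpr (scaledDisc_arg_pos hb hc i x)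

theorem scaledDisc_sq (hb : ∀ x, 0 < b x) (hc : ∀ x, 0 < c x) (i : Params) (x : ℝ) :
    scaledDisc b c i x ^ 2 = i.th2 ^ 2 * b x ^ 2 + 4 * i.th1 * c x :=
  Real.sq_sqrt (scaledDisc_arg_pos hb hc i x).le

/-- The weights `th2 ^ 2` and `th1` add up to one, so the value is at least the smaller of the lower
bounds `lam ^ 2` and `β`. -/
theorem exists_scaledDisc_lower {lam β : ℝ} (hlam : 0 < lam) (hβ : 0 < β)
    (hb : ∀ x ∈ Icc (0 : ℝ) 1, lam ≤ b x) (hc : ∀ x ∈ Icc (0 : ℝ) 1, β ≤ c x) :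
    ∃ κ, 0 < κ ∧ ∀ i : Params, ∀ x ∈ Icc (0 : ℝ) 1,
      κ ≤ i.th2 ^ 2 * b x ^ 2 + 4 * i.th1 * c x := by
  refine ⟨min (lam ^ 2) β, lt_min (by positivity) hβ, fun i x hx => ?_⟩
  have h1 : lam ^ 2 ≤ b x ^ 2 := pow_le_pow_left₀ hlam.le (hb x hx) 2
  have h2 := hc x hx
  have h3 := i.th1_pos
  have e : min (lam ^ 2) β = i.th2 ^ 2 * min (lam ^ 2) β + i.th1 * min (lam ^ 2) β := by
    rw [← add_mul, i.th_add, one_mul]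
  have h4 : i.th2 ^ 2 * min (lam ^ 2) β ≤ i.th2 ^ 2 * b x ^ 2 :=
    mul_le_mul_of_nonneg_left ((min_le_left _ _).trans h1) (sq_nonneg _)
  have h5 : i.th1 * min (lam ^ 2) β ≤ i.th1 * c x :=
    mul_le_mul_of_nonneg_left ((min_le_right _ _).trans h2) h3.le
  have h6 : 0 ≤ i.th1 * c x := mul_nonneg h3.le (hβ.le.trans h2)
  linarith

theorem sqrt_disc_eq (i : Params) (x : ℝ) :
    √(i.e2 ^ 2 * b x ^ 2 + 4 * i.e1 * c x) = i.delta * scaledDisc b c i x := by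
  have : i.e2 ^ 2 * b x ^ 2 + 4 * i.e1 * c x
      = i.delta ^ 2 * (i.th2 ^ 2 * b x ^ 2 + 4 * i.th1 * c x) := by
    rw [i.e2_eq, i.e1_eq]; ring
  rw [this, Real.sqrt_mul (sq_nonneg _), Real.sqrt_sq i.delta_pos.le, scaledDisc]

theorem charRoot0_eq (i : Params) (x : ℝ) : charRoot0 i.e1 i.e2 b c x
      = (i.e2 * b x - i.delta * scaledDisc b c i x) / (2 * i.e1) := by
  rw [charRoot0, sqrt_disc_eq]

theorem charRoot1_eq (i : Params) (x : ℝ) : charRoot1 i.e1 i.e2 b c x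
      = (i.e2 * b x + i.delta * scaledDisc b c i x) / (2 * i.e1) := by
  rw [charRoot1, sqrt_disc_eq]

/-- The rationalised form avoids the cancellation between `ε₂ b` and the square root when `ε₁` is
small compared with `ε₂²`. It exhibits the root as `δ⁻¹` times a function that is smooth uniformly
in the parameters. -/
theorem charRoot0_eq' (hb : ∀ x, 0 < b x) (hc : ∀ x, 0 < c x) (i : Params) (x : ℝ) :
    charRoot0 i.e1 i.e2 b c x
      = i.delta⁻¹ * (-(2 * c x * (i.th2 * b x + scaledDisc b c i x)⁻¹)) := by
  have h := scaledDisc_sq hb hc i x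
  have hd := scaledDisc_pos hb hc i x
  have h2 := mul_pos i.th2_pos (hb x)
  have h3 : i.th2 * b x + scaledDisc b c i x ≠ 0 := by positivity
  have h4 := i.delta_pos
  have h5 := i.th1_pos
  rw [charRoot0_eq, i.e2_eq, i.e1_eq]
  field_simp
  linear_combination (-1 : ℝ) * h

theorem charRoot1_eq' (i : Params) (x : ℝ) :
    charRoot1 i.e1 i.e2 b c x
      = i.delta / i.e1 * ((i.th2 * b x + scaledDisc b c i x) * 2⁻¹) := by
  have h4 := i.e1_pos
  rw [charRoot1_eq, i.e2_eq]
  field_simp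

variable {n : ℕ} {lam β : ℝ}

theorem unifC_scaledDisc (hb : ContDiff ℝ n b) (hc : ContDiff ℝ n c) (hb0 : ∀ x, 0 < b x)
    (hc0 : ∀ x, 0 < c x) (hlam : 0 < lam) (hβ : 0 < β) (hbl : ∀ x ∈ Icc (0 : ℝ) 1, lam ≤ b x)
    (hcl : ∀ x ∈ Icc (0 : ℝ) 1, β ≤ c x) : UnifC n (scaledDisc b c) := by
  obtain ⟨κ, hκ, hl⟩ := exists_scaledDisc_lower hlam hβ hbl hcl
  refine UnifC.sqrt hκ ?_ (scaledDisc_arg_pos hb0 hc0) hl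
  have h1 : UnifC n (fun (i : Params) (_ : ℝ) => i.th1) :=
    Params.unifC_const Params.th1_pos Params.th1_le
  have h2 : UnifC n (fun (i : Params) (_ : ℝ) => i.th2) :=
    Params.unifC_const Params.th2_pos Params.th2_le
  have hB : UnifC n (fun (_ : Params) => b) := UnifC.of_contDiff hb
  have hC : UnifC n (fun (_ : Params) => c) := UnifC.of_contDiff hc
  have h4 : UnifC n (fun (_ : Params) (_ : ℝ) => (4 : ℝ)) :=
    UnifC.const (M := 4) (by simp)
  simpa only [sq] using ((h2.mul h2).mul (hB.mul hB)).add ((h4.mul h1).mul hC)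

theorem exists_disc_lower (hlam : 0 < lam) (hβ : 0 < β)
    (hbl : ∀ x ∈ Icc (0 : ℝ) 1, lam ≤ b x) (hcl : ∀ x ∈ Icc (0 : ℝ) 1, β ≤ c x) :
    ∃ κ, 0 < κ ∧ ∀ i, ∀ x ∈ Icc (0 : ℝ) 1, κ ≤ scaledDisc b c i x := by
  obtain ⟨κ, hκ, hl⟩ := exists_scaledDisc_lower hlam hβ hbl hcl
  exact ⟨√κ, Real.sqrt_pos.mpr hκ, fun i x hx => Real.sqrt_le_sqrt (hl i x hx)⟩

/-- Bounds for the layer rates in terms of `δ = √(ε₂² + ε₁)`. -/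
theorem exists_mu_bounds (hb : ContDiff ℝ 0 b) (hc : ContDiff ℝ 0 c) (hb0 : ∀ x, 0 < b x)
    (hc0 : ∀ x, 0 < c x) (hlam : 0 < lam) (hβ : 0 < β) (hbl : ∀ x ∈ Icc (0 : ℝ) 1, lam ≤ b x)
    (hcl : ∀ x ∈ Icc (0 : ℝ) 1, β ≤ c x) :
    ∃ C, 0 < C ∧ ∀ i : Params,
      (∀ x ∈ Icc (0 : ℝ) 1, charRoot0 i.e1 i.e2 b c x ≤ -mu0 i.e1 i.e2 b c) ∧
      (∀ x ∈ Icc (0 : ℝ) 1, mu1 i.e1 i.e2 b c ≤ charRoot1 i.e1 i.e2 b c x) ∧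
      0 < mu0 i.e1 i.e2 b c ∧ mu0 i.e1 i.e2 b c ≤ mu1 i.e1 i.e2 b c ∧
      mu0 i.e1 i.e2 b c * i.delta ≤ C ∧ i.delta⁻¹ ≤ C * mu0 i.e1 i.e2 b c ∧
      i.delta / i.e1 ≤ C * mu1 i.e1 i.e2 b c := by
  obtain ⟨κ, hκ, hl⟩ := exists_disc_lower hlam hβ hbl hcl
  obtain ⟨M, hM⟩ := (unifC_scaledDisc (n := 0) hb hc hb0 hc0 hlam hβ hbl hcl).bdd
  obtain ⟨B, hB⟩ := (UnifC.of_contDiff (I := Params) (n := 0) hb).bdd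
  obtain ⟨K, hK⟩ := (UnifC.of_contDiff (I := Params) (n := 0) hc).bdd
  have hne : (Icc (0 : ℝ) 1).Nonempty := ⟨0, by simp⟩
  have h0 : (0 : ℝ) ∈ Icc (0 : ℝ) 1 := by simp
  have hlow0 : ∀ i : Params, ∀ x ∈ Icc (0 : ℝ) 1,
      charRoot0 i.e1 i.e2 b c x ≤ -(i.delta⁻¹ * (2 * β * (B + M)⁻¹)) := by
    intro i x hx
    have hd := scaledDisc_pos hb0 hc0 i x
    have h2 := mul_pos i.th2_pos (hb0 x)
    rw [charRoot0_eq' hb0 hc0, mul_neg, neg_le_neg_iff]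
    refine mul_le_mul_of_nonneg_left ?_ (inv_nonneg.mpr i.delta_pos.le)
    have h3 : i.th2 * b x + scaledDisc b c i x ≤ B + M := by
      have := (le_abs_self _).trans (hM i x hx)
      have := (le_abs_self _).trans (hB i x hx)
      have := mul_le_mul_of_nonneg_right i.th2_le (hb0 x).le
      linarith
    have h5 : (B + M)⁻¹ ≤ (i.th2 * b x + scaledDisc b c i x)⁻¹ := inv_anti₀ (by linarith) h3
    have h6 : 0 < (B + M)⁻¹ := inv_pos.mpr (by linarith)
    have h7 := hcl x hx
    exact mul_le_mul (by linarith) h5 h6.le (by linarith [hc0 x])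
  have hBM : ∀ i : Params, 0 < B + M := fun i => by
    have h1 := (le_abs_self _).trans (hM i 0 h0)
    have h2 := (le_abs_self _).trans (hB i 0 h0)
    linarith [scaledDisc_pos hb0 hc0 i 0, hb0 0]
  have hlow1 : ∀ i : Params, ∀ x ∈ Icc (0 : ℝ) 1,
      i.delta / i.e1 * (κ * 2⁻¹) ≤ charRoot1 i.e1 i.e2 b c x := by
    intro i x hx
    rw [charRoot1_eq']
    refine mul_le_mul_of_nonneg_left ?_ (div_pos i.delta_pos i.e1_pos).le
    have h2 := mul_pos i.th2_pos (hb0 x)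
    linarith [hl i x hx]
  -- A sample parameter pair, needed to read off the signs of `B + M` and `K`.
  let i0 : Params := ⟨(1, 1), by norm_num⟩
  have hBM' : 0 < B + M := hBM i0
  have hKp : 0 < K := by
    have := (le_abs_self _).trans (hK i0 0 h0)
    linarith [hc0 0]
  -- One summand for each estimate: `μ₀ δ` from above, `μ₀` from below, `μ₁` from below.
  refine ⟨2 * K * κ⁻¹ + (2 * β * (B + M)⁻¹)⁻¹ + (κ * 2⁻¹)⁻¹, by positivity, fun i => ?_⟩
  have hdp := i.delta_pos
  have hep := i.e1_pos
  have hA : ∀ x ∈ Icc (0 : ℝ) 1, charRoot0 i.e1 i.e2 b c x ≤ -mu0 i.e1 i.e2 b c := by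
    intro x hx
    rw [mu0, neg_neg]
    refine le_csSup ⟨-(i.delta⁻¹ * (2 * β * (B + M)⁻¹)), ?_⟩ (mem_image_of_mem _ hx)
    rintro _ ⟨y, hy, rfl⟩
    exact hlow0 i y hy
  have hB1 : ∀ x ∈ Icc (0 : ℝ) 1, mu1 i.e1 i.e2 b c ≤ charRoot1 i.e1 i.e2 b c x := by
    intro x hx
    refine csInf_le ⟨i.delta / i.e1 * (κ * 2⁻¹), ?_⟩ (mem_image_of_mem _ hx)
    rintro _ ⟨y, hy, rfl⟩
    exact hlow1 i y hy
  have hmu0 : i.delta⁻¹ * (2 * β * (B + M)⁻¹) ≤ mu0 i.e1 i.e2 b c := by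
    rw [mu0, le_neg]
    refine csSup_le (hne.image _) ?_
    rintro _ ⟨y, hy, rfl⟩
    exact hlow0 i y hy
  have hmu1 : i.delta / i.e1 * (κ * 2⁻¹) ≤ mu1 i.e1 i.e2 b c := by
    refine le_csInf (hne.image _) ?_
    rintro _ ⟨y, hy, rfl⟩
    exact hlow1 i y hy
  have hm0p : 0 < mu0 i.e1 i.e2 b c := lt_of_lt_of_le (by positivity) hmu0
  have hm01 : mu0 i.e1 i.e2 b c ≤ mu1 i.e1 i.e2 b c := by
    refine le_csInf (hne.image _) ?_
    rintro _ ⟨y, hy, rfl⟩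
    have h := hA y hy
    -- Holds because the two roots have sum `ε₂ b / ε₁ > 0`.
    have h' : -charRoot0 i.e1 i.e2 b c y ≤ charRoot1 i.e1 i.e2 b c y := by
      rw [charRoot0, charRoot1, ← neg_div]
      refine div_le_div_of_nonneg_right ?_ (by positivity)
      have := mul_pos i.e2_pos (hb0 y)
      linarith
    linarith
  have hm1p : 0 < mu1 i.e1 i.e2 b c := hm0p.trans_le hm01
  refine ⟨hA, hB1, hm0p, hm01, ?_, ?_, ?_⟩
  · have h := hA 0 h0
    rw [charRoot0_eq' hb0 hc0] at h
    have hd := hl i 0 h0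
    have h2 := mul_pos i.th2_pos (hb0 0)
    have h3 : (i.th2 * b 0 + scaledDisc b c i 0)⁻¹ ≤ κ⁻¹ := inv_anti₀ hκ (by linarith)
    have h4 := (le_abs_self _).trans (hK i 0 h0)
    have h5 : 2 * c 0 * (i.th2 * b 0 + scaledDisc b c i 0)⁻¹ ≤ 2 * K * κ⁻¹ :=
      mul_le_mul (by linarith) h3 (inv_nonneg.mpr (by linarith)) (by linarith)
    have h6 : mu0 i.e1 i.e2 b c * i.delta
        ≤ i.delta⁻¹ * (2 * c 0 * (i.th2 * b 0 + scaledDisc b c i 0)⁻¹) * i.delta :=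
      mul_le_mul_of_nonneg_right (by linarith) hdp.le
    rw [mul_right_comm, inv_mul_cancel₀ hdp.ne', one_mul] at h6
    have : 0 < (2 * β * (B + M)⁻¹)⁻¹ := by positivity
    have : 0 < (κ * 2⁻¹)⁻¹ := by positivity
    linarith
  · have h1 : i.delta⁻¹ ≤ (2 * β * (B + M)⁻¹)⁻¹ * mu0 i.e1 i.e2 b c := by
      rw [← div_eq_inv_mul, le_div_iff₀ (by positivity)]
      exact hmu0
    refine h1.trans (mul_le_mul_of_nonneg_right ?_ hm0p.le)
    have : 0 < 2 * K * κ⁻¹ := by positivity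
    have : 0 < (κ * 2⁻¹)⁻¹ := by positivity
    linarith
  · have h1 : i.delta / i.e1 ≤ (κ * 2⁻¹)⁻¹ * mu1 i.e1 i.e2 b c := by
      rw [← div_eq_inv_mul, le_div_iff₀ (by positivity)]
      exact hmu1
    refine h1.trans (mul_le_mul_of_nonneg_right ?_ hm1p.le)
    have : 0 < 2 * K * κ⁻¹ := by positivity
    have : 0 < (2 * β * (B + M)⁻¹)⁻¹ := by positivity
    linarith

end Roots


/-! ### WKB layer functions. -/

/-- `g₁, g₂, g₃` are the first three derivatives of the `C³` function `g`. -/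
structure HasDerivs3 (g g₁ g₂ g₃ : ℝ → ℝ) : Prop where
  d1 : ∀ x, HasDerivAt g (g₁ x) x
  d2 : ∀ x, HasDerivAt g₁ (g₂ x) x
  d3 : ∀ x, HasDerivAt g₂ (g₃ x) x
  cont : Continuous g₃

theorem hasDerivs3_exp_integral {w w₁ w₂ : ℝ → ℝ} (h1 : ∀ x, HasDerivAt w (w₁ x) x)
    (h2 : ∀ x, HasDerivAt w₁ (w₂ x) x) (h3 : Continuous w₂) (a : ℝ) :
    HasDerivs3 (fun x => Real.exp (∫ t in a..x, w t))
      (fun x => w x * Real.exp (∫ t in a..x, w t))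
      (fun x => (w x ^ 2 + w₁ x) * Real.exp (∫ t in a..x, w t))
      (fun x => (w x ^ 3 + 3 * w x * w₁ x + w₂ x) * Real.exp (∫ t in a..x, w t)) := by
  have hw : Continuous w := continuous_iff_continuousAt.mpr fun x => (h1 x).continuousAt
  have hw1 : Continuous w₁ := continuous_iff_continuousAt.mpr fun x => (h2 x).continuousAt
  have hE : ∀ x, HasDerivAt (fun x => Real.exp (∫ t in a..x, w t))
      (w x * Real.exp (∫ t in a..x, w t)) x := fun x => by
    have := (intervalIntegral.integral_hasDerivAt_right (hw.intervalIntegrable a x)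
        hw.stronglyMeasurable.stronglyMeasurableAtFilter hw.continuousAt).exp
    rwa [mul_comm] at this
  refine ⟨hE, fun x => ?_, fun x => ?_, ?_⟩
  · refine ((h1 x).mul (hE x)).congr_deriv ?_
    ring
  · refine ((((h1 x).pow 2).add (h2 x)).mul (hE x)).congr_deriv ?_
    simp only [Pi.add_apply, Pi.pow_apply]
    push_cast
    ring
  · have : Continuous fun x => Real.exp (∫ t in a..x, w t) :=
      continuous_iff_continuousAt.mpr fun x => (hE x).continuousAt
    fun_prop

section Layers

variable {b c : ℝ → ℝ} {lam β : ℝ}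

/-- The characteristic root with the sign `s = ±1` in front of the square root. -/
def signedRoot (s : ℝ) (b c : ℝ → ℝ) (i : Params) (x : ℝ) : ℝ :=
  (i.e2 * b x + s * (i.delta * scaledDisc b c i x)) / (2 * i.e1)

/-- The logarithmic derivative of the amplitude in the WKB approximation. -/
def wkbAmp (s : ℝ) (b c : ℝ → ℝ) (i : Params) (x : ℝ) : ℝ :=
  -((s * (i.th2 * deriv b x) + deriv (scaledDisc b c i) x) * ((scaledDisc b c i x)⁻¹ * 2⁻¹))

/-- Inserting a function with logarithmic derivative `g + A` produces terms of two orders that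
cancel: those without `A` and `g'` because `g` is a characteristic root, and the next ones because
`A` is chosen so that `A (ε₂ b - 2 ε₁ g) = ε₁ g'`. Only `ε₁ (A² + A')` survives. The sign `s` treats
both layers at once. -/
theorem wkb_residual {s e1 e2 dl th b b' c d d' g g' A A' E : ℝ} (hs : s ^ 2 = 1)
    (he1 : e1 ≠ 0) (he2 : e2 = dl * th) (hd : d ≠ 0)
    (hD : (dl * d) ^ 2 = e2 ^ 2 * b ^ 2 + 4 * e1 * c)
    (hg : g = (e2 * b + s * (dl * d)) / (2 * e1)) (hg' : g' = (e2 * b' + s * (dl * d')) / (2 * e1))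
    (hA : A = -((s * (th * b') + d') * (d⁻¹ * 2⁻¹))) :
    -e1 * (((g + A) ^ 2 + (g' + A')) * E) + e2 * b * ((g + A) * E) + c * E
      = -e1 * (A ^ 2 + A') * E := by
  have h1 : 2 * e1 * g = e2 * b + s * (dl * d) := by rw [hg]; field_simp
  have h2 : 2 * e1 * g' = e2 * b' + s * (dl * d') := by rw [hg']; field_simp
  have h3 : 2 * d * A = -(s * (th * b') + d') := by rw [hA]; field_simp
  have h0 : 4 * e1 * (-e1 * g ^ 2 + e2 * b * g + c) = 0 := by
    linear_combination (-(2 * e1 * g) + e2 * b - s * (dl * d)) * h1 - hD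
      - (dl * d) ^ 2 * hs
  have h0' : -e1 * g ^ 2 + e2 * b * g + c = 0 := by
    rcases mul_eq_zero.mp h0 with h | h
    · exact absurd h (by simpa using he1)
    · exact h
  have h4 : 2 * (A * (e2 * b - 2 * e1 * g) - e1 * g') = 0 := by
    linear_combination (-(2 * A)) * h1 - h2 - s * dl * h3 + dl * th * b' * hs - b' * he2
  have h5 : A * (e2 * b - 2 * e1 * g) - e1 * g' = 0 := by linarith
  linear_combination E * h0' + E * h5

/-- Here `κ` is the size of the root and `G` its profile, smooth uniformly in the parameters. The
function is the exponential of the integral of root plus amplitude: the amplitude is `O(1)` and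
changes it by a bounded factor, and each derivative costs a factor `κ`. The condition `κ⁻¹ ≤ 2` lets
lower powers of `κ` be absorbed in the highest. All bounds are relative to `E`, so they inherit its
decay. -/
theorem exists_wkb_layer (hb : ContDiff ℝ 3 b) (hc : ContDiff ℝ 3 c) (hb0 : ∀ x, 0 < b x)
    (hc0 : ∀ x, 0 < c x) (hlam : 0 < lam) (hβ : 0 < β) (hbl : ∀ x ∈ Icc (0 : ℝ) 1, lam ≤ b x)
    (hcl : ∀ x ∈ Icc (0 : ℝ) 1, β ≤ c x) {s : ℝ} (hs : s ^ 2 = 1) {κ : Params → ℝ}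
    (hκ : ∀ i, 0 < κ i) (hκ2 : ∀ i, (κ i)⁻¹ ≤ 2) {G : Params → ℝ → ℝ} (hG : UnifC 2 G)
    (hGg : ∀ i x, signedRoot s b c i x = κ i * G i x) {a : ℝ} (ha : a ∈ Icc (0 : ℝ) 1) :
    ∃ M, 0 < M ∧ ∀ i : Params, ∃ E E₁ E₂ E₃ : ℝ → ℝ, HasDerivs3 E E₁ E₂ E₃ ∧ E a = 1 ∧
      ∀ x ∈ Icc (0 : ℝ) 1, 0 < E x ∧ E x ≤ M * Real.exp (∫ t in a..x, signedRoot s b c i t) ∧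
        |E₁ x| ≤ M * κ i * E x ∧ |E₂ x| ≤ M * κ i ^ 2 * E x ∧ |E₃ x| ≤ M * κ i ^ 3 * E x ∧
        |-i.e1 * E₂ x + i.e2 * b x * E₁ x + c x * E x| ≤ M * i.delta ^ 2 * E x := by
  have hd3 : UnifC 3 (scaledDisc b c) := unifC_scaledDisc hb hc hb0 hc0 hlam hβ hbl hcl
  obtain ⟨κ0, hκ0, hl⟩ := exists_disc_lower hlam hβ hbl hcl
  have hdpos := scaledDisc_pos hb0 hc0
  have hA : UnifC 2 (wkbAmp s b c) := by
    have h2 : UnifC 2 (fun (i : Params) (_ : ℝ) => i.th2) :=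
      Params.unifC_const Params.th2_pos Params.th2_le
    have hB : UnifC 3 (fun (_ : Params) => b) := UnifC.of_contDiff hb
    have hs' : UnifC 2 (fun (_ : Params) (_ : ℝ) => s) := UnifC.const (M := |s|) fun _ => le_rfl
    have hh : UnifC 2 (fun (_ : Params) (_ : ℝ) => (2 : ℝ)⁻¹) :=
      UnifC.const (M := |(2 : ℝ)⁻¹|) fun _ => le_rfl
    exact (((hs'.mul (h2.mul hB.deriv)).add hd3.deriv).mul
      ((hd3.pred.inv hκ0 hdpos hl).mul hh)).neg
  have hκi : UnifC 2 (fun (i : Params) (_ : ℝ) => (κ i)⁻¹) :=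
    Params.unifC_const (fun i => inv_pos.mpr (hκ i)) hκ2
  have hW : UnifC 2 (fun i x => G i x + (κ i)⁻¹ * wkbAmp s b c i x) := hG.add (hκi.mul hA)
  obtain ⟨M0, hM0⟩ := hW.bdd
  obtain ⟨M1, hM1⟩ := hW.deriv.bdd
  obtain ⟨M2, hM2⟩ := hW.deriv.deriv.bdd
  obtain ⟨N0, hN0⟩ := hA.bdd
  obtain ⟨N1, hN1⟩ := hA.deriv.bdd
  have nn : ∀ {F : Params → ℝ → ℝ} {M : ℝ}, (∀ i, ∀ x ∈ Icc (0 : ℝ) 1, |F i x| ≤ M) → 0 ≤ M :=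
    fun h => (abs_nonneg _).trans (h ⟨(1, 1), by norm_num⟩ 0 (by simp))
  have p0 := nn hM0
  have p1 := nn hM1
  have p2 := nn hM2
  have q0 := nn hN0
  have q1 := nn hN1
  refine ⟨1 + Real.exp N0 + M0 + (M0 ^ 2 + 2 * M1) + (M0 ^ 3 + 6 * M0 * M1 + 4 * M2)
    + (N0 ^ 2 + N1), by positivity, fun i => ?_⟩
  -- `κ ω` is the logarithmic derivative of the layer function, and `ω` is bounded in `C²` uniformly
  -- in the parameters.
  set ω : ℝ → ℝ := fun x => G i x + (κ i)⁻¹ * wkbAmp s b c i x with hω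
  have hk := hκ i
  have dω : ∀ x, HasDerivAt ω (deriv ω x) x := fun x => hW.hasDerivAt i x
  have dω1 : ∀ x, HasDerivAt (deriv ω) (deriv (deriv ω) x) x := fun x => hW.deriv.hasDerivAt i x
  have cω2 : Continuous (deriv (deriv ω)) := hW.deriv.deriv.continuous i
  have hD := hasDerivs3_exp_integral (fun x => (dω x).const_mul (κ i))
    (fun x => (dω1 x).const_mul (κ i)) (cω2.const_mul (κ i)) a
  refine ⟨_, _, _, _, hD, by simp, fun x hx => ⟨Real.exp_pos _, ?_, ?_⟩⟩
  · have hwsplit : ∀ t, κ i * ω t = signedRoot s b c i t + wkbAmp s b c i t := by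
      intro t
      rw [hGg, hω]
      field_simp
    have cg : Continuous (signedRoot s b c i) := by
      have : signedRoot s b c i = fun x => κ i * G i x := funext (hGg i)
      rw [this]
      exact (hG.continuous i).const_mul _
    have cA : Continuous (wkbAmp s b c i) := hA.continuous i
    have hint : ∫ t in a..x, κ i * ω t
        = (∫ t in a..x, signedRoot s b c i t) + ∫ t in a..x, wkbAmp s b c i t := by
      rw [← intervalIntegral.integral_add (cg.intervalIntegrable _ _) (cA.intervalIntegrable _ _)]
      exact intervalIntegral.integral_congr fun t _ => hwsplit t
    have hle : ∫ t in a..x, wkbAmp s b c i t ≤ N0 := by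
      have h := intervalIntegral.norm_integral_le_of_norm_le_const (a := a) (b := x) (C := N0)
        (f := wkbAmp s b c i) fun t ht => hN0 i t <| by
          have := uIoc_subset_uIcc ht
          exact uIcc_subset_Icc ha hx this
      have h1 : |x - a| ≤ 1 := by
        rw [abs_le]; constructor <;> linarith [hx.1, hx.2, ha.1, ha.2]
      calc _ ≤ _ := le_abs_self _
        _ ≤ N0 * |x - a| := h
        _ ≤ N0 * 1 := mul_le_mul_of_nonneg_left h1 q0
        _ = N0 := mul_one _
    simp only [hint, Real.exp_add]
    rw [mul_comm]
    refine mul_le_mul_of_nonneg_right ?_ (Real.exp_pos _).le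
    have := Real.exp_le_exp.mpr hle
    have : 0 ≤ 1 + M0 + (M0 ^ 2 + 2 * M1) + (M0 ^ 3 + 6 * M0 * M1 + 4 * M2)
      + (N0 ^ 2 + N1) := by positivity
    linarith
  · have hwsplit : ∀ t, κ i * ω t = signedRoot s b c i t + wkbAmp s b c i t := by
      intro t
      rw [hGg, hω]
      field_simp
    have e0 : |ω x| ≤ M0 := hM0 i x hx
    have e1 : |deriv ω x| ≤ M1 := hM1 i x hx
    have e2 : |deriv (deriv ω) x| ≤ M2 := hM2 i x hx
    have f0 := hN0 i x hx
    have f1 := hN1 i x hx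
    have r := hκ2 i
    have rp : 0 < (κ i)⁻¹ := inv_pos.mpr hk
    set E := Real.exp (∫ t in a..x, κ i * ω t) with hE
    have Ep : 0 < E := Real.exp_pos _
    have hx0 : 0 ≤ Real.exp N0 := (Real.exp_pos _).le
    have P2 : 0 ≤ M0 ^ 2 + 2 * M1 := by positivity
    have P3 : 0 ≤ M0 ^ 3 + 6 * M0 * M1 + 4 * M2 := by positivity
    have P4 : 0 ≤ N0 ^ 2 + N1 := by positivity
    refine ⟨?_, ?_, ?_, ?_⟩
    · rw [abs_mul, abs_mul, abs_of_pos hk, abs_of_pos Ep]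
      refine mul_le_mul_of_nonneg_right ?_ Ep.le
      rw [mul_comm]
      exact mul_le_mul_of_nonneg_right (by linarith) hk.le
    · have id2 : (κ i * ω x) ^ 2 + κ i * deriv ω x
          = κ i ^ 2 * (ω x ^ 2 + (κ i)⁻¹ * deriv ω x) := by field_simp
      rw [abs_mul, abs_of_pos Ep, id2, abs_mul, abs_of_pos (pow_pos hk 2)]
      refine mul_le_mul_of_nonneg_right ?_ Ep.le
      rw [mul_comm]
      refine mul_le_mul_of_nonneg_right ?_ (pow_pos hk 2).le
      have h1 : |ω x ^ 2 + (κ i)⁻¹ * deriv ω x| ≤ M0 ^ 2 + 2 * M1 := by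
        refine (abs_add_le _ _).trans (add_le_add ?_ ?_)
        · rw [abs_pow]; exact pow_le_pow_left₀ (abs_nonneg _) e0 2
        · rw [abs_mul, abs_of_pos rp]; exact mul_le_mul r e1 (abs_nonneg _) zero_le_two
      linarith
    · have id3 : (κ i * ω x) ^ 3 + 3 * (κ i * ω x) * (κ i * deriv ω x) + κ i * deriv (deriv ω) x
          = κ i ^ 3 * (ω x ^ 3 + 3 * ((κ i)⁻¹ * (ω x * deriv ω x))
            + (κ i)⁻¹ ^ 2 * deriv (deriv ω) x) := by field_simp
      rw [abs_mul, abs_of_pos Ep, id3, abs_mul, abs_of_pos (pow_pos hk 3)]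
      refine mul_le_mul_of_nonneg_right ?_ Ep.le
      rw [mul_comm]
      refine mul_le_mul_of_nonneg_right ?_ (pow_pos hk 3).le
      have h1 : |ω x ^ 3 + 3 * ((κ i)⁻¹ * (ω x * deriv ω x)) + (κ i)⁻¹ ^ 2 * deriv (deriv ω) x|
          ≤ M0 ^ 3 + 3 * (2 * (M0 * M1)) + 2 ^ 2 * M2 := by
        refine (abs_add_le _ _).trans (add_le_add ((abs_add_le _ _).trans (add_le_add ?_ ?_)) ?_)
        · rw [abs_pow]; exact pow_le_pow_left₀ (abs_nonneg _) e0 3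
        · rw [abs_mul, abs_mul, abs_mul, abs_of_pos rp, abs_of_pos (by norm_num : (0 : ℝ) < 3)]
          gcongr
        · rw [abs_mul, abs_pow, abs_of_pos rp]
          gcongr
      linarith
    · have dg : HasDerivAt (signedRoot s b c i)
          ((i.e2 * deriv b x + s * (i.delta * deriv (scaledDisc b c i) x)) / (2 * i.e1)) x :=
        ((((hb.differentiable (by norm_num) x).hasDerivAt).const_mul i.e2).add
          (((hd3.hasDerivAt i x).const_mul i.delta).const_mul s)).div_const _
      have dA := hA.hasDerivAt i x
      have d1 : κ i * deriv ω x = (i.e2 * deriv b x + s * (i.delta * deriv (scaledDisc b c i) x))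
          / (2 * i.e1) + deriv (wkbAmp s b c i) x := by
        have h := (dω x).const_mul (κ i)
        have h' := dg.add dA
        have e : (fun y => κ i * ω y) = signedRoot s b c i + wkbAmp s b c i :=
          funext fun t => hwsplit t
        rw [e] at h
        exact h.unique h'
      have hDsq : (i.delta * scaledDisc b c i x) ^ 2 = i.e2 ^ 2 * b x ^ 2 + 4 * i.e1 * c x := by
        rw [mul_pow, scaledDisc_sq hb0 hc0, i.e2_eq, i.e1_eq]
        ring
      rw [hwsplit, d1, wkb_residual hs i.e1_pos.ne' i.e2_eq (hdpos i x).ne' hDsq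
        (g := signedRoot s b c i x) rfl rfl (A := wkbAmp s b c i x) rfl,
        abs_mul, abs_of_pos Ep]
      refine mul_le_mul_of_nonneg_right ?_ Ep.le
      rw [abs_mul, abs_neg, abs_of_pos i.e1_pos]
      have h1 : |wkbAmp s b c i x ^ 2 + deriv (wkbAmp s b c i) x| ≤ N0 ^ 2 + N1 := by
        refine (abs_add_le _ _).trans (add_le_add ?_ f1)
        rw [abs_pow]; exact pow_le_pow_left₀ (abs_nonneg _) f0 2
      rw [mul_comm]
      exact mul_le_mul (by linarith) i.e1_le_delta_sq i.e1_pos.le (by positivity)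

end Layers


/-! ### The explicit approximation of the solution. -/

/-- An approximation `S + E + F` of the solution: a smooth part, a layer at `0` and a layer at
`1`, whose residual is of the order `μ₀⁻²`. -/
structure IsDecomposition (C e1 e2 m0 m1 : ℝ) (b c f S S₁ S₂ E E₁ E₂ E₃ F F₁ F₂ : ℝ → ℝ) :
    Prop where
  S_d1 : ∀ x, HasDerivAt S (S₁ x) x
  S_d2 : ∀ x, HasDerivAt S₁ (S₂ x) x
  S_cont : Continuous S₂
  E_d : HasDerivs3 E E₁ E₂ E₃
  F_d1 : ∀ x, HasDerivAt F (F₁ x) x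
  F_d2 : ∀ x, HasDerivAt F₁ (F₂ x) x
  F_cont : Continuous F₂
  left : S 0 + E 0 + F 0 = 0
  right : S 1 + E 1 + F 1 = 0
  S_bdd : ∀ x ∈ Icc (0 : ℝ) 1, |S₂ x| ≤ C
  E_bdd0 : ∀ x ∈ Icc (0 : ℝ) 1, |E x| ≤ C * Real.exp (-(m0 * x))
  E_bdd1 : ∀ x ∈ Icc (0 : ℝ) 1, |E₁ x| ≤ C * m0 * Real.exp (-(m0 * x))
  E_bdd2 : ∀ x ∈ Icc (0 : ℝ) 1, |E₂ x| ≤ C * m0 ^ 2 * Real.exp (-(m0 * x))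
  E_bdd3 : ∀ x ∈ Icc (0 : ℝ) 1, |E₃ x| ≤ C * m0 ^ 3 * Real.exp (-(m0 * x))
  F_bdd0 : ∀ x ∈ Icc (0 : ℝ) 1, |F x| ≤ C * Real.exp (-(m1 * (1 - x)))
  F_bdd1 : ∀ x ∈ Icc (0 : ℝ) 1, |F₁ x| ≤ C * m1 * Real.exp (-(m1 * (1 - x)))
  F_bdd2 : ∀ x ∈ Icc (0 : ℝ) 1, |F₂ x| ≤ C * m1 ^ 2 * Real.exp (-(m1 * (1 - x)))
  residual : ∀ x ∈ Icc (0 : ℝ) 1, |-e1 * (S₂ x + E₂ x + F₂ x) + e2 * b x * (S₁ x + E₁ x + F₁ x)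
    + c x * (S x + E x + F x) - f x| ≤ C / m0 ^ 2

theorem exp_neg_le_two_div_sq {x : ℝ} (hx : 0 < x) : Real.exp (-x) ≤ 2 / x ^ 2 := by
  have h := Real.quadratic_le_exp_of_nonneg hx.le
  rw [Real.exp_neg, inv_le_comm₀ (Real.exp_pos _) (by positivity), inv_div]
  linarith

section

variable {b c f : ℝ → ℝ} {lam β : ℝ}

-- The outer expansion `T = f/c - ε₂ b (f/c)'/c` cancels the terms of order `1` and `ε₂`, leaving
-- `O(ε₁ + ε₂²) = O(δ²)`. The WKB layers `U` and `V`, equal to one at their own end point, remove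
-- the boundary values of `T`. What each leaves at the other end is at most a multiple of `exp(-μ₀)
-- ≤ 2 μ₀⁻²`; a linear function removes it without changing second derivatives.
set_option maxHeartbeats 1000000 in
theorem exists_decomposition (hb : ContDiff ℝ 3 b) (hc : ContDiff ℝ 3 c) (hf : ContDiff ℝ 3 f)
    (hb0 : ∀ x, 0 < b x)
    (hc0 : ∀ x, 0 < c x) (hlam : 0 < lam) (hβ : 0 < β) (hbl : ∀ x ∈ Icc (0 : ℝ) 1, lam ≤ b x)
    (hcl : ∀ x ∈ Icc (0 : ℝ) 1, β ≤ c x) :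
    ∃ C, 0 < C ∧ ∀ i : Params,
      0 < mu0 i.e1 i.e2 b c ∧ mu0 i.e1 i.e2 b c ≤ mu1 i.e1 i.e2 b c ∧
      i.e2 * mu0 i.e1 i.e2 b c ≤ C ∧ i.e2 ≤ C * (i.e1 * mu1 i.e1 i.e2 b c) ∧
      ∃ S S₁ S₂ E E₁ E₂ E₃ F F₁ F₂ : ℝ → ℝ,
        IsDecomposition C i.e1 i.e2 (mu0 i.e1 i.e2 b c) (mu1 i.e1 i.e2 b c) b c f
          S S₁ S₂ E E₁ E₂ E₃ F F₁ F₂ := by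
  have h02 : (0 : WithTop ℕ∞) ≤ 3 := by norm_num
  obtain ⟨K, hK, hmu⟩ := exists_mu_bounds (hb.of_le h02) (hc.of_le h02) hb0 hc0 hlam hβ hbl hcl
  obtain ⟨κ0, hκ0, hl⟩ := exists_disc_lower hlam hβ hbl hcl
  have hd3 : UnifC 3 (scaledDisc b c) := unifC_scaledDisc hb hc hb0 hc0 hlam hβ hbl hcl
  have hdpos := scaledDisc_pos hb0 hc0
  have hB : UnifC 3 (fun (_ : Params) => b) := UnifC.of_contDiff hb
  have hC : UnifC 3 (fun (_ : Params) => c) := UnifC.of_contDiff hc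
  have hF : UnifC 3 (fun (_ : Params) => f) := UnifC.of_contDiff hf
  have hsum : UnifC 3 (fun (i : Params) x => i.th2 * b x + scaledDisc b c i x) :=
    ((Params.unifC_const Params.th2_pos Params.th2_le).mul hB).add hd3
  have hsum0 : ∀ (i : Params) x, 0 < i.th2 * b x + scaledDisc b c i x := fun i x =>
    add_pos (mul_pos i.th2_pos (hb0 x)) (hdpos i x)
  have hconst : ∀ k : ℝ, UnifC 3 (fun (_ : Params) (_ : ℝ) => k) := fun k =>
    UnifC.const (M := |k|) fun _ => le_rfl
  have hG0 : UnifC 3 (fun (i : Params) x => -(2 * c x * (i.th2 * b x + scaledDisc b c i x)⁻¹)) :=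
    (((hconst 2).mul hC).mul (hsum.inv hκ0 hsum0 fun i x hx =>
      (hl i x hx).trans (le_add_of_nonneg_left (mul_pos i.th2_pos (hb0 x)).le))).neg
  have hG1 : UnifC 3 (fun (i : Params) x => (i.th2 * b x + scaledDisc b c i x) * 2⁻¹) :=
    hsum.mul (hconst _)
  obtain ⟨ML, hML, hL⟩ := exists_wkb_layer hb hc hb0 hc0 hlam hβ hbl hcl (s := -1) (by norm_num)
    (κ := fun i => i.delta⁻¹) (fun i => inv_pos.mpr i.delta_pos)
    (fun i => by rw [inv_inv]; exact i.delta_le) hG0.pred (fun i x => by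
      rw [← charRoot0_eq' hb0 hc0, charRoot0_eq, signedRoot]; ring) (a := 0) (by simp)
  obtain ⟨MR, hMR, hR⟩ := exists_wkb_layer hb hc hb0 hc0 hlam hβ hbl hcl (s := 1) (by norm_num)
    (κ := fun i => i.delta / i.e1) (fun i => div_pos i.delta_pos i.e1_pos)
    (fun i => by
      rw [inv_div, div_le_iff₀ i.delta_pos]
      have h1 := i.e1_le_delta_sq
      have h2 := i.delta_le
      have h3 := i.delta_pos
      nlinarith) hG1.pred (fun i x => by
      rw [← charRoot1_eq', charRoot1_eq, signedRoot]; ring) (a := 1) (by simp)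
  have hs0 : UnifC 3 (fun (_ : Params) x => f x * (c x)⁻¹) :=
    hF.mul (hC.inv hβ (fun _ => hc0) (fun _ => hcl))
  have hs1 : UnifC 2 (fun (_ : Params) x => -(b x * deriv (fun x => f x * (c x)⁻¹) x * (c x)⁻¹)) :=
    ((hB.pred.mul hs0.deriv).mul (hC.pred.inv hβ (fun _ => hc0) (fun _ => hcl))).neg
  have hT : UnifC 2 (fun (i : Params) x => f x * (c x)⁻¹
      + i.e2 * -(b x * deriv (fun x => f x * (c x)⁻¹) x * (c x)⁻¹)) :=
    hs0.pred.add ((Params.unifC_const Params.e2_pos Params.e2_le).mul hs1)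
  obtain ⟨T0, hT0⟩ := hT.bdd
  obtain ⟨T2, hT2⟩ := hT.deriv.deriv.bdd
  obtain ⟨D1, hD1⟩ := hs1.deriv.bdd
  obtain ⟨B0, hB0⟩ := hB.bdd
  obtain ⟨C0, hC0⟩ := hC.bdd
  have nn : ∀ {F : Params → ℝ → ℝ} {M : ℝ}, (∀ i, ∀ x ∈ Icc (0 : ℝ) 1, |F i x| ≤ M) → 0 ≤ M :=
    fun h => (abs_nonneg _).trans (h ⟨(1, 1), by norm_num⟩ 0 (by simp))
  have pT0 := nn hT0
  have pT2 := nn hT2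
  have pD1 := nn hD1
  have pB0 := nn hB0
  have pC0 := nn hC0
  set M := 1 + ML + MR with hM
  have hM1 : 1 ≤ M := by linarith
  set A := T0 * M * M * (1 + K) ^ 3 with hA
  have pA : 0 ≤ A := by positivity
  set R := (T2 + B0 * D1 + 2 * (T0 * (M * M))) * K ^ 2
    + (B0 * (2 * (T0 * (2 * M))) + C0 * (2 * (T0 * (2 * M)))) with hRdef
  have pR : 0 ≤ R := by positivity
  refine ⟨1 + K + T2 + A + R, by positivity, fun i => ?_⟩
  obtain ⟨hg0, hg1, m0p, m01, hKd, hKi, hKe⟩ := hmu i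
  set m0 := mu0 i.e1 i.e2 b c with hm0
  set m1 := mu1 i.e1 i.e2 b c with hm1
  have m1p : 0 < m1 := m0p.trans_le m01
  have dp := i.delta_pos
  have ep := i.e1_pos
  refine ⟨m0p, m01, ?_, ?_, ?_⟩
  · have h1 : i.e2 * m0 ≤ i.delta * m0 := mul_le_mul_of_nonneg_right i.e2_le_delta m0p.le
    linarith
  · rw [div_le_iff₀ ep] at hKe
    have h1 : 0 ≤ (1 + T2 + A + R) * (i.e1 * m1) := by positivity
    have := i.e2_le_delta
    linarith
  obtain ⟨U, U₁, U₂, U₃, hU, hU0, hUb⟩ := hL i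
  obtain ⟨V, V₁, V₂, V₃, hV, hV1, hVb⟩ := hR i
  set s0 : ℝ → ℝ := fun x => f x * (c x)⁻¹ with hs0def
  set s1 : ℝ → ℝ := fun x => -(b x * deriv s0 x * (c x)⁻¹) with hs1def
  set T : ℝ → ℝ := fun x => s0 x + i.e2 * s1 x with hTdef
  have dT : ∀ x, HasDerivAt T (deriv T x) x := fun x => hT.hasDerivAt i x
  have dT1 : ∀ x, HasDerivAt (deriv T) (deriv (deriv T) x) x := fun x => hT.deriv.hasDerivAt i x
  have cT2 : Continuous (deriv (deriv T)) := hT.deriv.deriv.continuous i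
  have c0 : Continuous fun t => charRoot0 i.e1 i.e2 b c t := by
    have : (fun t => charRoot0 i.e1 i.e2 b c t) = _ := funext (charRoot0_eq' hb0 hc0 i)
    rw [this]
    exact (hG0.continuous i).const_mul _
  have c1 : Continuous fun t => charRoot1 i.e1 i.e2 b c t := by
    have : (fun t => charRoot1 i.e1 i.e2 b c t) = _ := funext (charRoot1_eq' i)
    rw [this]
    exact (hG1.continuous i).const_mul _
  have hs0' : signedRoot (-1) b c i = fun t => charRoot0 i.e1 i.e2 b c t := by
    funext x
    rw [charRoot0_eq, signedRoot]; ring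
  have hs1' : signedRoot 1 b c i = fun t => charRoot1 i.e1 i.e2 b c t := by
    funext x
    rw [charRoot1_eq, signedRoot]; ring
  have hUe : ∀ x ∈ Icc (0 : ℝ) 1, U x ≤ M * Real.exp (-(m0 * x)) := by
    intro x hx
    refine (hUb x hx).2.1.trans (mul_le_mul (by linarith) (Real.exp_le_exp.mpr ?_)
      (Real.exp_pos _).le (by linarith))
    rw [hs0']
    have h := intervalIntegral.integral_mono_on hx.1 (c0.intervalIntegrable (μ := volume) 0 x)
      (continuous_const.intervalIntegrable (μ := volume) 0 x)
      (g := fun _ => -m0) fun t ht => hg0 t ⟨ht.1, ht.2.trans hx.2⟩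
    simp at h
    linarith
  have hVe : ∀ x ∈ Icc (0 : ℝ) 1, V x ≤ M * Real.exp (-(m1 * (1 - x))) := by
    intro x hx
    refine (hVb x hx).2.1.trans (mul_le_mul (by linarith) (Real.exp_le_exp.mpr ?_)
      (Real.exp_pos _).le (by linarith))
    rw [hs1', intervalIntegral.integral_symm]
    have h := intervalIntegral.integral_mono_on hx.2
      (continuous_const.intervalIntegrable (μ := volume) x 1)
      (c1.intervalIntegrable (μ := volume) x 1)
      (f := fun _ => m1) fun t ht => hg1 t ⟨hx.1.trans ht.1, ht.2⟩
    simp at h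
    linarith
  have hz : (0 : ℝ) ∈ Icc (0 : ℝ) 1 := by simp
  have ho : (1 : ℝ) ∈ Icc (0 : ℝ) 1 := by simp
  have t0 : |T 0| ≤ T0 := hT0 i 0 hz
  have t1 : |T 1| ≤ T0 := hT0 i 1 ho
  have hUp : ∀ x ∈ Icc (0 : ℝ) 1, U x ≤ M := fun x hx => (hUe x hx).trans <|
    mul_le_of_le_one_right (by linarith) (Real.exp_le_one_iff.mpr (by nlinarith [hx.1]))
  have hVp : ∀ x ∈ Icc (0 : ℝ) 1, V x ≤ M := fun x hx => (hVe x hx).trans <|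
    mul_le_of_le_one_right (by linarith) (Real.exp_le_one_iff.mpr (by nlinarith [hx.2]))
  have hU1 : U 1 ≤ 2 * M / m0 ^ 2 := by
    have h1 := hUe 1 ho
    have h2 := exp_neg_le_two_div_sq m0p
    rw [mul_one] at h1
    calc U 1 ≤ M * (2 / m0 ^ 2) := h1.trans (mul_le_mul_of_nonneg_left h2 (by linarith))
      _ = _ := by ring
  have hV0 : V 0 ≤ 2 * M / m0 ^ 2 := by
    have h1 := hVe 0 hz
    have h2 := exp_neg_le_two_div_sq m0p
    have h3 : Real.exp (-(m1 * (1 - 0))) ≤ Real.exp (-m0) := Real.exp_le_exp.mpr (by linarith)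
    calc V 0 ≤ M * (2 / m0 ^ 2) := h1.trans (mul_le_mul_of_nonneg_left (h3.trans h2) (by linarith))
      _ = _ := by ring
  have hδm : i.delta ^ 2 ≤ K ^ 2 / m0 ^ 2 := by
    rw [le_div_iff₀ (by positivity), ← mul_pow]
    exact pow_le_pow_left₀ (by positivity) (by linarith) 2
  -- Shared by all derivative bounds of both layers: it replaces the size `k` of the root by the
  -- rate `m`, using `k ≤ K m`.
  have generic : ∀ {t g e k m x : ℝ} (n : ℕ), n ≤ 3 → |t| ≤ T0 → 0 < k → k ≤ K * m → 0 < m →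
      0 < e → e ≤ M * x → 0 ≤ x → |g| ≤ M * k ^ n * e →
      |-t * g| ≤ (1 + K + T2 + A + R) * m ^ n * x := by
    intro t g e k m x n hn ht hk hkm hm he hex hx hg
    have h1 : k ^ n ≤ (1 + K) ^ 3 * m ^ n := by
      calc k ^ n ≤ (K * m) ^ n := pow_le_pow_left₀ hk.le hkm n
        _ = K ^ n * m ^ n := mul_pow _ _ _
        _ ≤ (1 + K) ^ 3 * m ^ n := by
          refine mul_le_mul_of_nonneg_right ?_ (by positivity)
          calc K ^ n ≤ (1 + K) ^ n := pow_le_pow_left₀ hK.le (by linarith) n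
            _ ≤ (1 + K) ^ 3 := pow_le_pow_right₀ (by linarith) hn
    calc |-t * g| = |t| * |g| := by rw [abs_mul, abs_neg]
      _ ≤ T0 * (M * ((1 + K) ^ 3 * m ^ n) * (M * x)) := by
        refine mul_le_mul ht (hg.trans ?_) (abs_nonneg _) pT0
        exact mul_le_mul (mul_le_mul_of_nonneg_left h1 (by linarith)) hex he.le (by positivity)
      _ = A * (m ^ n * x) := by rw [hA]; ring
      _ ≤ (1 + K + T2 + A + R) * (m ^ n * x) := by
        refine mul_le_mul_of_nonneg_right (by linarith) (by positivity)
      _ = _ := by ring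
  -- `p` and `p + q` are the values that the linear correction must take at `0` and at `1`.
  set p := T 1 * V 0 with hp
  set q := T 0 * U 1 - p with hq
  have hpb : |p| ≤ T0 * (2 * M / m0 ^ 2) := by
    rw [hp, abs_mul, abs_of_pos (hVb 0 hz).1]
    exact mul_le_mul t1 hV0 (hVb 0 hz).1.le pT0
  have hqb' : |T 0 * U 1| ≤ T0 * (2 * M / m0 ^ 2) := by
    rw [abs_mul, abs_of_pos (hUb 1 ho).1]
    exact mul_le_mul t0 hU1 (hUb 1 ho).1.le pT0
  have hqb : |q| ≤ 2 * (T0 * (2 * M / m0 ^ 2)) := by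
    refine (abs_sub _ _).trans ?_
    linarith
  have MLM : ML ≤ M := by linarith
  have MRM : MR ≤ M := by linarith
  have up : ∀ {g k e a : ℝ}, |g| ≤ a * k * e → 0 ≤ k → 0 ≤ e → a ≤ M → |g| ≤ M * k * e :=
    fun h hk he ha => h.trans (mul_le_mul_of_nonneg_right (mul_le_mul_of_nonneg_right ha hk) he)
  refine ⟨fun x => T x + (p + q * x), fun x => deriv T x + q, fun x => deriv (deriv T) x,
    fun x => -T 0 * U x, fun x => -T 0 * U₁ x, fun x => -T 0 * U₂ x, fun x => -T 0 * U₃ x,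
    fun x => -T 1 * V x, fun x => -T 1 * V₁ x, fun x => -T 1 * V₂ x,
    { S_d1 := fun x => ?_
      S_d2 := fun x => (dT1 x).add_const _
      S_cont := cT2
      E_d := ⟨fun x => (hU.d1 x).const_mul _, fun x => (hU.d2 x).const_mul _,
        fun x => (hU.d3 x).const_mul _, hU.cont.const_mul _⟩
      F_d1 := fun x => (hV.d1 x).const_mul _
      F_d2 := fun x => (hV.d2 x).const_mul _
      F_cont := (continuous_iff_continuousAt.mpr fun x => (hV.d3 x).continuousAt).const_mul _
      left := by rw [hU0, hp]; ring
      right := by rw [hV1, hq, hp]; ring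
      S_bdd := fun x hx => (hT2 i x hx).trans (by linarith)
      E_bdd0 := fun x hx => ?_
      E_bdd1 := fun x hx => ?_
      E_bdd2 := fun x hx => ?_
      E_bdd3 := fun x hx => ?_
      F_bdd0 := fun x hx => ?_
      F_bdd1 := fun x hx => ?_
      F_bdd2 := fun x hx => ?_
      residual := fun x hx => ?_ }⟩
  · have := (dT x).add (((hasDerivAt_id x).const_mul q).const_add p)
    simp only [mul_one] at this
    exact this
  · have h := hUb x hx
    have := generic (k := i.delta⁻¹) (g := U x) 0 (by norm_num) t0 (inv_pos.mpr dp) hKi m0p h.1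
      (hUe x hx) (Real.exp_pos _).le (by
        rw [abs_of_pos h.1, pow_zero, mul_one]; exact le_mul_of_one_le_left h.1.le hM1)
    simpa only [pow_zero, mul_one] using this
  · have h := hUb x hx
    have := generic (k := i.delta⁻¹) (g := U₁ x) 1 (by norm_num) t0 (inv_pos.mpr dp) hKi m0p h.1
      (hUe x hx) (Real.exp_pos _).le
      (by rw [pow_one]; exact up h.2.2.1 (inv_pos.mpr dp).le h.1.le MLM)
    simpa only [pow_one] using this
  · have h := hUb x hx
    exact generic (k := i.delta⁻¹) (g := U₂ x) 2 (by norm_num) t0 (inv_pos.mpr dp) hKi m0p h.1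
      (hUe x hx) (Real.exp_pos _).le
      (up h.2.2.2.1 (pow_pos (inv_pos.mpr dp) 2).le h.1.le MLM)
  · have h := hUb x hx
    exact generic (k := i.delta⁻¹) (g := U₃ x) 3 (by norm_num) t0 (inv_pos.mpr dp) hKi m0p h.1
      (hUe x hx) (Real.exp_pos _).le
      (up h.2.2.2.2.1 (pow_pos (inv_pos.mpr dp) 3).le h.1.le MLM)
  · have h := hVb x hx
    have := generic (k := i.delta / i.e1) (g := V x) 0 (by norm_num) t1 (div_pos dp ep) hKe m1p h.1
      (hVe x hx) (Real.exp_pos _).le (by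
        rw [abs_of_pos h.1, pow_zero, mul_one]; exact le_mul_of_one_le_left h.1.le hM1)
    simpa only [pow_zero, mul_one] using this
  · have h := hVb x hx
    have := generic (k := i.delta / i.e1) (g := V₁ x) 1 (by norm_num) t1 (div_pos dp ep) hKe m1p h.1
      (hVe x hx) (Real.exp_pos _).le
      (by rw [pow_one]; exact up h.2.2.1 (div_pos dp ep).le h.1.le MRM)
    simpa only [pow_one] using this
  · have h := hVb x hx
    exact generic (k := i.delta / i.e1) (g := V₂ x) 2 (by norm_num) t1 (div_pos dp ep) hKe m1p h.1
      (hVe x hx) (Real.exp_pos _).le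
      (up h.2.2.2.1 (pow_pos (div_pos dp ep) 2).le h.1.le MRM)
  · have hcx := hc0 x
    have ds0 : HasDerivAt s0 (deriv s0 x) x := hs0.hasDerivAt i x
    have ds1 : HasDerivAt s1 (deriv s1 x) x := hs1.hasDerivAt i x
    have e1 : deriv T x = deriv s0 x + i.e2 * deriv s1 x :=
      (dT x).unique (ds0.add (ds1.const_mul i.e2))
    have e2 : c x * s0 x = f x := by
      change c x * (f x * (c x)⁻¹) = f x
      rw [mul_left_comm, mul_inv_cancel₀ hcx.ne', mul_one]
    have e3 : c x * s1 x = -(b x * deriv s0 x) := by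
      change c x * -(b x * deriv s0 x * (c x)⁻¹) = _
      rw [mul_neg, mul_left_comm, mul_inv_cancel₀ hcx.ne', mul_one]
    have e4 : c x * T x = f x - i.e2 * (b x * deriv s0 x) := by
      change c x * (s0 x + i.e2 * s1 x) = _
      linear_combination e2 + i.e2 * e3
    have key : -i.e1 * (deriv (deriv T) x + -T 0 * U₂ x + -T 1 * V₂ x)
        + i.e2 * b x * (deriv T x + q + -T 0 * U₁ x + -T 1 * V₁ x)
        + c x * (T x + (p + q * x) + -T 0 * U x + -T 1 * V x) - f x
        = (-i.e1 * deriv (deriv T) x + i.e2 ^ 2 * (b x * deriv s1 x))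
          + (-T 0 * (-i.e1 * U₂ x + i.e2 * b x * U₁ x + c x * U x)
            + -T 1 * (-i.e1 * V₂ x + i.e2 * b x * V₁ x + c x * V x))
          + (i.e2 * (b x * q) + c x * (p + q * x)) := by
      rw [e1]; linear_combination e4
    rw [key]
    have bB : |b x| ≤ B0 := hB0 i x hx
    have bC : |c x| ≤ C0 := hC0 i x hx
    have bT2 : |deriv (deriv T) x| ≤ T2 := hT2 i x hx
    have bD1 : |deriv s1 x| ≤ D1 := hD1 i x hx
    have hU := hUb x hx
    have hV := hVb x hx
    have r1 : |-i.e1 * deriv (deriv T) x + i.e2 ^ 2 * (b x * deriv s1 x)|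
        ≤ i.delta ^ 2 * T2 + i.delta ^ 2 * (B0 * D1) := by
      refine (abs_add_le _ _).trans (add_le_add ?_ ?_)
      · rw [abs_mul, abs_neg, abs_of_pos ep]
        exact mul_le_mul i.e1_le_delta_sq bT2 (abs_nonneg _) (by positivity)
      · rw [abs_mul, abs_mul, abs_of_nonneg (sq_nonneg i.e2)]
        refine mul_le_mul ?_ (mul_le_mul bB bD1 (abs_nonneg _) pB0) (by positivity) (by positivity)
        exact pow_le_pow_left₀ i.e2_pos.le i.e2_le_delta 2
    have r2 : |-T 0 * (-i.e1 * U₂ x + i.e2 * b x * U₁ x + c x * U x)|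
        ≤ T0 * (M * i.delta ^ 2 * M) := by
      rw [abs_mul, abs_neg]
      refine mul_le_mul t0 (hU.2.2.2.2.2.trans ?_) (abs_nonneg _) pT0
      exact mul_le_mul (mul_le_mul_of_nonneg_right MLM (by positivity)) (hUp x hx) hU.1.le
        (by positivity)
    have r3 : |-T 1 * (-i.e1 * V₂ x + i.e2 * b x * V₁ x + c x * V x)|
        ≤ T0 * (M * i.delta ^ 2 * M) := by
      rw [abs_mul, abs_neg]
      refine mul_le_mul t1 (hV.2.2.2.2.2.trans ?_) (abs_nonneg _) pT0
      exact mul_le_mul (mul_le_mul_of_nonneg_right MRM (by positivity)) (hVp x hx) hV.1.le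
        (by positivity)
    have r4 : |i.e2 * (b x * q)| ≤ 1 * (B0 * (2 * (T0 * (2 * M / m0 ^ 2)))) := by
      rw [abs_mul, abs_mul, abs_of_pos i.e2_pos]
      exact mul_le_mul i.e2_le (mul_le_mul bB hqb (abs_nonneg _) pB0) (by positivity) zero_le_one
    have r5 : |c x * (p + q * x)| ≤ C0 * (2 * (T0 * (2 * M / m0 ^ 2))) := by
      rw [abs_mul]
      refine mul_le_mul bC ?_ (abs_nonneg _) pC0
      have : p + q * x = p * (1 - x) + (T 0 * U 1) * x := by rw [hq]; ring
      rw [this]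
      refine (abs_add_le _ _).trans ?_
      rw [abs_mul p, abs_mul (T 0 * U 1), abs_of_nonneg hx.1, abs_of_nonneg (sub_nonneg.mpr hx.2)]
      have h1 : |p| * (1 - x) ≤ |p| * 1 :=
        mul_le_mul_of_nonneg_left (by linarith [hx.1]) (abs_nonneg _)
      have h2 : |T 0 * U 1| * x ≤ |T 0 * U 1| * 1 :=
        mul_le_mul_of_nonneg_left hx.2 (abs_nonneg _)
      linarith
    have tot : i.delta ^ 2 * T2 + i.delta ^ 2 * (B0 * D1)
        + (T0 * (M * i.delta ^ 2 * M) + T0 * (M * i.delta ^ 2 * M))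
        + (1 * (B0 * (2 * (T0 * (2 * M / m0 ^ 2)))) + C0 * (2 * (T0 * (2 * M / m0 ^ 2))))
        ≤ R / m0 ^ 2 := by
      calc _ = (T2 + B0 * D1 + 2 * (T0 * (M * M))) * i.delta ^ 2
            + (B0 * (2 * (T0 * (2 * M))) + C0 * (2 * (T0 * (2 * M)))) / m0 ^ 2 := by ring
        _ ≤ (T2 + B0 * D1 + 2 * (T0 * (M * M))) * (K ^ 2 / m0 ^ 2)
            + (B0 * (2 * (T0 * (2 * M))) + C0 * (2 * (T0 * (2 * M)))) / m0 ^ 2 := by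
          gcongr
        _ = R / m0 ^ 2 := by rw [hRdef]; ring
    have fin : R / m0 ^ 2 ≤ (1 + K + T2 + A + R) / m0 ^ 2 :=
      div_le_div_of_nonneg_right (by linarith) (by positivity)
    refine ((abs_add_three _ _ _).trans (add_le_add_three r1 ((abs_add_le _ _).trans
      (add_le_add r2 r3)) ((abs_add_le _ _).trans (add_le_add r4 r5)))).trans (tot.trans fin)

end


/-! ### Step size estimates on the graded mesh of one layer. -/

/-- Properties of the graded part `0 = y 0 < ⋯ < y m` of the Bakhvalov-type mesh with `4 m = n`
for the layer function `exp (-p μ y)`. -/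
structure IsLayerMesh (L p μ n : ℝ) (m : ℕ) (y : ℕ → ℝ) : Prop where
  zero : y 0 = 0
  lt : ∀ j < m, y j < y (j + 1)
  lower : ∀ j < m, 1 ≤ L * (μ * n * (y (j + 1) - y j))
  upper : ∀ j < m, (y (j + 1) - y j) * n ≤ L
  sq_le : ∀ j, j + 1 < m → ((y (j + 1) - y j) * μ) ^ 2 * Real.exp (-(p * μ * y j)) ≤ L / n ^ 2
  cube_le : ∀ j, j + 1 < m →
    ((y (j + 1) - y j) * μ) ^ 3 * Real.exp (-(p * μ * y j)) ≤ L / (n ^ 2 * √n)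
  cube_le' : ∀ j, j + 2 < m →
    ((y (j + 2) - y (j + 1)) * μ) ^ 3 * Real.exp (-(p * μ * y j)) ≤ L / (n ^ 2 * √n)
  diff_le : ∀ j, j + 2 < m → |((y (j + 2) - y (j + 1)) * μ) ^ 2 - ((y (j + 1) - y j) * μ) ^ 2|
    * Real.exp (-(p * μ * y j)) ≤ L / (n ^ 2 * √n)
  fifth_le : ∀ j, j + 1 < m →
    ((y (j + 1) - y j) * μ) ^ 5 * Real.exp (-(p * μ * y j)) ^ 2 ≤ L / n ^ 5
  last_le : Real.exp (-(p * μ * y (m - 1))) ≤ L / (n ^ 2 * √n)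
  log_le : μ * y (m - 1) ≤ L * Real.log n

theorem one_sub_div_le_log_div {x y : ℝ} (hx : 0 < x) (hy : 0 < y) :
    1 - y / x ≤ Real.log (x / y) := by
  have := Real.one_sub_inv_le_log_of_pos (div_pos hx hy)
  rwa [inv_div] at this

theorem log_div_le {x y : ℝ} (hx : 0 < x) (hy : 0 < y) : Real.log (x / y) ≤ (x - y) / y := by
  have := Real.log_le_sub_one_of_pos (div_pos hx hy)
  rwa [sub_div, div_self hy.ne']

-- With `q_j = 1 - η j` and `T = τ/p`, the points are `-(T/μ) log q_j` and `exp(-p μ y_j) = q_j^τ ≤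
-- q_j^(5/2)`. Away from the last cell the scaled step is at most a multiple of `1/(n q_j)`, and the
-- difference of two neighbouring scaled steps a multiple of `1/(n q_j)²`. Hence every expression of
-- third order, times the weight, is at most a multiple of `n⁻³ q_j^(-1/2) ≤ n^(-5/2)`, because `n
-- q_j ≥ 1`. The last cell is excluded from these bounds since `q_m = μ⁻¹` may be far smaller than
-- `q_{m-1}`.
set_option maxHeartbeats 1000000 in
theorem isLayerMesh_phi0 {τ p : ℝ} (hτ : 5 / 2 ≤ τ) (hp0 : 0 < p) :
    ∃ L, 0 < L ∧ ∀ (μ : ℝ) (N m : ℕ), N = 4 * m → 4 ≤ m → (N : ℝ) ≤ μ →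
      IsLayerMesh L p μ N m (fun j => τ / (p * μ) * phi0 μ ((j : ℝ) / N)) := by
  set T := τ / p with hT
  have Tp : 0 < T := div_pos (by linarith) hp0
  -- `T⁻¹` serves the lower bound of the steps; the other term dominates `a T^k` for all `k ≤ 5` and
  -- `a ≤ 10 ^ 7`.
  refine ⟨1 + 10 ^ 7 * (1 + T) ^ 5 + T⁻¹, by positivity, fun μ N m hN hm hμ => ?_⟩
  set L := 1 + 10 ^ 7 * (1 + T) ^ 5 + T⁻¹ with hL
  have hm' : (4 : ℝ) ≤ m := by exact_mod_cast hm
  have hn : (N : ℝ) = 4 * m := by rw [hN]; push_cast; ring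
  set n : ℝ := (N : ℝ) with hndef
  have hn16 : 16 ≤ n := by linarith
  have hn0 : 0 < n := by linarith
  have hμ0 : 0 < μ := by linarith
  set η := 4 * (1 - μ⁻¹) / n with hη
  have hμi : μ⁻¹ ≤ n⁻¹ := inv_anti₀ hn0 hμ
  have hni : n⁻¹ ≤ 16⁻¹ := inv_anti₀ (by norm_num) hn16
  have hη1 : 3 / n ≤ η := div_le_div_of_nonneg_right (by linarith) hn0.le
  have hμip : 0 < μ⁻¹ := inv_pos.mpr hμ0
  have hη2 : η ≤ 4 / n := div_le_div_of_nonneg_right (by linarith) hn0.le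
  have hηp : 0 < η := lt_of_lt_of_le (by positivity) hη1
  have hηn : η * n ≤ 4 := by rwa [le_div_iff₀ hn0] at hη2
  have hηn' : 3 ≤ η * n := by rwa [div_le_iff₀ hn0] at hη1
  set q : ℕ → ℝ := fun j => 1 - η * j with hq
  have hqm : ∀ j : ℕ, q j = μ⁻¹ + η * (m - j) := by
    intro j
    have : η * m = 1 - μ⁻¹ := by rw [hη, hn]; field_simp
    simp only [hq]; linarith
  have hqlow : ∀ j : ℕ, j ≤ m → μ⁻¹ ≤ q j := by
    intro j hj
    rw [hqm]
    have : (j : ℝ) ≤ m := by exact_mod_cast hj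
    have := mul_nonneg hηp.le (sub_nonneg.mpr this)
    linarith
  have hqp : ∀ j : ℕ, j ≤ m → 0 < q j := fun j hj => hμip.trans_le (hqlow j hj)
  have hqη : ∀ j : ℕ, j < m → η ≤ q j := by
    intro j hj
    rw [hqm]
    have : (j : ℝ) + 1 ≤ m := by exact_mod_cast hj
    have := mul_le_mul_of_nonneg_left (show (1 : ℝ) ≤ m - j by linarith) hηp.le
    linarith
  have hq1 : ∀ j : ℕ, q j ≤ 1 := fun j => by
    have : 0 ≤ η * (j : ℝ) := by positivity
    simp only [hq]; linarith
  have hqs : ∀ j : ℕ, q (j + 1) = q j - η := fun j => by simp only [hq]; push_cast; ring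
  set y : ℕ → ℝ := fun j => τ / (p * μ) * phi0 μ ((j : ℝ) / n) with hy
  have hyq : ∀ j, y j = T / μ * -Real.log (q j) := by
    intro j
    simp only [hy, phi0, hq, hη, hT]
    rw [div_div]
    congr 4
    ring
  have hstep : ∀ j : ℕ, j < m → (y (j + 1) - y j) * μ = T * Real.log (q j / q (j + 1)) := by
    intro j hj
    rw [hyq, hyq, Real.log_div (hqp j hj.le).ne' (hqp (j + 1) hj).ne']
    field_simp
    ring
  have hlow : ∀ j : ℕ, j < m → T * η ≤ (y (j + 1) - y j) * μ := by
    intro j hj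
    rw [hstep j hj]
    refine mul_le_mul_of_nonneg_left ?_ Tp.le
    refine le_trans ?_ (one_sub_div_le_log_div (hqp j hj.le) (hqp (j + 1) hj))
    have h1 := hqp j hj.le
    have h2 := hq1 j
    rw [hqs, sub_div, div_self h1.ne', sub_sub_cancel, le_div_iff₀ h1]
    nlinarith
  have hup : ∀ j : ℕ, j < m → (y (j + 1) - y j) * μ ≤ T * (η / q (j + 1)) := by
    intro j hj
    rw [hstep j hj]
    refine mul_le_mul_of_nonneg_left ?_ Tp.le
    have := log_div_le (hqp j hj.le) (hqp (j + 1) hj)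
    rwa [hqs, sub_sub_cancel, ← hqs] at this
  have hsp : ∀ j : ℕ, j < m → 0 < (y (j + 1) - y j) * μ := fun j hj =>
    lt_of_lt_of_le (by positivity) (hlow j hj)
  have hstep_pos : ∀ j : ℕ, j < m → 0 < y (j + 1) - y j := fun j hj =>
    pos_of_mul_pos_left (hsp j hj) hμ0.le
  have hexp : ∀ j : ℕ, j ≤ m → Real.exp (-(p * μ * y j)) ≤ q j ^ 2 * √(q j) := by
    intro j hj
    have h0 := hqp j hj
    have e1 : -(p * μ * y j) = τ * Real.log (q j) := by
      rw [hyq, hT]; field_simp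
    have e2 : q j ^ 2 * √(q j) = Real.exp (5 / 2 * Real.log (q j)) := by
      rw [Real.sqrt_eq_rpow, ← Real.rpow_natCast, ← Real.rpow_add h0, Real.rpow_def_of_pos h0]
      congr 1
      push_cast
      ring
    rw [e1, e2]
    refine Real.exp_le_exp.mpr (mul_le_mul_of_nonpos_right hτ (Real.log_nonpos h0.le (hq1 j)))
  -- a step in terms of the parameter at its left end or one step further left
  have hS : ∀ j : ℕ, j + 1 < m → (y (j + 1) - y j) * μ ≤ 8 * T / (n * q j) := by
    intro j hj
    refine (hup j (by omega)).trans ?_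
    have h1 := hqη (j + 1) hj
    have h2 := hqp j (by omega)
    have h3 := hqp (j + 1) (by omega)
    have h4 : q j ≤ 2 * q (j + 1) := by rw [hqs] at h1 ⊢; linarith
    rw [← mul_div_assoc, div_le_div_iff₀ h3 (by positivity)]
    calc T * η * (n * q j) = T * (η * n) * q j := by ring
      _ ≤ T * 4 * (2 * q (j + 1)) := by gcongr
      _ = _ := by ring
  have hS' : ∀ j : ℕ, j + 2 < m → (y (j + 2) - y (j + 1)) * μ ≤ 12 * T / (n * q j) := by
    intro j hj
    refine (hup (j + 1) (by omega)).trans ?_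
    have h1 := hqη (j + 2) hj
    have h2 := hqp j (by omega)
    have h3 := hqp (j + 1 + 1) (by omega)
    have h4 : q j ≤ 3 * q (j + 1 + 1) := by
      have e1 := hqs j
      have e2 := hqs (j + 1)
      rw [show j + 2 = j + 1 + 1 from rfl] at h1
      linarith
    rw [← mul_div_assoc, div_le_div_iff₀ h3 (by positivity)]
    calc T * η * (n * q j) = T * (η * n) * q j := by ring
      _ ≤ T * 4 * (3 * q (j + 1 + 1)) := by gcongr
      _ = _ := by ring
  have hD : ∀ j : ℕ, j + 2 < m →
      |(y (j + 2) - y (j + 1)) * μ - (y (j + 1) - y j) * μ| ≤ 96 * T / (n * q j) ^ 2 := by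
    intro j hj
    have a0 := hqp j (by omega)
    have a1 := hqp (j + 1) (by omega)
    have a2 := hqp (j + 1 + 1) (by omega)
    have e1 := hqs j
    have e2 := hqs (j + 1)
    have b2 := hqη (j + 1 + 1) hj
    rw [show j + 2 = j + 1 + 1 from rfl, hstep (j + 1) (by omega), hstep j (by omega), ← mul_sub,
      ← Real.log_div (div_pos a1 a2).ne' (div_pos a0 a1).ne', abs_mul, abs_of_pos Tp]
    have e3 : q (j + 1) / q (j + 1 + 1) / (q j / q (j + 1))
        = q (j + 1) ^ 2 / (q j * q (j + 1 + 1)) := by field_simp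
    have p02 : 0 < q j * q (j + 1 + 1) := mul_pos a0 a2
    -- The `q_j` are in arithmetic progression, so the second difference of their logarithms is of
    -- order `η²` instead of `η`.
    have e4 : q (j + 1) ^ 2 - q j * q (j + 1 + 1) = η ^ 2 := by
      have : q j = q (j + 1) + η := by linarith
      rw [e2, this]; ring
    have l1 := log_div_le (pow_pos a1 2) p02
    have l2 := one_sub_div_le_log_div (pow_pos a1 2) p02
    rw [e4] at l1
    have l3 : 0 ≤ Real.log (q (j + 1) ^ 2 / (q j * q (j + 1 + 1))) := by
      refine le_trans ?_ l2
      rw [sub_nonneg, div_le_one (pow_pos a1 2)]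
      nlinarith [sq_nonneg η]
    rw [e3, abs_of_nonneg l3]
    have h4 : q j ≤ 3 * q (j + 1 + 1) := by linarith
    calc T * Real.log (q (j + 1) ^ 2 / (q j * q (j + 1 + 1)))
        ≤ T * (η ^ 2 / (q j * q (j + 1 + 1))) := mul_le_mul_of_nonneg_left l1 Tp.le
      _ ≤ 96 * T / (n * q j) ^ 2 := by
        rw [← mul_div_assoc, div_le_div_iff₀ p02 (by positivity)]
        calc T * η ^ 2 * (n * q j) ^ 2 = T * (η * n) ^ 2 * (q j * q j) := by ring
          _ ≤ T * 4 ^ 2 * (q j * (3 * q (j + 1 + 1))) := by gcongr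
          _ ≤ 96 * T * (q j * q (j + 1 + 1)) := by
            have : 0 < T * (q j * q (j + 1 + 1)) := by positivity
            linarith
  have hsq : ∀ j : ℕ, j ≤ m → √(q j) ^ 2 = q j := fun j hj => Real.sq_sqrt (hqp j hj).le
  have hsq1 : ∀ j : ℕ, √(q j) ≤ 1 := fun j => Real.sqrt_le_one.mpr (hq1 j)
  have hsn : √n ^ 2 = n := Real.sq_sqrt hn0.le
  have hsnp : 0 < √n := Real.sqrt_pos.mpr hn0
  have hsnq : ∀ j : ℕ, j < m → 1 ≤ √n * √(q j) := by
    intro j hj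
    rw [← Real.sqrt_mul hn0.le]
    refine Real.one_le_sqrt.mpr ?_
    have := mul_le_mul_of_nonneg_left (hqη j hj) hn0.le
    linarith
  have hT1 : 1 ≤ (1 + T) := by linarith
  have hTk : ∀ k ≤ 5, T ^ k ≤ (1 + T) ^ 5 := fun k hk =>
    (pow_le_pow_left₀ Tp.le (by linarith) k).trans (pow_le_pow_right₀ hT1 hk)
  have hLb : ∀ a : ℝ, ∀ k ≤ 5, 0 ≤ a → a ≤ 10 ^ 7 → a * T ^ k ≤ L := by
    intro a k hk ha0 ha
    have h1 : a * T ^ k ≤ 10 ^ 7 * (1 + T) ^ 5 :=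
      mul_le_mul ha (hTk k hk) (by positivity) (by norm_num)
    have : 0 < T⁻¹ := inv_pos.mpr Tp
    linarith
  -- the products of three steps with the layer function
  have gen3 : ∀ (j : ℕ) (z a : ℝ) (k : ℕ), j < m → k ≤ 5 → 0 ≤ a → a ≤ 10 ^ 7 →
      z ≤ a * T ^ k / (n * q j) ^ 3 → z * Real.exp (-(p * μ * y j)) ≤ L / (n ^ 2 * √n) := by
    intro j z a k hj hk ha0 ha hz
    have hq0 := hqp j hj.le
    have hb := hexp j hj.le
    have hs := hsq j hj.le
    have hsp : 0 < √(q j) := Real.sqrt_pos.mpr hq0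
    have h1 := hsnq j hj
    calc z * Real.exp (-(p * μ * y j))
        ≤ a * T ^ k / (n * q j) ^ 3 * Real.exp (-(p * μ * y j)) :=
          mul_le_mul_of_nonneg_right hz (Real.exp_pos _).le
      _ ≤ a * T ^ k / (n * q j) ^ 3 * (q j ^ 2 * √(q j)) :=
          mul_le_mul_of_nonneg_left hb (by positivity)
      _ = a * T ^ k / (n ^ 3 * √(q j)) := by
          rw [← hs]
          have : √(√(q j) ^ 2) = √(q j) := by rw [hs]
          rw [this]
          field_simp
      _ ≤ L / (n ^ 2 * √n) := by
          rw [div_le_div_iff₀ (by positivity) (by positivity)]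
          have h2 : n ^ 2 * √n ≤ n ^ 3 * √(q j) := by
            calc n ^ 2 * √n = n ^ 2 * √n * 1 := by ring
              _ ≤ n ^ 2 * √n * (√n * √(q j)) := by gcongr
              _ = n ^ 2 * (√n ^ 2) * √(q j) := by ring
              _ = n ^ 3 * √(q j) := by rw [hsn]; ring
          exact mul_le_mul (hLb a k hk ha0 ha) h2 (by positivity) (by positivity)
  refine ⟨?_, ?_, ?_, ?_, ?_, ?_, ?_, ?_, ?_, ?_, ?_⟩
  · rw [hyq]; simp [hq]
  · exact fun j hj => sub_pos.mp (hstep_pos j hj)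
  · intro j hj
    have h1 := hlow j hj
    have h2 : 0 < (1 : ℝ) + 10 ^ 7 * (1 + T) ^ 5 := by positivity
    have h3 : T⁻¹ * (T * η * n) ≤ L * (μ * n * (y (j + 1) - y j)) := by
      have e : μ * n * (y (j + 1) - y j) = (y (j + 1) - y j) * μ * n := by ring
      rw [e]
      refine mul_le_mul (by linarith) ?_ (by positivity) (by positivity)
      exact mul_le_mul_of_nonneg_right h1 hn0.le
    have h4 : T⁻¹ * (T * η * n) = η * n := by field_simp
    have : 1 ≤ η * n := by linarith
    exact (this.trans_eq h4.symm).trans h3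
  · intro j hj
    have h1 := hup j hj
    have h3 := hqp (j + 1) hj
    -- The bound `q ≥ μ⁻¹` is valid up to index `m`, so this estimate includes the last cell.
    have h4 := hqlow (j + 1) hj
    have h5 : (y (j + 1) - y j) * μ ≤ T * (η * μ) := by
      refine h1.trans (mul_le_mul_of_nonneg_left ?_ Tp.le)
      rw [div_le_iff₀ h3, mul_assoc]
      refine le_mul_of_one_le_right hηp.le ?_
      rwa [inv_le_iff_one_le_mul₀ hμ0, mul_comm] at h4
    rw [← mul_assoc] at h5
    have h6 := le_of_mul_le_mul_right h5 hμ0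
    have h7 := mul_le_mul_of_nonneg_right h6 hn0.le
    have h8 : T * η * n ≤ T * 4 := by rw [mul_assoc]; gcongr
    have h9 := hLb 4 1 (by norm_num) (by norm_num) (by norm_num)
    change (y (j + 1) - y j) * n ≤ L
    linarith
  · intro j hj
    have hq0 := hqp j (by omega)
    have hb := hexp j (by omega)
    calc ((y (j + 1) - y j) * μ) ^ 2 * Real.exp (-(p * μ * y j))
        ≤ (8 * T / (n * q j)) ^ 2 * (q j ^ 2 * √(q j)) := by
          refine mul_le_mul (pow_le_pow_left₀ (hsp j (by omega)).le (hS j hj) 2) hb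
            (Real.exp_pos _).le (by positivity)
      _ = 64 * T ^ 2 * √(q j) / n ^ 2 := by field_simp; ring
      _ ≤ L / n ^ 2 := by
          refine div_le_div_of_nonneg_right ?_ (by positivity)
          calc 64 * T ^ 2 * √(q j) ≤ 64 * T ^ 2 * 1 := by
                gcongr; exact hsq1 j
            _ ≤ L := by
              rw [mul_one]; exact hLb 64 2 (by norm_num) (by norm_num) (by norm_num)
  · intro j hj
    refine gen3 j _ 512 3 (by omega) (by norm_num) (by norm_num) (by norm_num) ?_
    refine (pow_le_pow_left₀ (hsp j (by omega)).le (hS j hj) 3).trans (le_of_eq ?_)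
    rw [div_pow]; ring
  · intro j hj
    refine gen3 j _ 1728 3 (by omega) (by norm_num) (by norm_num) (by norm_num) ?_
    refine (pow_le_pow_left₀ (hsp (j + 1) (by omega)).le (hS' j hj) 3).trans (le_of_eq ?_)
    rw [div_pow]; ring
  · intro j hj
    refine gen3 j _ 1920 2 (by omega) (by norm_num) (by norm_num) (by norm_num) ?_
    have hq0 := hqp j (by omega)
    have s1 := hS j (by omega)
    have s2 := hS' j hj
    have p1 := hsp j (by omega)
    have p2 : 0 < (y (j + 2) - y (j + 1)) * μ := hsp (j + 1) (by omega)
    rw [sq_sub_sq, abs_mul, abs_of_pos (add_pos p2 p1)]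
    calc _ ≤ (12 * T / (n * q j) + 8 * T / (n * q j)) * (96 * T / (n * q j) ^ 2) :=
          mul_le_mul (add_le_add s2 s1) (hD j hj) (abs_nonneg _) (by positivity)
      _ = 1920 * T ^ 2 / (n * q j) ^ 3 := by field_simp; ring
  · intro j hj
    have hq0 := hqp j (by omega)
    have hb := hexp j (by omega)
    calc ((y (j + 1) - y j) * μ) ^ 5 * Real.exp (-(p * μ * y j)) ^ 2
        ≤ (8 * T / (n * q j)) ^ 5 * (q j ^ 2 * √(q j)) ^ 2 := by
          refine mul_le_mul (pow_le_pow_left₀ (hsp j (by omega)).le (hS j hj) 5)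
            (pow_le_pow_left₀ (Real.exp_pos _).le hb 2) (by positivity) (by positivity)
      _ = (8 * T / (n * q j)) ^ 5 * q j ^ 5 := by
          rw [mul_pow, hsq j (by omega)]; ring
      _ = 32768 * T ^ 5 / n ^ 5 := by field_simp; ring
      _ ≤ L / n ^ 5 := by
          refine div_le_div_of_nonneg_right ?_ (by positivity)
          exact hLb 32768 5 (by norm_num) (by norm_num) (by norm_num)
  · have hmc : ((m - 1 : ℕ) : ℝ) = m - 1 := by
      rw [Nat.cast_sub (by omega)]; simp
    -- One cell before the end, `q` equals `μ⁻¹ + η`, and `μ⁻¹ ≤ 1/n`, `η ≤ 4/n`.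
    have hql : q (m - 1) ≤ 5 / n := by
      rw [hqm, hmc, sub_sub_cancel, mul_one]
      have : 5 / n = n⁻¹ + 4 / n := by field_simp; norm_num
      linarith
    have hq0 := hqp (m - 1) (by omega)
    calc Real.exp (-(p * μ * y (m - 1))) ≤ q (m - 1) ^ 2 * √(q (m - 1)) := hexp _ (by omega)
      _ ≤ (5 / n) ^ 2 * √(5 / n) := by
          gcongr
      _ = 25 * √5 / (n ^ 2 * √n) := by
          rw [Real.sqrt_div (by norm_num)]; field_simp; norm_num
      _ ≤ L / (n ^ 2 * √n) := by
          refine div_le_div_of_nonneg_right ?_ (by positivity)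
          have h5 : √5 ≤ 3 := Real.sqrt_le_iff.mpr (by norm_num)
          have := hLb 75 0 (by norm_num) (by norm_num) (by norm_num)
          rw [pow_zero, mul_one] at this
          linarith
  · have h1 := hqη (m - 1) (by omega)
    have hq0 := hqp (m - 1) (by omega)
    have h2 : μ * y (m - 1) = T * -Real.log (q (m - 1)) := by
      rw [hyq]; field_simp
    have h3 : -Real.log (q (m - 1)) ≤ Real.log n := by
      rw [← Real.log_inv]
      refine Real.log_le_log (inv_pos.mpr hq0) ?_
      rw [inv_le_comm₀ hq0 hn0]
      have : n⁻¹ ≤ 3 / n := by rw [inv_eq_one_div]; gcongr; norm_num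
      linarith
    rw [h2]
    have h4 : T ≤ L := by
      have := hLb 1 1 (by norm_num) (by norm_num) (by norm_num)
      simpa using this
    have h5 : 0 ≤ Real.log n := Real.log_nonneg (by linarith)
    calc T * -Real.log (q (m - 1)) ≤ T * Real.log n := mul_le_mul_of_nonneg_left h3 Tp.le
      _ ≤ _ := mul_le_mul_of_nonneg_right h4 h5


theorem IsLayerMesh.congr {L p μ n : ℝ} {m : ℕ} {y z : ℕ → ℝ} (h : IsLayerMesh L p μ n m y)
    (he : ∀ j ≤ m, z j = y j) : IsLayerMesh L p μ n m z where
  zero := by rw [he 0 (by omega)]; exact h.zero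
  lt j hj := by rw [he j (by omega), he (j + 1) (by omega)]; exact h.lt j hj
  lower j hj := by rw [he j (by omega), he (j + 1) (by omega)]; exact h.lower j hj
  upper j hj := by rw [he j (by omega), he (j + 1) (by omega)]; exact h.upper j hj
  sq_le j hj := by rw [he j (by omega), he (j + 1) (by omega)]; exact h.sq_le j hj
  cube_le j hj := by rw [he j (by omega), he (j + 1) (by omega)]; exact h.cube_le j hj
  cube_le' j hj := by
    rw [he j (by omega), he (j + 1) (by omega), he (j + 2) (by omega)]; exact h.cube_le' j hj
  diff_le j hj := by
    rw [he j (by omega), he (j + 1) (by omega), he (j + 2) (by omega)]; exact h.diff_le j hj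
  fifth_le j hj := by rw [he j (by omega), he (j + 1) (by omega)]; exact h.fifth_le j hj
  last_le := by rw [he (m - 1) (by omega)]; exact h.last_le
  log_le := by rw [he (m - 1) (by omega)]; exact h.log_le

/-! ### The complete mesh. -/

/-- The properties of the Bakhvalov-type mesh with `4 m` intervals used in the error analysis. -/
structure IsBakhvalovMesh (L p m0 m1 : ℝ) (m : ℕ) (x : ℕ → ℝ) : Prop where
  left : IsLayerMesh L p m0 ((4 * m : ℕ) : ℝ) m x
  right : IsLayerMesh L p m1 ((4 * m : ℕ) : ℝ) m (fun j => 1 - x (4 * m - j))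
  mid_lower : ∀ i, m ≤ i → i < 3 * m → 1 ≤ (x (i + 1) - x i) * ((4 * m : ℕ) : ℝ)
  mid_upper : ∀ i, m ≤ i → i < 3 * m → (x (i + 1) - x i) * ((4 * m : ℕ) : ℝ) ≤ 2
  three_quarters : 3 / 4 ≤ x (3 * m)

/-- The right part, reflected, is again a mesh generated by `phi0`, now with rate `μ₁`. The formulas
match at the two transition points because `φ` takes the value `log μ` there. On the middle part `n`
times the step is `2 (1 - σ₀ - σ₁)`, which lies between `1` and `2` as `0 ≤ σ ≤ 1/4`. -/
theorem isBakhvalovMesh_meshPoint {τ p : ℝ} (hτ : 5 / 2 ≤ τ) (hp0 : 0 < p) :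
    ∃ L, 0 < L ∧ ∀ (m0 m1 : ℝ) (m : ℕ), 4 ≤ m → ((4 * m : ℕ) : ℝ) ≤ m0 →
      ((4 * m : ℕ) : ℝ) ≤ m1 → sigma τ p m0 ≤ 1 / 4 → sigma τ p m1 ≤ 1 / 4 →
      IsBakhvalovMesh L p m0 m1 m (meshPoint τ p m0 m1 (4 * m)) := by
  obtain ⟨L, hL, h⟩ := isLayerMesh_phi0 hτ hp0
  refine ⟨L, hL, fun m0 m1 m hm hm0 hm1 hs0 hs1 => ?_⟩
  have hmr : (4 : ℝ) ≤ m := by exact_mod_cast hm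
  have hn : ((4 * m : ℕ) : ℝ) = 4 * m := by push_cast; ring
  have hmp : (0 : ℝ) < m := by linarith
  have hsig : ∀ μ : ℝ, ((4 * m : ℕ) : ℝ) ≤ μ → 0 ≤ sigma τ p μ := by
    intro μ hμ
    have h1 : 1 ≤ μ := by linarith
    have h2 := Real.log_nonneg h1
    have h3 : 0 < p * μ := by positivity
    exact mul_nonneg (div_nonneg (by linarith) h3.le) h2
  have hmid : ∀ i, m ≤ i → i ≤ 3 * m → meshPoint τ p m0 m1 (4 * m) i
      = sigma τ p m0 + 2 * ((i : ℝ) / ((4 * m : ℕ) : ℝ) - 1 / 4)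
        * (1 - sigma τ p m0 - sigma τ p m1) := by
    intro i h1 h2
    rw [meshPoint]
    rcases h1.eq_or_lt with h3 | h3
    · rw [if_pos (by omega), ← h3, phi0, sigma]
      have e : (m : ℝ) / ((4 * m : ℕ) : ℝ) = 1 / 4 := by rw [hn]; field_simp
      rw [e, show (1 : ℝ) - 4 * (1 - m0⁻¹) * (1 / 4) = m0⁻¹ by ring, Real.log_inv]
      ring
    · rw [if_neg (by omega), if_pos (by omega)]
  have hstep : ∀ i, m ≤ i → i < 3 * m →
      (meshPoint τ p m0 m1 (4 * m) (i + 1) - meshPoint τ p m0 m1 (4 * m) i)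
        * ((4 * m : ℕ) : ℝ) = 2 * (1 - sigma τ p m0 - sigma τ p m1) := by
    intro i h1 h2
    rw [hmid i h1 h2.le, hmid (i + 1) (by omega) h2, hn]
    push_cast
    field_simp
    ring
  have hend : meshPoint τ p m0 m1 (4 * m) (3 * m) = 1 - sigma τ p m1 := by
    rw [hmid (3 * m) (by omega) le_rfl]
    have e : ((3 * m : ℕ) : ℝ) / ((4 * m : ℕ) : ℝ) = 3 / 4 := by
      rw [hn]; push_cast; field_simp
    rw [e]; ring
  have g0 := hsig m0 hm0
  have g1 := hsig m1 hm1
  refine ⟨(h m0 (4 * m) m rfl hm hm0).congr fun j hj => ?_,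
    (h m1 (4 * m) m rfl hm hm1).congr fun j hj => ?_, fun i h1 h2 => ?_, fun i h1 h2 => ?_, ?_⟩
  · rw [meshPoint, if_pos (by omega)]
  · rcases hj.eq_or_lt with h3 | h3
    · rw [h3, show 4 * m - m = 3 * m by omega, hend, sigma, phi0]
      have e : (m : ℝ) / ((4 * m : ℕ) : ℝ) = 1 / 4 := by rw [hn]; field_simp
      rw [e, show (1 : ℝ) - 4 * (1 - m1⁻¹) * (1 / 4) = m1⁻¹ by ring, Real.log_inv]
      ring
    · rw [meshPoint, if_neg (by omega), if_neg (by omega), phi1, phi0]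
      have e : 1 - ((4 * m - j : ℕ) : ℝ) / ((4 * m : ℕ) : ℝ) = (j : ℝ) / ((4 * m : ℕ) : ℝ) := by
        rw [Nat.cast_sub (by omega), hn]; field_simp; ring
      rw [e]; ring
  · rw [hstep i h1 h2]; linarith
  · rw [hstep i h1 h2]; linarith
  · rw [hend]; linarith

/-- A mesh on `[0,1]`. -/
structure IsMesh (x : ℕ → ℝ) (N : ℕ) : Prop where
  zero : x 0 = 0
  one : x N = 1
  lt : ∀ i < N, x i < x (i + 1)

namespace IsBakhvalovMesh

variable {L p m0 m1 : ℝ} {m : ℕ} {x : ℕ → ℝ}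

theorem isMesh (h : IsBakhvalovMesh L p m0 m1 m x) : IsMesh x (4 * m) where
  zero := h.left.zero
  one := by
    have := h.right.zero
    simp only [Nat.sub_zero] at this
    linarith
  lt i hi := by
    rcases lt_or_ge i m with h1 | h1
    · exact h.left.lt i h1
    rcases lt_or_ge i (3 * m) with h2 | h2
    · have h3 := h.mid_lower i h1 h2
      have h4 : (0 : ℝ) ≤ ((4 * m : ℕ) : ℝ) := by positivity
      by_contra h5
      have := mul_nonpos_of_nonpos_of_nonneg (sub_nonpos.mpr (not_lt.mp h5)) h4
      linarith
    · have h3 := h.right.lt (4 * m - 1 - i) (by omega)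
      rw [show 4 * m - (4 * m - 1 - i) = i + 1 by omega,
        show 4 * m - (4 * m - 1 - i + 1) = i by omega] at h3
      linarith

theorem upper (h : IsBakhvalovMesh L p m0 m1 m x) (i : ℕ) (hi : i < 4 * m) :
    (x (i + 1) - x i) * ((4 * m : ℕ) : ℝ) ≤ L + 2 := by
  have hL : 0 ≤ L := by
    have h1 := h.left.upper 0 (by omega)
    refine le_trans (mul_nonneg (sub_nonneg.mpr (h.left.lt 0 (by omega)).le) (by positivity)) h1
  rcases lt_or_ge i m with h1 | h1
  · linarith [h.left.upper i h1]
  rcases lt_or_ge i (3 * m) with h2 | h2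
  · linarith [h.mid_upper i h1 h2]
  · have h3 := h.right.upper (4 * m - 1 - i) (by omega)
    rw [show 4 * m - (4 * m - 1 - i) = i + 1 by omega,
        show 4 * m - (4 * m - 1 - i + 1) = i by omega] at h3
    linarith

/-- Provides the inverse estimates for nodal values. It stops at `3 m`: further right the guaranteed
lower bound for the steps involves the larger rate `μ₁`. -/
theorem lower (h : IsBakhvalovMesh L p m0 m1 m x) (hm0 : 1 ≤ m0) (i : ℕ) (hi : i < 3 * m) :
    1 ≤ (L + 1) * (m0 * ((4 * m : ℕ) : ℝ) * (x (i + 1) - x i)) := by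
  have hlt := h.isMesh.lt i (by omega)
  have hpos : 0 ≤ m0 * ((4 * m : ℕ) : ℝ) * (x (i + 1) - x i) :=
    mul_nonneg (by positivity) (sub_nonneg.mpr hlt.le)
  rcases lt_or_ge i m with h1 | h1
  · linarith [h.left.lower i h1]
  · have hL : 0 ≤ L := by
      have h1 := h.left.upper 0 (by omega)
      refine le_trans (mul_nonneg (sub_nonneg.mpr (h.left.lt 0 (by omega)).le) (by positivity)) h1
    have h3 := h.mid_lower i h1 hi
    have h4 : 0 ≤ L * (m0 * ((4 * m : ℕ) : ℝ) * (x (i + 1) - x i)) := mul_nonneg hL hpos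
    nlinarith

end IsBakhvalovMesh

namespace IsMesh

variable {x : ℕ → ℝ} {N : ℕ}

theorem le_of_le (h : IsMesh x N) {i j : ℕ} (hij : i ≤ j) (hj : j ≤ N) : x i ≤ x j := by
  induction j, hij using Nat.le_induction with
  | base => exact le_rfl
  | succ k hk ih => exact (ih (by omega)).trans (h.lt k (by omega)).le

theorem mem_Icc (h : IsMesh x N) {i : ℕ} (hi : i ≤ N) : x i ∈ Icc (0 : ℝ) 1 := by
  rw [← h.zero, ← h.one]
  exact ⟨h.le_of_le (Nat.zero_le _) hi, h.le_of_le hi le_rfl⟩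

theorem Icc_subset (h : IsMesh x N) {i : ℕ} (hi : i < N) :
    Icc (x i) (x (i + 1)) ⊆ Icc (0 : ℝ) 1 :=
  Icc_subset_Icc (h.mem_Icc hi.le).1 (h.mem_Icc (Nat.succ_le_of_lt hi)).2

theorem exists_mem_Ico (h : IsMesh x N) {t : ℝ} (ht : t ∈ Ico (0 : ℝ) 1) :
    ∃ i < N, t ∈ Ico (x i) (x (i + 1)) := by
  by_contra hc
  have : ∀ j ≤ N, x j ≤ t := by
    intro j
    induction j with
    | zero => intro _; rw [h.zero]; exact ht.1
    | succ k ih =>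
      intro hk
      by_contra h2
      exact hc ⟨k, by omega, ih (by omega), not_le.mp h2⟩
  have := this N le_rfl
  rw [h.one] at this
  exact absurd ht.2 (not_lt.mpr this)

theorem sum_integral (h : IsMesh x N) {g : ℝ → ℝ} (hg : IntervalIntegrable g volume 0 1) :
    ∑ i ∈ Finset.range N, ∫ t in x i..x (i + 1), g t = ∫ t in (0 : ℝ)..1, g t := by
  rw [intervalIntegral.sum_integral_adjacent_intervals, h.zero, h.one]
  intro k hk
  refine hg.mono_set ?_
  rw [uIcc_of_le (h.lt k hk).le, uIcc_of_le zero_le_one]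
  exact h.Icc_subset hk

end IsMesh


/-! ### The bilinear form: coercivity, maximum principle, energy estimate. -/

theorem intervalIntegrable_of_continuousOn_unit {g : ℝ → ℝ} (hg : ContinuousOn g (Icc 0 1)) :
    IntervalIntegrable g volume 0 1 :=
  ContinuousOn.intervalIntegrable (by rwa [uIcc_of_le zero_le_one])

theorem absolutelyContinuous_of_hasDerivAt {g g₁ : ℝ → ℝ} (h : ∀ x, HasDerivAt g (g₁ x) x)
    (hc : Continuous g₁) (a b : ℝ) : AbsolutelyContinuousOnInterval g a b := by
  have e : deriv g = g₁ := funext fun x => (h x).deriv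
  have : ContDiff ℝ 1 g := contDiff_one_iff_deriv.mpr ⟨fun x => (h x).differentiableAt, by rwa [e]⟩
  exact this.contDiffOn.absolutelyContinuousOnInterval

namespace MemH10

variable {v w z : ℝ → ℝ}

theorem continuousOn (hv : MemH10 v) : ContinuousOn v (Icc 0 1) := by
  have := hv.absCont.continuousOn
  rwa [uIcc_of_le zero_le_one] at this

theorem intervalIntegrable_deriv (hv : MemH10 v) : IntervalIntegrable (deriv v) volume 0 1 :=
  hv.absCont.intervalIntegrable_deriv

theorem intervalIntegrable_deriv_mul (hv : MemH10 v) (hw : MemH10 w) :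
    IntervalIntegrable (fun t => deriv v t * deriv w t) volume 0 1 := by
  rw [intervalIntegrable_iff_integrableOn_Ioo_of_le zero_le_one]
  exact hv.deriv_memLp.integrable_mul hw.deriv_memLp

theorem intervalIntegrable_mul_deriv_mul {g : ℝ → ℝ} (hg : ContinuousOn g (Icc 0 1))
    (hv : MemH10 v) (hw : ContinuousOn w (Icc 0 1)) :
    IntervalIntegrable (fun t => g t * deriv v t * w t) volume 0 1 := by
  have h1 := hv.intervalIntegrable_deriv.continuousOn_mul (by rwa [uIcc_of_le zero_le_one] : ContinuousOn g (uIcc 0 1))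
  exact h1.mul_continuousOn (by rwa [uIcc_of_le zero_le_one])

theorem deriv_sub_ae (hv : MemH10 v) (hw : MemH10 w) :
    ∀ᵐ t, t ∈ uIoc (0 : ℝ) 1 → deriv (fun s => v s - w s) t = deriv v t - deriv w t := by
  filter_upwards [hv.absCont.ae_differentiableAt, hw.absCont.ae_differentiableAt] with t h1 h2 ht
  exact deriv_fun_sub (h1 (uIoc_subset_uIcc ht)) (h2 (uIoc_subset_uIcc ht))

theorem sub (hv : MemH10 v) (hw : MemH10 w) : MemH10 (fun s => v s - w s) where
  absCont := hv.absCont.sub hw.absCont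
  deriv_memLp := by
    refine (hv.deriv_memLp.sub hw.deriv_memLp).ae_eq ?_
    rw [Filter.EventuallyEq, ae_restrict_iff' measurableSet_Ioo]
    filter_upwards [hv.deriv_sub_ae hw] with t h ht
    rw [h (by rw [uIoc_of_le zero_le_one]; exact Ioo_subset_Ioc_self ht)]
    rfl
  left_eq_zero := by rw [hv.left_eq_zero, hw.left_eq_zero, sub_zero]
  right_eq_zero := by rw [hv.right_eq_zero, hw.right_eq_zero, sub_zero]

theorem neg (hv : MemH10 v) : MemH10 (fun s => -v s) where
  absCont := hv.absCont.neg
  deriv_memLp := by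
    have : deriv (fun s => -v s) = -deriv v := funext fun s => deriv.fun_neg
    rw [this]
    exact hv.deriv_memLp.neg
  left_eq_zero := by rw [hv.left_eq_zero, neg_zero]
  right_eq_zero := by rw [hv.right_eq_zero, neg_zero]

end MemH10

section Bilinear

variable {e1 e2 γ β ρ : ℝ} {b c v w z r R : ℝ → ℝ}

theorem bilin_eq_integral (hb : ContinuousOn b (Icc 0 1)) (hc : ContinuousOn c (Icc 0 1))
    (hv : MemH10 v) (hw : MemH10 w) :
    IntervalIntegrable (fun t => e1 * (deriv v t * deriv w t) + e2 * (b t * deriv v t * w t)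
      + c t * v t * w t) volume 0 1 ∧
    bilin e1 e2 b c v w = ∫ t in (0 : ℝ)..1, (e1 * (deriv v t * deriv w t)
      + e2 * (b t * deriv v t * w t) + c t * v t * w t) := by
  have h1 := (hv.intervalIntegrable_deriv_mul hw).const_mul e1
  have h2 := (MemH10.intervalIntegrable_mul_deriv_mul hb hv hw.continuousOn).const_mul e2
  have h3 : IntervalIntegrable (fun t => c t * v t * w t) volume 0 1 :=
    intervalIntegrable_of_continuousOn_unit ((hc.mul hv.continuousOn).mul hw.continuousOn)
  refine ⟨(h1.add h2).add h3, ?_⟩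
  rw [intervalIntegral.integral_add (h1.add h2) h3, intervalIntegral.integral_add h1 h2,
    intervalIntegral.integral_const_mul, intervalIntegral.integral_const_mul]
  rfl

theorem bilin_sub_left (hb : ContinuousOn b (Icc 0 1)) (hc : ContinuousOn c (Icc 0 1))
    (hv : MemH10 v) (hw : MemH10 w) (hz : MemH10 z) :
    bilin e1 e2 b c (fun s => v s - w s) z = bilin e1 e2 b c v z - bilin e1 e2 b c w z := by
  rw [(bilin_eq_integral hb hc (hv.sub hw) hz).2, (bilin_eq_integral hb hc hv hz).2,
    (bilin_eq_integral hb hc hw hz).2, ← intervalIntegral.integral_sub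
      (bilin_eq_integral hb hc hv hz).1 (bilin_eq_integral hb hc hw hz).1]
  refine intervalIntegral.integral_congr_ae ?_
  filter_upwards [hv.deriv_sub_ae hw] with t h ht
  rw [h ht]
  ring

theorem bilin_neg_left : bilin e1 e2 b c (fun s => -v s) z = -bilin e1 e2 b c v z := by
  have : deriv (fun s => -v s) = fun s => -deriv v s := funext fun s => deriv.fun_neg
  simp only [bilin, l2Inner, this, mul_neg, neg_mul, intervalIntegral.integral_neg]
  ring

/-- The absolutely continuous function `b v²` vanishes at both ends, so the integral of its
derivative `b' v² + 2 b v v'` is zero. -/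
theorem integral_mul_deriv_mul_self (hb : ContDiff ℝ 1 b) (hv : MemH10 v) :
    ∫ t in (0 : ℝ)..1, b t * deriv v t * v t
      = -(1 / 2) * ∫ t in (0 : ℝ)..1, deriv b t * v t ^ 2 := by
  have hbA : AbsolutelyContinuousOnInterval b 0 1 :=
    hb.contDiffOn.absolutelyContinuousOnInterval
  have hbd : Continuous (deriv b) := hb.continuous_deriv le_rfl
  have h := (hbA.fun_mul hv.absCont).integral_deriv_mul_eq_sub hv.absCont
  rw [hv.left_eq_zero, hv.right_eq_zero, mul_zero, mul_zero, sub_zero] at h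
  have i1 := MemH10.intervalIntegrable_mul_deriv_mul hb.continuous.continuousOn hv hv.continuousOn
  have i2 : IntervalIntegrable (fun t => deriv b t * v t ^ 2) volume 0 1 :=
    intervalIntegrable_of_continuousOn_unit (hbd.continuousOn.mul (hv.continuousOn.pow 2))
  have h' : ∫ t in (0 : ℝ)..1, (deriv (fun t => b t * v t) t * v t + b t * v t * deriv v t)
      = ∫ t in (0 : ℝ)..1, (deriv b t * v t ^ 2 + 2 * (b t * deriv v t * v t)) := by
    refine intervalIntegral.integral_congr_ae ?_
    filter_upwards [hv.absCont.ae_differentiableAt] with t h1 ht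
    have h2 := h1 (uIoc_subset_uIcc ht)
    rw [deriv_fun_mul (hb.differentiable one_ne_zero t) h2]
    ring
  rw [h', intervalIntegral.integral_add i2 (i1.const_mul 2),
    intervalIntegral.integral_const_mul] at h
  linarith

theorem bilin_self_ge (hb : ContDiff ℝ 1 b) (hc : ContinuousOn c (Icc 0 1)) (hv : MemH10 v)
    (hγ : ∀ x ∈ Icc (0 : ℝ) 1, γ ≤ c x - 1 / 2 * e2 * deriv b x) :
    e1 * l2Inner (deriv v) (deriv v) + γ * l2Inner v v ≤ bilin e1 e2 b c v v := by
  have hbd : Continuous (deriv b) := hb.continuous_deriv le_rfl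
  have e : bilin e1 e2 b c v v = e1 * l2Inner (deriv v) (deriv v)
      + ∫ t in (0 : ℝ)..1, (c t - 1 / 2 * e2 * deriv b t) * v t ^ 2 := by
    have i2 : IntervalIntegrable (fun t => deriv b t * v t ^ 2) volume 0 1 :=
      intervalIntegrable_of_continuousOn_unit (hbd.continuousOn.mul (hv.continuousOn.pow 2))
    have i3 : IntervalIntegrable (fun t => c t * v t * v t) volume 0 1 :=
      intervalIntegrable_of_continuousOn_unit ((hc.mul hv.continuousOn).mul hv.continuousOn)
    have h1 : ∀ t, (c t - 1 / 2 * e2 * deriv b t) * v t ^ 2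
        = c t * v t * v t - 1 / 2 * e2 * (deriv b t * v t ^ 2) := fun t => by ring
    simp only [h1]
    rw [intervalIntegral.integral_sub i3 (i2.const_mul _), intervalIntegral.integral_const_mul]
    simp only [bilin, l2Inner]
    rw [integral_mul_deriv_mul_self hb hv]
    ring
  rw [e]
  refine add_le_add le_rfl ?_
  rw [l2Inner, ← intervalIntegral.integral_const_mul]
  refine (intervalIntegral.integral_mono_on zero_le_one ?_ ?_ fun t ht => ?_)
  · exact (intervalIntegrable_of_continuousOn_unit (hv.continuousOn.mul hv.continuousOn)).const_mul _
  · exact intervalIntegrable_of_continuousOn_unit ((hc.sub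
      (hbd.continuousOn.const_smul (1 / 2 * e2))).mul (hv.continuousOn.pow 2))
  · rw [← sq]
    exact mul_le_mul_of_nonneg_right (hγ t ht) (sq_nonneg _)

theorem memH10_of_hasDerivAt {g g₁ : ℝ → ℝ} (h1 : ∀ x, HasDerivAt g (g₁ x) x) (hc : Continuous g₁)
    (h0 : g 0 = 0) (h0' : g 1 = 0) : MemH10 g where
  absCont := absolutelyContinuous_of_hasDerivAt h1 hc 0 1
  deriv_memLp := by
    have e : deriv g = g₁ := funext fun x => (h1 x).deriv
    rw [e]
    obtain ⟨M, hM⟩ := isCompact_Icc.exists_bound_of_continuousOn (s := Icc (0 : ℝ) 1) hc.continuousOn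
    refine MemLp.of_bound hc.aestronglyMeasurable M ?_
    rw [ae_restrict_iff' measurableSet_Ioo]
    exact Filter.Eventually.of_forall fun t ht => hM t (Ioo_subset_Icc_self ht)
  left_eq_zero := h0
  right_eq_zero := h0'

theorem bilin_of_hasDerivAt {g g₁ g₂ : ℝ → ℝ} (hb : Continuous b) (hc : Continuous c)
    (h1 : ∀ x, HasDerivAt g (g₁ x) x) (h2 : ∀ x, HasDerivAt g₁ (g₂ x) x) (hg2 : Continuous g₂)
    (hw : MemH10 w) :
    bilin e1 e2 b c g w
      = ∫ t in (0 : ℝ)..1, (-e1 * g₂ t + e2 * b t * g₁ t + c t * g t) * w t := by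
  have e : deriv g = g₁ := funext fun x => (h1 x).deriv
  have e' : deriv g₁ = g₂ := funext fun x => (h2 x).deriv
  have c0 : Continuous g := continuous_iff_continuousAt.mpr fun x => (h1 x).continuousAt
  have c1 : Continuous g₁ := continuous_iff_continuousAt.mpr fun x => (h2 x).continuousAt
  have ibp := (absolutelyContinuous_of_hasDerivAt h2 hg2 0 1).integral_mul_deriv_eq_deriv_mul
    hw.absCont
  rw [hw.left_eq_zero, hw.right_eq_zero, e'] at ibp
  have hwc := hw.continuousOn
  have i1 : IntervalIntegrable (fun t => g₂ t * w t) volume 0 1 :=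
    intervalIntegrable_of_continuousOn_unit (hg2.continuousOn.mul hwc)
  have i2 : IntervalIntegrable (fun t => b t * g₁ t * w t) volume 0 1 :=
    intervalIntegrable_of_continuousOn_unit ((hb.mul c1).continuousOn.mul hwc)
  have i3 : IntervalIntegrable (fun t => c t * g t * w t) volume 0 1 :=
    intervalIntegrable_of_continuousOn_unit ((hc.mul c0).continuousOn.mul hwc)
  have h : ∀ t, (-e1 * g₂ t + e2 * b t * g₁ t + c t * g t) * w t
      = -e1 * (g₂ t * w t) + e2 * (b t * g₁ t * w t) + c t * g t * w t := fun t => by ring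
  simp only [h]
  rw [intervalIntegral.integral_add ((i1.const_mul _).add (i2.const_mul _)) i3,
    intervalIntegral.integral_add (i1.const_mul _) (i2.const_mul _),
    intervalIntegral.integral_const_mul, intervalIntegral.integral_const_mul]
  simp only [bilin, l2Inner, e]
  rw [ibp]
  ring

/-- The positive part of `R - K` for `K ≥ 0`. -/
theorem memH10_max_sub {K : ℝ} (hR : MemH10 R) (hK : 0 ≤ K) :
    MemH10 (fun t => max (R t - K) 0) ∧ ∀ t ∈ Ioo (0 : ℝ) 1,
      deriv (fun t => max (R t - K) 0) t = if K < R t then deriv R t else 0 := by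
  have hd : ∀ t ∈ Ioo (0 : ℝ) 1,
      deriv (fun t => max (R t - K) 0) t = if K < R t then deriv R t else 0 := by
    intro t ht
    have hcont : ContinuousAt R t := hR.continuousOn.continuousAt (Icc_mem_nhds ht.1 ht.2)
    split_ifs with h
    · have : (fun t => max (R t - K) 0) =ᶠ[nhds t] fun t => R t - K := by
        filter_upwards [hcont.eventually (lt_mem_nhds h)] with s hs
        exact max_eq_left (sub_nonneg.mpr hs.le)
      rw [this.deriv_eq, deriv_sub_const]
    -- Where `R ≤ K` the truncation attains its minimum `0`, so `deriv` is zero there, also at a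
    -- kink, where zero is the default value. Thus the formula holds at every interior point and no
    -- exceptional null set arises.
    · have hmin : IsLocalMin (fun t => max (R t - K) 0) t := by
        refine Filter.Eventually.of_forall fun s => ?_
        have : max (R t - K) 0 = 0 := max_eq_right (by linarith)
        simp only [this]
        exact le_max_right _ _
      exact hmin.deriv_eq_zero
  refine ⟨⟨?_, ?_, ?_, ?_⟩, hd⟩
  · have hA := hR.absCont
    rw [absolutelyContinuousOnInterval_iff] at hA ⊢
    intro ε hε
    obtain ⟨δ, hδ, h⟩ := hA ε hε
    refine ⟨δ, hδ, fun E hE hs => lt_of_le_of_lt (Finset.sum_le_sum fun i _ => ?_) (h E hE hs)⟩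
    rw [Real.dist_eq, Real.dist_eq]
    refine (abs_max_sub_max_le_abs _ _ _).trans (le_of_eq ?_)
    congr 1; ring
  · refine MemLp.of_le hR.deriv_memLp (measurable_deriv _).aestronglyMeasurable ?_
    rw [ae_restrict_iff' measurableSet_Ioo]
    refine Filter.Eventually.of_forall fun t ht => ?_
    rw [hd t ht]
    split_ifs
    · exact le_rfl
    · simp
  · rw [hR.left_eq_zero]; simpa using hK
  · rw [hR.right_eq_zero]; simpa using hK

/-- Stampacchia truncation: test with `v = (R - K)⁺`, `K = ρ/β`. On the set where `v > 0` the
functions `R` and `v` differ by the constant `K`, so `a(v, v) = (r - K c, v) ≤ 0`, and coercivity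
forces `v = 0`. -/
theorem le_of_bilin_eq (he1 : 0 ≤ e1) (hγ0 : 0 < γ) (hβ : 0 < β) (hρ : 0 ≤ ρ)
    (hb : ContDiff ℝ 1 b)
    (hc : ContinuousOn c (Icc 0 1)) (hγ : ∀ x ∈ Icc (0 : ℝ) 1, γ ≤ c x - 1 / 2 * e2 * deriv b x)
    (hcl : ∀ x ∈ Icc (0 : ℝ) 1, β ≤ c x) (hR : MemH10 R) (hr : ContinuousOn r (Icc 0 1))
    (hrρ : ∀ x ∈ Icc (0 : ℝ) 1, r x ≤ ρ)
    (h : ∀ v, MemH10 v → bilin e1 e2 b c R v = l2Inner r v) :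
    ∀ x ∈ Icc (0 : ℝ) 1, R x ≤ ρ / β := by
  have hK : 0 ≤ ρ / β := div_nonneg hρ hβ.le
  set K := ρ / β with hKdef
  obtain ⟨hv, hd⟩ := memH10_max_sub hR hK
  set v : ℝ → ℝ := fun t => max (R t - K) 0 with hvdef
  have hvn : ∀ t, 0 ≤ v t := fun t => le_max_right _ _
  have hvc := hv.continuousOn
  have hrv : IntervalIntegrable (fun t => r t * v t) volume 0 1 :=
    intervalIntegrable_of_continuousOn_unit (hr.mul hvc)
  have hcv : IntervalIntegrable (fun t => K * (c t * v t)) volume 0 1 :=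
    (intervalIntegrable_of_continuousOn_unit (hc.mul hvc)).const_mul _
  have key : bilin e1 e2 b c v v = bilin e1 e2 b c R v - ∫ t in (0 : ℝ)..1, K * (c t * v t) := by
    have hbc := hb.continuous.continuousOn (s := Icc (0 : ℝ) 1)
    rw [(bilin_eq_integral hbc hc hv hv).2, (bilin_eq_integral hbc hc hR hv).2,
      ← intervalIntegral.integral_sub (bilin_eq_integral hbc hc hR hv).1 hcv]
    refine intervalIntegral.integral_congr_ae ?_
    have h1 : ∀ᵐ t : ℝ, t ≠ 1 := by simp [ae_iff, measure_singleton]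
    filter_upwards [h1] with t ht1 ht
    rw [uIoc_of_le zero_le_one] at ht
    have htt : t ∈ Ioo (0 : ℝ) 1 := ⟨ht.1, lt_of_le_of_ne ht.2 ht1⟩
    rw [hd t htt]
    split_ifs with hlt
    · have : v t = R t - K := max_eq_left (by linarith)
      rw [this]; ring
    · have : v t = 0 := max_eq_right (by linarith)
      rw [this]; ring
  have h1 := bilin_self_ge (e1 := e1) hb hc hv hγ
  have h2 : bilin e1 e2 b c v v ≤ 0 := by
    rw [key, h v hv, l2Inner, ← intervalIntegral.integral_sub hrv hcv]
    refine (intervalIntegral.integral_mono_on zero_le_one (hrv.sub hcv)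
      (continuous_const.intervalIntegrable 0 1) (g := fun _ => (0 : ℝ)) fun t ht => ?_).trans
      (by simp)
    have h3 : r t ≤ K * c t := by
      calc r t ≤ ρ := hrρ t ht
        _ = K * β := by rw [hKdef]; field_simp
        _ ≤ K * c t := mul_le_mul_of_nonneg_left (hcl t ht) hK
    have h4 := mul_le_mul_of_nonneg_right h3 (hvn t)
    linarith
  have h3 : 0 ≤ l2Inner (deriv v) (deriv v) :=
    intervalIntegral.integral_nonneg zero_le_one fun t _ => mul_self_nonneg _
  have h4 : l2Inner v v ≤ 0 := by
    have h5 := mul_nonneg he1 h3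
    by_contra h6
    have := mul_pos hγ0 (not_le.mp h6)
    linarith
  intro x hx
  by_contra hx1
  have hpos : 0 < v x := lt_max_of_lt_left (sub_pos.mpr (not_le.mp hx1))
  have : 0 < l2Inner v v := intervalIntegral.integral_pos zero_lt_one (hvc.mul hvc)
    (fun t _ => mul_self_nonneg _) ⟨x, hx, mul_pos hpos hpos⟩
  linarith

theorem abs_le_of_bilin_eq (he1 : 0 ≤ e1) (hγ0 : 0 < γ) (hβ : 0 < β) (hρ : 0 ≤ ρ)
    (hb : ContDiff ℝ 1 b)
    (hc : ContinuousOn c (Icc 0 1)) (hγ : ∀ x ∈ Icc (0 : ℝ) 1, γ ≤ c x - 1 / 2 * e2 * deriv b x)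
    (hcl : ∀ x ∈ Icc (0 : ℝ) 1, β ≤ c x) (hR : MemH10 R) (hr : ContinuousOn r (Icc 0 1))
    (hrρ : ∀ x ∈ Icc (0 : ℝ) 1, |r x| ≤ ρ)
    (h : ∀ v, MemH10 v → bilin e1 e2 b c R v = l2Inner r v) :
    ∀ x ∈ Icc (0 : ℝ) 1, |R x| ≤ ρ / β := by
  intro x hx
  refine abs_le'.mpr ⟨?_, ?_⟩
  · exact le_of_bilin_eq he1 hγ0 hβ hρ hb hc hγ hcl hR hr
      (fun x hx => (le_abs_self _).trans (hrρ x hx)) h x hx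
  · refine le_of_bilin_eq (R := fun x => -R x) (r := fun x => -r x) he1 hγ0 hβ hρ hb hc hγ hcl
      hR.neg hr.neg (fun x hx => (neg_le_abs _).trans (hrρ x hx)) (fun v hv => ?_) x hx
    rw [bilin_neg_left, h v hv]
    simp [l2Inner]

/-- Young's inequality `r R ≤ γ R² + ρ²/(4γ)` uses up exactly the `L²` part of the coercivity bound.
-/
theorem energy_le_of_bilin_eq (hγ0 : 0 < γ) (hb : ContDiff ℝ 1 b)
    (hc : ContinuousOn c (Icc 0 1)) (hγ : ∀ x ∈ Icc (0 : ℝ) 1, γ ≤ c x - 1 / 2 * e2 * deriv b x)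
    (hR : MemH10 R) (hr : ContinuousOn r (Icc 0 1)) (hrρ : ∀ x ∈ Icc (0 : ℝ) 1, |r x| ≤ ρ)
    (h : ∀ v, MemH10 v → bilin e1 e2 b c R v = l2Inner r v) :
    e1 * l2Inner (deriv R) (deriv R) ≤ ρ ^ 2 / (4 * γ) := by
  have h1 := bilin_self_ge (e1 := e1) hb hc hR hγ
  rw [h R hR] at h1
  have hRc := hR.continuousOn
  have i1 : IntervalIntegrable (fun t => R t * R t) volume 0 1 :=
    intervalIntegrable_of_continuousOn_unit (hRc.mul hRc)
  have h2 : l2Inner r R ≤ ∫ t in (0 : ℝ)..1, (γ * (R t * R t) + ρ ^ 2 / (4 * γ)) := by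
    refine intervalIntegral.integral_mono_on zero_le_one
      (intervalIntegrable_of_continuousOn_unit (hr.mul hRc))
      ((i1.const_mul _).add (continuous_const.intervalIntegrable _ _)) fun t ht => ?_
    have h3 : r t ^ 2 ≤ ρ ^ 2 := sq_le_sq' (neg_le_of_abs_le (hrρ t ht)) (le_of_abs_le (hrρ t ht))
    have h4 : r t ^ 2 / (4 * γ) ≤ ρ ^ 2 / (4 * γ) := div_le_div_of_nonneg_right h3 (by positivity)
    have h5 : γ * (R t * R t) + r t ^ 2 / (4 * γ) - r t * R t
        = γ * (R t - r t / (2 * γ)) ^ 2 := by field_simp; ring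
    have h6 : 0 ≤ γ * (R t - r t / (2 * γ)) ^ 2 := by positivity
    linarith
  rw [intervalIntegral.integral_add (i1.const_mul _) (continuous_const.intervalIntegrable _ _),
    intervalIntegral.integral_const_mul] at h2
  simp only [intervalIntegral.integral_const, sub_zero, one_smul] at h2
  simp only [l2Inner] at h1 h2 ⊢
  linarith

end Bilinear


/-! ### Piecewise linear functions and their nodal values. -/

theorem integral_congr_on_Ioo {a b : ℝ} (hab : a ≤ b) {f g : ℝ → ℝ}
    (h : ∀ t ∈ Ioo a b, f t = g t) : ∫ t in a..b, f t = ∫ t in a..b, g t := by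
  rw [intervalIntegral.integral_of_le hab, intervalIntegral.integral_of_le hab,
    integral_Ioc_eq_integral_Ioo, integral_Ioc_eq_integral_Ioo]
  exact setIntegral_congr_fun measurableSet_Ioo h

/-- The slope on the `i`-th interval of the piecewise linear function with nodal values `z`. -/
def slp (x z : ℕ → ℝ) (i : ℕ) : ℝ := (z (i + 1) - z i) / (x (i + 1) - x i)

/-- The restriction to the `i`-th interval of the piecewise linear function with nodal
values `z`. -/
def aff (x z : ℕ → ℝ) (i : ℕ) (t : ℝ) : ℝ := z i + slp x z i * (t - x i)

section Element

variable {x z y : ℕ → ℝ} {i N : ℕ}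

theorem aff_left : aff x z i (x i) = z i := by simp [aff]

theorem aff_right (h : x i < x (i + 1)) : aff x z i (x (i + 1)) = z (i + 1) := by
  have := sub_pos.mpr h
  rw [aff, slp, div_mul_cancel₀ _ this.ne']; ring

theorem continuous_aff : Continuous (aff x z i) := by unfold aff; fun_prop

theorem hasDerivAt_aff (t : ℝ) : HasDerivAt (aff x z i) (slp x z i) t := by
  have := (((hasDerivAt_id t).sub_const (x i)).const_mul (slp x z i)).const_add (z i)
  rw [mul_one] at this
  exact this

theorem slp_add : slp x (fun j => z j + y j) i = slp x z i + slp x y i := by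
  simp only [slp]; rw [← add_div]; congr 1; ring

theorem aff_add (t : ℝ) : aff x (fun j => z j + y j) i t = aff x z i t + aff x y i t := by
  simp only [aff, slp_add]; ring

theorem aff_eq_convex (h : x i < x (i + 1)) (t : ℝ) :
    aff x z i t = (x (i + 1) - t) / (x (i + 1) - x i) * z i
      + (t - x i) / (x (i + 1) - x i) * z (i + 1) := by
  have := (sub_pos.mpr h).ne'
  rw [aff, slp]; field_simp; ring

theorem abs_aff_le {M : ℝ} (h : x i < x (i + 1)) {t : ℝ} (ht : t ∈ Icc (x i) (x (i + 1)))
    (h0 : |z i| ≤ M) (h1 : |z (i + 1)| ≤ M) : |aff x z i t| ≤ M := by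
  have hh := sub_pos.mpr h
  rw [aff_eq_convex h]
  have a0 : 0 ≤ (x (i + 1) - t) / (x (i + 1) - x i) := div_nonneg (by linarith [ht.2]) hh.le
  have a1 : 0 ≤ (t - x i) / (x (i + 1) - x i) := div_nonneg (by linarith [ht.1]) hh.le
  have e : (x (i + 1) - t) / (x (i + 1) - x i) + (t - x i) / (x (i + 1) - x i) = 1 := by
    field_simp; ring
  refine (abs_add_le _ _).trans ?_
  rw [abs_mul, abs_mul, abs_of_nonneg a0, abs_of_nonneg a1]
  calc _ ≤ (x (i + 1) - t) / (x (i + 1) - x i) * M + (t - x i) / (x (i + 1) - x i) * M := by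
        gcongr
    _ = M := by rw [← add_mul, e, one_mul]

/-- The integral is `h (z_i² + z_i z_{i+1} + z_{i+1}²)/3`, which exceeds the left side by `h (z_i +
z_{i+1})²/6`. -/
theorem le_integral_aff_sq (h : x i < x (i + 1)) :
    (x (i + 1) - x i) * (z i ^ 2 + z (i + 1) ^ 2) / 6
      ≤ ∫ t in x i..x (i + 1), aff x z i t ^ 2 := by
  have hd : ∀ t ∈ uIcc (x i) (x (i + 1)), HasDerivAt (fun t => z i ^ 2 * (t - x i)
      + z i * slp x z i * (t - x i) ^ 2 + slp x z i ^ 2 * (t - x i) ^ 3 / 3)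
      (aff x z i t ^ 2) t := by
    intro t _
    have h1 := (hasDerivAt_id t).sub_const (x i)
    have := ((h1.const_mul (z i ^ 2)).add ((h1.pow 2).const_mul (z i * slp x z i))).add
      (((h1.pow 3).const_mul (slp x z i ^ 2)).div_const 3)
    refine this.congr_deriv ?_
    simp only [id, aff]
    push_cast
    ring
  rw [intervalIntegral.integral_eq_sub_of_hasDerivAt hd
    ((continuous_aff.pow 2).intervalIntegrable _ _)]
  have hh := sub_pos.mpr h
  have hs : slp x z i * (x (i + 1) - x i) = z (i + 1) - z i := by
    rw [slp, div_mul_cancel₀ _ hh.ne']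
  have e : z i ^ 2 * (x (i + 1) - x i) + z i * slp x z i * (x (i + 1) - x i) ^ 2
      + slp x z i ^ 2 * (x (i + 1) - x i) ^ 3 / 3
      = (x (i + 1) - x i) * (z i ^ 2 + z i * (z (i + 1) - z i) + (z (i + 1) - z i) ^ 2 / 3) := by
    rw [← hs]; ring
  rw [e]
  simp only [sub_self]
  nlinarith [mul_nonneg hh.le (sq_nonneg (z i + z (i + 1)))]

end Element

/-- The energy of the piecewise linear function with nodal values `z`. -/
def nodalEnergy (e1 : ℝ) (x : ℕ → ℝ) (N : ℕ) (z : ℕ → ℝ) : ℝ :=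
  e1 * ∑ i ∈ Finset.range N, (x (i + 1) - x i) * slp x z i ^ 2
    + ∑ i ∈ Finset.range N, ∫ t in x i..x (i + 1), aff x z i t ^ 2

section Mesh

variable {x z y : ℕ → ℝ} {N : ℕ} {w : ℝ → ℝ} {e1 e2 : ℝ} {b c : ℝ → ℝ}

theorem nodalEnergy_add_le (h : IsMesh x N) (he1 : 0 ≤ e1) :
    nodalEnergy e1 x N (fun j => z j + y j)
      ≤ 2 * nodalEnergy e1 x N z + 2 * nodalEnergy e1 x N y := by
  have h1 : ∑ i ∈ Finset.range N, (x (i + 1) - x i) * slp x (fun j => z j + y j) i ^ 2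
      ≤ 2 * ∑ i ∈ Finset.range N, (x (i + 1) - x i) * slp x z i ^ 2
        + 2 * ∑ i ∈ Finset.range N, (x (i + 1) - x i) * slp x y i ^ 2 := by
    rw [Finset.mul_sum, Finset.mul_sum, ← Finset.sum_add_distrib]
    refine Finset.sum_le_sum fun i hi => ?_
    have hh := (sub_pos.mpr (h.lt i (Finset.mem_range.mp hi))).le
    rw [slp_add]
    nlinarith [mul_nonneg hh (sq_nonneg (slp x z i - slp x y i))]
  have h2 : ∑ i ∈ Finset.range N, ∫ t in x i..x (i + 1), aff x (fun j => z j + y j) i t ^ 2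
      ≤ 2 * (∑ i ∈ Finset.range N, ∫ t in x i..x (i + 1), aff x z i t ^ 2)
        + 2 * ∑ i ∈ Finset.range N, ∫ t in x i..x (i + 1), aff x y i t ^ 2 := by
    rw [Finset.mul_sum, Finset.mul_sum, ← Finset.sum_add_distrib]
    refine Finset.sum_le_sum fun i hi => ?_
    have hlt := h.lt i (Finset.mem_range.mp hi)
    have ii : ∀ z : ℕ → ℝ, IntervalIntegrable (fun t => 2 * aff x z i t ^ 2) volume (x i) (x (i + 1)) :=
      fun z => ((continuous_aff.pow 2).const_mul 2).intervalIntegrable _ _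
    rw [← intervalIntegral.integral_const_mul, ← intervalIntegral.integral_const_mul,
      ← intervalIntegral.integral_add (ii z) (ii y)]
    refine intervalIntegral.integral_mono_on hlt.le
      ((continuous_aff.pow 2).intervalIntegrable _ _) ((ii z).add (ii y)) fun t _ => ?_
    rw [aff_add]
    nlinarith [sq_nonneg (aff x z i t - aff x y i t)]
  have h3 := mul_le_mul_of_nonneg_left h1 he1
  simp only [nodalEnergy]
  linarith

theorem continuousOn_of_pieces (h : IsMesh x N)
    (hw : ∀ i < N, ContinuousOn w (Icc (x i) (x (i + 1)))) : ContinuousOn w (Icc 0 1) := by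
  have : ∀ k ≤ N, ContinuousOn w (Icc (x 0) (x k)) := by
    intro k
    induction k with
    | zero => intro _; simp
    | succ k ih =>
      intro hk
      have h1 := (ih (by omega)).union_of_isClosed (hw k (by omega)) isClosed_Icc isClosed_Icc
      rwa [Icc_union_Icc_eq_Icc (h.le_of_le (Nat.zero_le _) (by omega)) (h.lt k (by omega)).le] at h1
  have := this N le_rfl
  rwa [h.zero, h.one] at this

namespace MemVN

theorem eq_aff (h : IsMesh x N) (hw : MemVN x N w) {i : ℕ} (hi : i < N) {t : ℝ}
    (ht : t ∈ Icc (x i) (x (i + 1))) : w t = aff x (fun j => w (x j)) i t := by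
  obtain ⟨m, k, hmk⟩ := hw.affine i hi
  have hh := (sub_pos.mpr (h.lt i hi)).ne'
  rw [hmk t ht, aff, slp, hmk _ (left_mem_Icc.mpr (h.lt i hi).le),
    hmk _ (right_mem_Icc.mpr (h.lt i hi).le)]
  field_simp
  ring

theorem deriv_eq (h : IsMesh x N) (hw : MemVN x N w) {i : ℕ} (hi : i < N) {t : ℝ}
    (ht : t ∈ Ioo (x i) (x (i + 1))) : deriv w t = slp x (fun j => w (x j)) i := by
  have : w =ᶠ[nhds t] aff x (fun j => w (x j)) i := by
    filter_upwards [Icc_mem_nhds ht.1 ht.2] with s hs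
    exact hw.eq_aff h hi hs
  rw [this.deriv_eq, (hasDerivAt_aff t).deriv]

/-- On `[0,1)` there is everywhere a right derivative, bounded by the sum of the absolute slopes.
The mean value inequality for right derivatives makes `w` Lipschitz, hence absolutely continuous
with bounded derivative. -/
theorem memH10 (h : IsMesh x N) (hw : MemVN x N w) : MemH10 w := by
  set z : ℕ → ℝ := fun j => w (x j) with hz
  set K : ℝ := ∑ i ∈ Finset.range N, |slp x z i| with hK
  have hK0 : 0 ≤ K := Finset.sum_nonneg fun i _ => abs_nonneg _
  have hslp : ∀ i < N, |slp x z i| ≤ K := fun i hi =>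
    Finset.single_le_sum (f := fun i => |slp x z i|) (fun j _ => abs_nonneg _)
      (Finset.mem_range.mpr hi)
  have hder : ∀ t ∈ Ico (0 : ℝ) 1, ∃ s, |s| ≤ K ∧ HasDerivWithinAt w s (Ici t) t := by
    intro t ht
    obtain ⟨i, hi, hti⟩ := h.exists_mem_Ico ht
    refine ⟨slp x z i, hslp i hi, ?_⟩
    have h1 : w =ᶠ[nhdsWithin t (Ici t)] aff x z i := by
      filter_upwards [Icc_mem_nhdsGE hti.2] with s hs
      exact hw.eq_aff h hi ⟨hti.1.trans hs.1, hs.2⟩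
    exact (hasDerivAt_aff t).hasDerivWithinAt.congr_of_eventuallyEq h1
      (hw.eq_aff h hi (Ico_subset_Icc_self hti))
  have hlip' : ∀ s ∈ Icc (0 : ℝ) 1, ∀ t ∈ Icc (0 : ℝ) 1, s ≤ t → |w t - w s| ≤ K * (t - s) := by
    intro s hs t ht hst
    have hsub : Icc s t ⊆ Icc 0 1 := Icc_subset_Icc hs.1 ht.2
    refine norm_image_sub_le_of_norm_deriv_right_le_segment (f := w)
      (f' := fun r => derivWithin w (Ici r) r) (hw.continuousOn.mono hsub) ?_ ?_ t ⟨hst, le_rfl⟩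
    · intro r hr
      obtain ⟨d, _, hd⟩ := hder r ⟨hs.1.trans hr.1, hr.2.trans_le ht.2⟩
      exact hd.differentiableWithinAt.hasDerivWithinAt
    · intro r hr
      obtain ⟨d, hdK, hd⟩ := hder r ⟨hs.1.trans hr.1, hr.2.trans_le ht.2⟩
      rw [hd.derivWithin (uniqueDiffWithinAt_Ici r)]
      exact hdK
  have hlip : LipschitzOnWith (NNReal.mk K hK0) w (Icc 0 1) := by
    refine LipschitzOnWith.of_dist_le_mul fun s hs t ht => ?_
    rw [Real.dist_eq, Real.dist_eq, NNReal.coe_mk]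
    rcases le_total s t with hst | hst
    · rw [abs_sub_comm, abs_sub_comm s t, abs_of_nonneg (sub_nonneg.mpr hst)]
      exact hlip' s hs t ht hst
    · rw [abs_of_nonneg (sub_nonneg.mpr hst)]
      exact hlip' t ht s hs hst
  refine ⟨LipschitzOnWith.absolutelyContinuousOnInterval (by rwa [uIcc_of_le zero_le_one]), ?_,
    hw.left_eq_zero, hw.right_eq_zero⟩
  refine MemLp.of_bound (measurable_deriv _).aestronglyMeasurable K ?_
  rw [ae_restrict_iff' measurableSet_Ioo]
  exact Filter.Eventually.of_forall fun t ht =>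
    norm_deriv_le_of_lipschitzOn (Icc_mem_nhds ht.1 ht.2) hlip

theorem sub {v : ℝ → ℝ} (hv : MemVN x N v) (hw : MemVN x N w) :
    MemVN x N (fun t => v t - w t) where
  continuousOn := hv.continuousOn.sub hw.continuousOn
  left_eq_zero := by rw [hv.left_eq_zero, hw.left_eq_zero, sub_zero]
  right_eq_zero := by rw [hv.right_eq_zero, hw.right_eq_zero, sub_zero]
  affine i hi := by
    obtain ⟨m, k, h1⟩ := hv.affine i hi
    obtain ⟨m', k', h2⟩ := hw.affine i hi
    refine ⟨m - m', k - k', fun t ht => ?_⟩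
    rw [h1 t ht, h2 t ht]; ring

theorem energy_eq (h : IsMesh x N) (hw : MemVN x N w) :
    e1 * l2Inner (deriv w) (deriv w) + l2Inner w w
      = nodalEnergy e1 x N (fun j => w (x j)) := by
  have hH := hw.memH10 h
  have h1 : l2Inner (deriv w) (deriv w)
      = ∑ i ∈ Finset.range N, (x (i + 1) - x i) * slp x (fun j => w (x j)) i ^ 2 := by
    rw [l2Inner, ← h.sum_integral (hH.intervalIntegrable_deriv_mul hH)]
    refine Finset.sum_congr rfl fun i hi => ?_
    have hi := Finset.mem_range.mp hi
    rw [integral_congr_on_Ioo (h.lt i hi).le (g := fun _ => slp x (fun j => w (x j)) i ^ 2)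
      fun t ht => by rw [hw.deriv_eq h hi ht, sq]]
    simp
  have h2 : l2Inner w w
      = ∑ i ∈ Finset.range N, ∫ t in x i..x (i + 1), aff x (fun j => w (x j)) i t ^ 2 := by
    have hi : IntervalIntegrable (fun t => w t * w t) volume 0 1 :=
      intervalIntegrable_of_continuousOn_unit (hw.continuousOn.mul hw.continuousOn)
    rw [l2Inner, ← h.sum_integral hi]
    refine Finset.sum_congr rfl fun i hi => ?_
    have hi := Finset.mem_range.mp hi
    exact integral_congr_on_Ioo (h.lt i hi).le fun t ht => by
      rw [hw.eq_aff h hi (Ioo_subset_Icc_self ht), sq]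
  rw [h1, h2, nodalEnergy]

end MemVN

theorem lagrangeInterp_eq_aff (h : IsMesh x N) (v : ℝ → ℝ) {i : ℕ} (hi : i < N) {t : ℝ}
    (ht : t ∈ Icc (x i) (x (i + 1))) :
    lagrangeInterp x N v t = aff x (fun j => v (x j)) i t := by
  have hlt := h.lt i hi
  have hh := (sub_pos.mpr hlt)
  have hi0 : hat x N i t = (x (i + 1) - t) / (x (i + 1) - x i) := by
    unfold hat
    -- At the common node of two cells the first branch of `hat` takes precedence; both branches
    -- give the value one there.
    by_cases h1 : 1 ≤ i ∧ x (i - 1) ≤ t ∧ t ≤ x i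
    · rw [if_pos h1]
      have e : t = x i := le_antisymm h1.2.2 ht.1
      have h3 := h.lt (i - 1) (by omega)
      rw [Nat.sub_add_cancel h1.1] at h3
      rw [e, div_self (sub_pos.mpr h3).ne', div_self hh.ne']
    · rw [if_neg h1, if_pos ⟨hi, ht.1, ht.2⟩]
  have hi1 : hat x N (i + 1) t = (t - x i) / (x (i + 1) - x i) := by
    unfold hat
    rw [if_pos ⟨by omega, by simpa using ht.1, ht.2⟩]
    simp
  have hj : ∀ j ∈ Finset.range (N + 1), j ≠ i → j ≠ i + 1 → hat x N j t = 0 := by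
    intro j hj h1 h2
    have hj' := Finset.mem_range.mp hj
    unfold hat
    split_ifs with h3 h4
    · rcases lt_or_gt_of_ne h1 with h5 | h5
      · have h6 := h.le_of_le (show j ≤ i by omega) (by omega)
        have h7 := h.lt j (by omega)
        have h8 := h.le_of_le (show j + 1 ≤ i by omega) (by omega)
        linarith [ht.1, h3.2.2]
      · have h6 := h.le_of_le (show i + 1 ≤ j - 1 by omega) (by omega)
        have e : t = x (j - 1) := le_antisymm (ht.2.trans h6) h3.2.1
        rw [e, sub_self, zero_div]
    · rcases lt_or_gt_of_ne h1 with h5 | h5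
      · have h6 := h.le_of_le (show j + 1 ≤ i by omega) (by omega)
        have e : t = x (j + 1) := le_antisymm h4.2.2 (h6.trans ht.1)
        rw [e, sub_self, zero_div]
      · have h6 := h.le_of_le (show i + 2 ≤ j by omega) (by omega)
        have h7 := h.lt (i + 1) (by omega)
        have h8 : x (i + 1 + 1) ≤ x j := h6
        linarith [ht.2, h4.2.1]
    · rfl
  unfold lagrangeInterp
  rw [Finset.sum_eq_add_of_mem i (i + 1) (Finset.mem_range.mpr (by omega))
    (Finset.mem_range.mpr (by omega)) (by omega)
    (fun j hjr hne => by rw [hj j hjr hne.1 hne.2, mul_zero]), hi0, hi1, aff_eq_convex hlt]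
  ring

theorem lagrangeInterp_node (h : IsMesh x N) (v : ℝ → ℝ) {j : ℕ} (hj : j ≤ N) :
    lagrangeInterp x N v (x j) = v (x j) := by
  rcases Nat.lt_or_ge j N with h1 | h1
  · rw [lagrangeInterp_eq_aff h v h1 (left_mem_Icc.mpr (h.lt j h1).le), aff_left]
  · have hN : 0 < N := by
      rcases Nat.eq_zero_or_pos N with h0 | h0
      · have h3 := h.one
        rw [h0, h.zero] at h3
        norm_num at h3
      · exact h0
    obtain ⟨k, rfl⟩ : ∃ k, N = k + 1 := ⟨N - 1, by omega⟩
    have hk : j = k + 1 := by omega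
    have h2 := h.lt k (by omega)
    rw [hk, lagrangeInterp_eq_aff h v (by omega : k < k + 1) (right_mem_Icc.mpr h2.le), aff_right h2]

theorem memVN_lagrangeInterp (h : IsMesh x N) {v : ℝ → ℝ} (h0 : v 0 = 0) (h1 : v 1 = 0) :
    MemVN x N (lagrangeInterp x N v) where
  continuousOn := continuousOn_of_pieces h fun i hi =>
    continuous_aff.continuousOn.congr fun t ht => lagrangeInterp_eq_aff h v hi ht
  left_eq_zero := by
    have := lagrangeInterp_node h v (Nat.zero_le N)
    rwa [h.zero, h0] at this
  right_eq_zero := by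
    have := lagrangeInterp_node h v (le_refl N)
    rwa [h.one, h1] at this
  affine i hi := ⟨slp x (fun j => v (x j)) i, v (x i) - slp x (fun j => v (x j)) i * x i,
    fun t ht => by rw [lagrangeInterp_eq_aff h v hi ht, aff]; ring⟩

/-- Each slope is the mean of `R'` over its cell, so by Jensen's inequality interpolation does not
increase `‖R'‖`; the interpolant is bounded by the maximum of `|R|`, which bounds its `L²` norm. -/
theorem nodalEnergy_sample_le {R : ℝ → ℝ} {K : ℝ} (h : IsMesh x N) (he1 : 0 ≤ e1) (hR : MemH10 R)
    (hK : ∀ t ∈ Icc (0 : ℝ) 1, |R t| ≤ K) :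
    nodalEnergy e1 x N (fun j => R (x j)) ≤ e1 * l2Inner (deriv R) (deriv R) + K ^ 2 := by
  refine add_le_add (mul_le_mul_of_nonneg_left ?_ he1) ?_
  · rw [l2Inner, ← h.sum_integral (hR.intervalIntegrable_deriv_mul hR)]
    refine Finset.sum_le_sum fun i hi => ?_
    have hi := Finset.mem_range.mp hi
    have hlt := h.lt i hi
    have hh := sub_pos.mpr hlt
    have hsub : uIcc (x i) (x (i + 1)) ⊆ uIcc 0 1 := by
      rw [uIcc_of_le hlt.le, uIcc_of_le zero_le_one]; exact h.Icc_subset hi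
    have hA := hR.absCont.mono hsub
    have i1 := hA.intervalIntegrable_deriv
    have i2 := (hR.intervalIntegrable_deriv_mul hR).mono_set hsub
    set s := slp x (fun j => R (x j)) i with hs
    have e1 : ∫ t in x i..x (i + 1), deriv R t = s * (x (i + 1) - x i) := by
      rw [hA.integral_deriv_eq_sub, hs, slp, div_mul_cancel₀ _ hh.ne']
    have h2 : ∫ t in x i..x (i + 1), (2 * s * deriv R t - s ^ 2)
        ≤ ∫ t in x i..x (i + 1), deriv R t * deriv R t := by
      refine intervalIntegral.integral_mono_on hlt.le
        ((i1.const_mul _).sub (continuous_const.intervalIntegrable _ _)) i2 fun t _ => ?_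
      -- Integrating this square with `s` equal to the mean of `R'` replaces Cauchy-Schwarz.
      nlinarith [sq_nonneg (deriv R t - s)]
    rw [intervalIntegral.integral_sub (i1.const_mul _) (continuous_const.intervalIntegrable _ _),
      intervalIntegral.integral_const_mul, e1] at h2
    simp only [intervalIntegral.integral_const, smul_eq_mul] at h2
    linarith
  · have h1 : ∑ i ∈ Finset.range N, ∫ t in x i..x (i + 1), K ^ 2 = K ^ 2 := by
      rw [h.sum_integral (continuous_const.intervalIntegrable _ _)]; simp
    rw [← h1]
    refine Finset.sum_le_sum fun i hi => ?_
    have hi := Finset.mem_range.mp hi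
    have hlt := h.lt i hi
    refine intervalIntegral.integral_mono_on hlt.le ((continuous_aff.pow 2).intervalIntegrable _ _)
      (continuous_const.intervalIntegrable _ _) fun t ht => ?_
    have := abs_aff_le (z := fun j => R (x j)) hlt ht (hK _ (h.mem_Icc hi.le))
      (hK _ (h.mem_Icc hi))
    exact sq_le_sq' (neg_le_of_abs_le this) (le_of_abs_le this)

/-- There is no term with `ε₁`: the test function has constant slope on a cell, and the derivative
of the interpolation error has mean zero there. -/
theorem bilin_interp_error {g g₁ : ℝ → ℝ} (h : IsMesh x N) (hb : Continuous b) (hc : Continuous c)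
    (hg : ∀ t, HasDerivAt g (g₁ t) t) (hg1 : Continuous g₁) (h0 : g 0 = 0) (h1 : g 1 = 0)
    (hw : MemVN x N w) :
    bilin e1 e2 b c (fun s => lagrangeInterp x N g s - g s) w
      = ∑ i ∈ Finset.range N,
        (e2 * (∫ t in x i..x (i + 1), b t * (slp x (fun j => g (x j)) i - g₁ t)
            * aff x (fun j => w (x j)) i t)
          + ∫ t in x i..x (i + 1), c t * (aff x (fun j => g (x j)) i t - g t)
            * aff x (fun j => w (x j)) i t) := by
  have hI := memVN_lagrangeInterp h h0 h1
  have hgH := memH10_of_hasDerivAt hg hg1 h0 h1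
  have hgc : Continuous g := continuous_iff_continuousAt.mpr fun t => (hg t).continuousAt
  obtain ⟨hint, heq⟩ := bilin_eq_integral (e1 := e1) (e2 := e2) hb.continuousOn hc.continuousOn
    ((hI.memH10 h).sub hgH) (hw.memH10 h)
  rw [heq, ← h.sum_integral hint]
  refine Finset.sum_congr rfl fun i hi => ?_
  have hi := Finset.mem_range.mp hi
  have hlt := h.lt i hi
  have hh := sub_pos.mpr hlt
  set s := slp x (fun j => g (x j)) i with hs
  set a := aff x (fun j => g (x j)) i with ha
  set ω := aff x (fun j => w (x j)) i with hω
  have cω : Continuous ω := continuous_aff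
  have ca : Continuous a := continuous_aff
  rw [integral_congr_on_Ioo hlt.le (g := fun t =>
    e1 * slp x (fun j => w (x j)) i * (s - g₁ t) + e2 * (b t * (s - g₁ t) * ω t)
      + c t * (a t - g t) * ω t)]
  · have j1 : IntervalIntegrable (fun t => s - g₁ t) volume (x i) (x (i + 1)) :=
      (continuous_const.sub hg1).intervalIntegrable _ _
    have j2 : IntervalIntegrable (fun t => b t * (s - g₁ t) * ω t) volume (x i) (x (i + 1)) :=
      ((hb.mul (continuous_const.sub hg1)).mul cω).intervalIntegrable _ _
    have j3 : IntervalIntegrable (fun t => c t * (a t - g t) * ω t) volume (x i) (x (i + 1)) :=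
      ((hc.mul (ca.sub hgc)).mul cω).intervalIntegrable _ _
    rw [intervalIntegral.integral_add ((j1.const_mul _).add (j2.const_mul _)) j3,
      intervalIntegral.integral_add (j1.const_mul _) (j2.const_mul _),
      intervalIntegral.integral_const_mul, intervalIntegral.integral_const_mul]
    have e : ∫ t in x i..x (i + 1), (s - g₁ t) = 0 := by
      rw [intervalIntegral.integral_sub (continuous_const.intervalIntegrable _ _)
        (hg1.intervalIntegrable _ _), intervalIntegral.integral_eq_sub_of_hasDerivAt
        (fun t _ => hg t) (hg1.intervalIntegrable _ _)]
      simp only [intervalIntegral.integral_const, smul_eq_mul]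
      rw [hs, slp]
      field_simp
      ring
    rw [e, mul_zero, zero_add]
  · intro t ht
    have htc := Ioo_subset_Icc_self ht
    have hd : deriv (fun s => lagrangeInterp x N g s - g s) t = s - g₁ t := by
      have : (fun s => lagrangeInterp x N g s - g s) =ᶠ[nhds t] fun s => a s - g s := by
        filter_upwards [Icc_mem_nhds ht.1 ht.2] with r hr
        rw [lagrangeInterp_eq_aff h g hi hr]
      rw [this.deriv_eq]
      exact ((hasDerivAt_aff t).sub (hg t)).deriv
    rw [hd, hw.deriv_eq h hi ht, hw.eq_aff h hi htc, lagrangeInterp_eq_aff h g hi htc]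
    ring

theorem integral_abs_le_sqrt (hw : ContinuousOn w (Icc 0 1)) :
    ∫ t in (0 : ℝ)..1, |w t| ≤ √(l2Inner w w) := by
  have i1 : IntervalIntegrable (fun t => |w t|) volume 0 1 :=
    intervalIntegrable_of_continuousOn_unit hw.abs
  set M := ∫ t in (0 : ℝ)..1, |w t| with hM
  refine Real.le_sqrt_of_sq_le ?_
  have h2 : ∫ t in (0 : ℝ)..1, (2 * M * |w t| - M ^ 2) ≤ l2Inner w w := by
    refine intervalIntegral.integral_mono_on zero_le_one
      ((i1.const_mul _).sub (continuous_const.intervalIntegrable _ _))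
      (intervalIntegrable_of_continuousOn_unit (hw.mul hw)) fun t _ => ?_
    nlinarith [sq_nonneg (|w t| - M), sq_abs (w t)]
  rw [intervalIntegral.integral_sub (i1.const_mul _) (continuous_const.intervalIntegrable _ _),
      intervalIntegral.integral_const_mul, ← hM] at h2
  simp only [intervalIntegral.integral_const, smul_eq_mul] at h2
  linarith

theorem abs_l2Inner_le {r : ℝ → ℝ} {ρ : ℝ} (hr : ∀ t ∈ Icc (0 : ℝ) 1, |r t| ≤ ρ)
    (hw : ContinuousOn w (Icc 0 1)) : |l2Inner r w| ≤ ρ * √(l2Inner w w) := by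
  have hρ : 0 ≤ ρ := (abs_nonneg _).trans (hr 0 (by simp))
  have i1 : IntervalIntegrable (fun t => |w t|) volume 0 1 :=
    intervalIntegrable_of_continuousOn_unit hw.abs
  refine le_trans ?_ (mul_le_mul_of_nonneg_left (integral_abs_le_sqrt hw) hρ)
  rw [← intervalIntegral.integral_const_mul]
  refine intervalIntegral.norm_integral_le_of_norm_le (f := fun t => r t * w t) zero_le_one
    (Filter.Eventually.of_forall fun t ht => ?_) (i1.const_mul ρ)
  rw [Real.norm_eq_abs, abs_mul]
  exact mul_le_mul_of_nonneg_right (hr t (Ioc_subset_Icc_self ht)) (abs_nonneg _)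

theorem sum_integral_abs_aff_le (h : IsMesh x N) (hw : MemVN x N w) :
    ∑ i ∈ Finset.range N, ∫ t in x i..x (i + 1), |aff x (fun j => w (x j)) i t|
      ≤ √(l2Inner w w) := by
  refine le_trans (le_of_eq ?_) (integral_abs_le_sqrt hw.continuousOn)
  rw [← h.sum_integral (intervalIntegrable_of_continuousOn_unit hw.continuousOn.abs)]
  refine Finset.sum_congr rfl fun i hi => ?_
  have hi := Finset.mem_range.mp hi
  exact integral_congr_on_Ioo (h.lt i hi).le fun t ht => by
    rw [hw.eq_aff h hi (Ioo_subset_Icc_self ht)]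

theorem nodalEnergy_congr (h : ∀ j ≤ N, z j = y j) :
    nodalEnergy e1 x N z = nodalEnergy e1 x N y := by
  have h1 : ∀ i < N, slp x z i = slp x y i := fun i hi => by
    rw [slp, slp, h i hi.le, h (i + 1) hi]
  have h2 : ∀ i < N, ∀ t, aff x z i t = aff x y i t := fun i hi t => by
    rw [aff, aff, h i hi.le, h1 i hi]
  rw [nodalEnergy, nodalEnergy]
  congr 1
  · exact congrArg _ (Finset.sum_congr rfl fun i hi => by rw [h1 i (Finset.mem_range.mp hi)])
  · exact Finset.sum_congr rfl fun i hi => by simp only [h2 i (Finset.mem_range.mp hi)]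

end Mesh


/-! ### Interpolation errors on a single cell. -/

section ElementError

variable {x z : ℕ → ℝ} {i : ℕ} {g g₁ g₂ g₃ b : ℝ → ℝ} {B B₁ D M K K₂ K₃ : ℝ}

/-- The slope equals `g'` at some point of the cell, so the derivative error is at most `K h`.
Integrating from the left node, where the error vanishes, yields `K h²`. -/
theorem abs_interp_error_le (hlt : x i < x (i + 1)) (hg : ∀ t, HasDerivAt g (g₁ t) t)
    (hg1 : ∀ t, HasDerivAt g₁ (g₂ t) t) (hK : ∀ t ∈ Icc (x i) (x (i + 1)), |g₂ t| ≤ K) :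
    ∀ t ∈ Icc (x i) (x (i + 1)),
      |aff x (fun j => g (x j)) i t - g t| ≤ K * (x (i + 1) - x i) ^ 2 ∧
      |slp x (fun j => g (x j)) i - g₁ t| ≤ K * (x (i + 1) - x i) := by
  have hh := sub_pos.mpr hlt
  have hK0 : 0 ≤ K := (abs_nonneg _).trans (hK _ (left_mem_Icc.mpr hlt.le))
  have hgc : Continuous g := continuous_iff_continuousAt.mpr fun t => (hg t).continuousAt
  obtain ⟨ξ, hξ, hs⟩ := exists_hasDerivAt_eq_slope g g₁ hlt hgc.continuousOn fun t _ => hg t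
  have hder : ∀ t ∈ Icc (x i) (x (i + 1)),
      |slp x (fun j => g (x j)) i - g₁ t| ≤ K * (x (i + 1) - x i) := by
    intro t ht
    have h1 := (convex_Icc (x i) (x (i + 1))).norm_image_sub_le_of_norm_hasDerivWithin_le
      (fun s _ => (hg1 s).hasDerivWithinAt) hK ht (Ioo_subset_Icc_self hξ)
    have h2 : ‖ξ - t‖ ≤ x (i + 1) - x i := by
      rw [Real.norm_eq_abs, abs_le]
      constructor <;> linarith [ht.1, ht.2, hξ.1, hξ.2]
    rw [hs] at h1
    exact h1.trans (mul_le_mul_of_nonneg_left h2 hK0)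
  intro t ht
  refine ⟨?_, hder t ht⟩
  have h1 := (convex_Icc (x i) (x (i + 1))).norm_image_sub_le_of_norm_hasDerivWithin_le
    (f := fun s => aff x (fun j => g (x j)) i s - g s)
    (fun s _ => ((hasDerivAt_aff s).sub (hg s)).hasDerivWithinAt) hder
    (left_mem_Icc.mpr hlt.le) ht
  rw [aff_left, sub_self, sub_zero] at h1
  have h2 : ‖t - x i‖ ≤ x (i + 1) - x i := by
    rw [Real.norm_eq_abs, abs_le]
    constructor <;> linarith [ht.1, ht.2]
  calc _ ≤ _ := h1
    _ ≤ K * (x (i + 1) - x i) * (x (i + 1) - x i) := mul_le_mul_of_nonneg_left h2 (by positivity)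
    _ = _ := by ring

theorem abs_interp_error_le_two (hlt : x i < x (i + 1))
    (hK : ∀ t ∈ Icc (x i) (x (i + 1)), |g t| ≤ K) :
    ∀ t ∈ Icc (x i) (x (i + 1)), |aff x (fun j => g (x j)) i t - g t| ≤ 2 * K := by
  intro t ht
  have h1 := abs_aff_le (z := fun j => g (x j)) hlt ht (hK _ (left_mem_Icc.mpr hlt.le))
    (hK _ (right_mem_Icc.mpr hlt.le))
  have h2 := abs_sub (aff x (fun j => g (x j)) i t) (g t)
  linarith [hK t ht]

theorem abs_integral_mul_mul_le {e ω : ℝ → ℝ} (hlt : x i < x (i + 1)) (hω : Continuous ω)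
    (hb : ∀ t ∈ Icc (x i) (x (i + 1)), |b t| ≤ B) (he : ∀ t ∈ Icc (x i) (x (i + 1)), |e t| ≤ D) :
    |∫ t in x i..x (i + 1), b t * e t * ω t| ≤ B * D * ∫ t in x i..x (i + 1), |ω t| := by
  rw [← intervalIntegral.integral_const_mul]
  have hB : 0 ≤ B := (abs_nonneg _).trans (hb _ (left_mem_Icc.mpr hlt.le))
  refine intervalIntegral.norm_integral_le_of_norm_le (f := fun t => b t * e t * ω t) hlt.le
    (Filter.Eventually.of_forall fun t ht => ?_) ((hω.abs.const_mul _).intervalIntegrable _ _)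
  have ht' := Ioc_subset_Icc_self ht
  rw [Real.norm_eq_abs, abs_mul, abs_mul]
  exact mul_le_mul_of_nonneg_right (mul_le_mul (hb t ht') (he t ht') (abs_nonneg _) hB)
    (abs_nonneg _)

/-- Both `|s| h` and `∫ |g'|` are at most the increment of `V`. No smallness of the step is used and
the bound telescopes over cells, which suits regions where the layer is negligible but the mesh is
too coarse to resolve it. -/
theorem abs_conv_le_of_antideriv {V V' ω : ℝ → ℝ} (hlt : x i < x (i + 1))
    (hg : ∀ t, HasDerivAt g (g₁ t) t) (hg1 : Continuous g₁)
    (hb : ∀ t ∈ Icc (x i) (x (i + 1)), |b t| ≤ B) (hω : ∀ t ∈ Icc (x i) (x (i + 1)), |ω t| ≤ M)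
    (hV : ∀ t, HasDerivAt V (V' t) t) (hV' : Continuous V')
    (hgV : ∀ t ∈ Icc (x i) (x (i + 1)), |g₁ t| ≤ V' t) :
    |∫ t in x i..x (i + 1), b t * (slp x (fun j => g (x j)) i - g₁ t) * ω t|
      ≤ 2 * B * M * (V (x (i + 1)) - V (x i)) := by
  have hh := sub_pos.mpr hlt
  have hB : 0 ≤ B := (abs_nonneg _).trans (hb _ (left_mem_Icc.mpr hlt.le))
  have hM : 0 ≤ M := (abs_nonneg _).trans (hω _ (left_mem_Icc.mpr hlt.le))
  have hVi : ∫ t in x i..x (i + 1), V' t = V (x (i + 1)) - V (x i) :=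
    intervalIntegral.integral_eq_sub_of_hasDerivAt (fun t _ => hV t) (hV'.intervalIntegrable _ _)
  set s := slp x (fun j => g (x j)) i with hs
  have hsb : |s| * (x (i + 1) - x i) ≤ V (x (i + 1)) - V (x i) := by
    have h1 : ∫ t in x i..x (i + 1), g₁ t = g (x (i + 1)) - g (x i) :=
      intervalIntegral.integral_eq_sub_of_hasDerivAt (fun t _ => hg t) (hg1.intervalIntegrable _ _)
    have h2 : s * (x (i + 1) - x i) = g (x (i + 1)) - g (x i) := by
      rw [hs, slp, div_mul_cancel₀ _ hh.ne']
    have h3 : |s| * (x (i + 1) - x i) = |s * (x (i + 1) - x i)| := by rw [abs_mul, abs_of_pos hh]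
    rw [h3, h2, ← h1, ← hVi]
    exact intervalIntegral.norm_integral_le_of_norm_le (f := g₁) hlt.le
      (Filter.Eventually.of_forall fun t ht => hgV t (Ioc_subset_Icc_self ht))
      (hV'.intervalIntegrable _ _)
  have key : |∫ t in x i..x (i + 1), b t * (s - g₁ t) * ω t|
      ≤ ∫ t in x i..x (i + 1), (B * M * |s| + B * M * V' t) := by
    refine intervalIntegral.norm_integral_le_of_norm_le
      (f := fun t => b t * (s - g₁ t) * ω t) hlt.le
      (Filter.Eventually.of_forall fun t ht => ?_)
      ((continuous_const.add (hV'.const_mul _)).intervalIntegrable _ _)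
    have ht' := Ioc_subset_Icc_self ht
    rw [Real.norm_eq_abs, abs_mul, abs_mul]
    have h3 : |s - g₁ t| ≤ |s| + V' t := (abs_sub _ _).trans (by linarith [hgV t ht'])
    calc |b t| * |s - g₁ t| * |ω t| ≤ B * (|s| + V' t) * M :=
          mul_le_mul (mul_le_mul (hb t ht') h3 (abs_nonneg _) hB) (hω t ht') (abs_nonneg _)
            (mul_nonneg hB ((abs_nonneg _).trans h3))
      _ = _ := by ring
  rw [intervalIntegral.integral_add (continuous_const.intervalIntegrable _ _)
    ((hV'.const_mul _).intervalIntegrable _ _), intervalIntegral.integral_const,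
    intervalIntegral.integral_const_mul (B * M) V', hVi, smul_eq_mul] at key
  have hBM : 0 ≤ B * M := mul_nonneg hB hM
  have := mul_le_mul_of_nonneg_left hsb hBM
  linarith

/-- The boundary terms vanish because the interpolation error is zero at the nodes. -/
theorem conv_eq_by_parts (hlt : x i < x (i + 1)) (hg : ∀ t, HasDerivAt g (g₁ t) t)
    (hg1 : Continuous g₁) (hb : ContDiff ℝ 1 b) :
    ∫ t in x i..x (i + 1), b t * (slp x (fun j => g (x j)) i - g₁ t) * aff x z i t
      = -(∫ t in x i..x (i + 1), deriv b t * (aff x (fun j => g (x j)) i t - g t) * aff x z i t)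
        - slp x z i * ∫ t in x i..x (i + 1), b t * (aff x (fun j => g (x j)) i t - g t) := by
  have hgc : Continuous g := continuous_iff_continuousAt.mpr fun t => (hg t).continuousAt
  have hbd : Continuous (deriv b) := hb.continuous_deriv le_rfl
  have cb := hb.continuous
  have ca : Continuous (aff x (fun j => g (x j)) i) := continuous_aff
  have cω : Continuous (aff x z i) := continuous_aff
  have hd1 : ∀ t ∈ uIcc (x i) (x (i + 1)), HasDerivAt (fun t => b t * aff x z i t)
      (deriv b t * aff x z i t + b t * slp x z i) t := fun t _ =>
    (hb.differentiable one_ne_zero t).hasDerivAt.mul (hasDerivAt_aff t)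
  have hd2 : ∀ t ∈ uIcc (x i) (x (i + 1)),
      HasDerivAt (fun t => aff x (fun j => g (x j)) i t - g t)
        (slp x (fun j => g (x j)) i - g₁ t) t := fun t _ => (hasDerivAt_aff t).sub (hg t)
  have ibp := intervalIntegral.integral_mul_deriv_eq_deriv_mul hd1 hd2
    (((hbd.mul cω).add (cb.mul continuous_const)).intervalIntegrable _ _)
    ((continuous_const.sub hg1).intervalIntegrable _ _)
  simp only [aff_right hlt, aff_left, sub_self, mul_zero, zero_sub] at ibp
  have e1 : ∀ t, b t * (slp x (fun j => g (x j)) i - g₁ t) * aff x z i t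
      = b t * aff x z i t * (slp x (fun j => g (x j)) i - g₁ t) := fun t => by ring
  have e2 : ∀ t, (deriv b t * aff x z i t + b t * slp x z i)
        * (aff x (fun j => g (x j)) i t - g t)
      = deriv b t * (aff x (fun j => g (x j)) i t - g t) * aff x z i t
        + slp x z i * (b t * (aff x (fun j => g (x j)) i t - g t)) := fun t => by ring
  simp only [e1, ibp, e2]
  have i1 : IntervalIntegrable (fun t => deriv b t * (aff x (fun j => g (x j)) i t - g t)
      * aff x z i t) volume (x i) (x (i + 1)) :=
    ((hbd.mul (ca.sub hgc)).mul cω).intervalIntegrable _ _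
  have i2 : IntervalIntegrable (fun t => slp x z i * (b t * (aff x (fun j => g (x j)) i t - g t)))
      volume (x i) (x (i + 1)) := ((cb.mul (ca.sub hgc)).const_mul _).intervalIntegrable _ _
  rw [intervalIntegral.integral_add i1 i2, intervalIntegral.integral_const_mul]
  ring

/-- To leading order the error is `g''(x_i) (t - x_i)(x_{i+1} - t)/2`, whose integral is `g''(x_i)
h³/12`. The explicit leading term is what allows neighbouring cells to be compared. -/
theorem abs_integral_interp_error_sub_le (hlt : x i < x (i + 1))
    (hg : ∀ t, HasDerivAt g (g₁ t) t) (hg1 : ∀ t, HasDerivAt g₁ (g₂ t) t)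
    (hg2 : ∀ t, HasDerivAt g₂ (g₃ t) t) (hb : ContDiff ℝ 1 b)
    (hbB : ∀ t ∈ Icc (x i) (x (i + 1)), |b t| ≤ B)
    (hbB1 : ∀ t ∈ Icc (x i) (x (i + 1)), |deriv b t| ≤ B₁)
    (hK2 : |g₂ (x i)| ≤ K₂) (hK3 : ∀ t ∈ Icc (x i) (x (i + 1)), |g₃ t| ≤ K₃) :
    |(∫ t in x i..x (i + 1), b t * (aff x (fun j => g (x j)) i t - g t))
        - b (x i) * g₂ (x i) * (x (i + 1) - x i) ^ 3 / 12|
      ≤ (B * K₃ + B₁ * K₂) * (x (i + 1) - x i) ^ 4 := by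
  have hl := left_mem_Icc.mpr hlt.le
  have hh := sub_pos.mpr hlt
  have hB : 0 ≤ B := (abs_nonneg _).trans (hbB _ hl)
  have hB1 : 0 ≤ B₁ := (abs_nonneg _).trans (hbB1 _ hl)
  have hk2 : 0 ≤ K₂ := (abs_nonneg _).trans hK2
  have hk3 : 0 ≤ K₃ := (abs_nonneg _).trans (hK3 _ hl)
  set h := x (i + 1) - x i with hdef
  set G := g₂ (x i) with hG
  have hgc : Continuous g := continuous_iff_continuousAt.mpr fun t => (hg t).continuousAt
  have cb := hb.continuous
  have ca : Continuous (aff x (fun j => g (x j)) i) := continuous_aff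
  have hquad : ∀ t ∈ Icc (x i) (x (i + 1)), |(aff x (fun j => g (x j)) i t - g t)
      - G * (1 / 2 * ((t - x i) * (x (i + 1) - t)))| ≤ K₃ * h * h ^ 2 := by
    intro t ht
    -- Apply the basic estimate to `g` minus its quadratic Taylor term at `x_i`: the remaining
    -- second derivative is at most `K₃ h`.
    have h1 := (abs_interp_error_le (g := fun t => g t - G * (1 / 2 * (t - x i) ^ 2))
      (g₁ := fun t => g₁ t - G * (t - x i)) (g₂ := fun t => g₂ t - G) (K := K₃ * h) hlt
      (fun t => ?_) (fun t => ?_) (fun t ht => ?_) t ht).1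
    · have e : aff x (fun j => g (x j) - G * (1 / 2 * (x j - x i) ^ 2)) i t
          = aff x (fun j => g (x j)) i t - G * (1 / 2 * (h * (t - x i))) := by
        simp only [aff, slp, ← hdef, sub_self]
        field_simp
        ring
      rw [e] at h1
      refine le_trans (le_of_eq ?_) h1
      congr 1
      rw [hdef]; ring
    · have := ((((hasDerivAt_id t).sub_const (x i)).pow 2).const_mul (1 / 2)).const_mul G
      refine ((hg t).sub this).congr_deriv ?_
      simp only [id]; push_cast; ring
    · have := ((hasDerivAt_id t).sub_const (x i)).const_mul G
      refine ((hg1 t).sub this).congr_deriv ?_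
      ring
    · have h1 := (convex_Icc (x i) (x (i + 1))).norm_image_sub_le_of_norm_hasDerivWithin_le
        (fun s _ => (hg2 s).hasDerivWithinAt) hK3 hl ht
      refine h1.trans (mul_le_mul_of_nonneg_left ?_ hk3)
      rw [Real.norm_eq_abs, abs_le]
      constructor <;> linarith [ht.1, ht.2]
  have hI : ∫ t in x i..x (i + 1), b (x i) * (G * (1 / 2 * ((t - x i) * (x (i + 1) - t))))
      = b (x i) * G * h ^ 3 / 12 := by
    have hd : ∀ t ∈ uIcc (x i) (x (i + 1)),
        HasDerivAt (fun t => b (x i) * G * (h * (t - x i) ^ 2 / 4 - (t - x i) ^ 3 / 6))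
        (b (x i) * (G * (1 / 2 * ((t - x i) * (x (i + 1) - t))))) t := by
      intro t _
      have h1 := (hasDerivAt_id t).sub_const (x i)
      have := (((((h1.pow 2).const_mul h).div_const 4).sub ((h1.pow 3).div_const 6))).const_mul
        (b (x i) * G)
      refine this.congr_deriv ?_
      simp only [id, hdef]; push_cast; ring
    rw [intervalIntegral.integral_eq_sub_of_hasDerivAt hd
      (Continuous.intervalIntegrable (by fun_prop) _ _), ← hdef]
    ring
  have i1 : IntervalIntegrable (fun t => b t * (aff x (fun j => g (x j)) i t - g t)) volume
      (x i) (x (i + 1)) := (cb.mul (ca.sub hgc)).intervalIntegrable _ _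
  have i2 : IntervalIntegrable (fun t => b (x i) * (G * (1 / 2 * ((t - x i) * (x (i + 1) - t)))))
      volume (x i) (x (i + 1)) := Continuous.intervalIntegrable (by fun_prop) _ _
  rw [← hI, ← intervalIntegral.integral_sub i1 i2]
  have hbl : ∀ t ∈ Icc (x i) (x (i + 1)), |b t - b (x i)| ≤ B₁ * h := by
    intro t ht
    have h1 := (convex_Icc (x i) (x (i + 1))).norm_image_sub_le_of_norm_hasDerivWithin_le
      (f := b) (fun s _ => (hb.differentiable one_ne_zero s).hasDerivAt.hasDerivWithinAt) hbB1 hl ht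
    refine h1.trans (mul_le_mul_of_nonneg_left ?_ hB1)
    rw [Real.norm_eq_abs, abs_le]
    constructor <;> linarith [ht.1, ht.2]
  have := intervalIntegral.norm_integral_le_of_norm_le_const (a := x i) (b := x (i + 1))
    (C := (B * K₃ + B₁ * K₂) * h ^ 3) (f := fun t => b t * (aff x (fun j => g (x j)) i t - g t)
      - b (x i) * (G * (1 / 2 * ((t - x i) * (x (i + 1) - t))))) fun t ht => ?_
  · rw [← hdef, abs_of_pos hh] at this
    refine this.trans (le_of_eq ?_)
    ring
  · rw [uIoc_of_le hlt.le] at ht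
    have ht' := Ioc_subset_Icc_self ht
    have e : b t * (aff x (fun j => g (x j)) i t - g t)
        - b (x i) * (G * (1 / 2 * ((t - x i) * (x (i + 1) - t))))
        = b t * ((aff x (fun j => g (x j)) i t - g t)
            - G * (1 / 2 * ((t - x i) * (x (i + 1) - t))))
          + (b t - b (x i)) * (G * (1 / 2 * ((t - x i) * (x (i + 1) - t)))) := by ring
    rw [Real.norm_eq_abs, e]
    have q1 : 0 ≤ t - x i := by linarith [ht'.1]
    have q2 : 0 ≤ x (i + 1) - t := by linarith [ht'.2]
    have q3 : |1 / 2 * ((t - x i) * (x (i + 1) - t))| ≤ h * h := by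
      rw [abs_of_nonneg (by positivity)]
      have : (t - x i) * (x (i + 1) - t) ≤ h * h := mul_le_mul (by linarith) (by linarith) q2 hh.le
      nlinarith [mul_nonneg q1 q2]
    refine (abs_add_le _ _).trans ?_
    rw [abs_mul, abs_mul (b t - b (x i)), abs_mul G]
    calc _ ≤ B * (K₃ * h * h ^ 2) + B₁ * h * (K₂ * (h * h)) := by
          refine add_le_add (mul_le_mul (hbB t ht') (hquad t ht') (abs_nonneg _) hB)
            (mul_le_mul (hbl t ht') (mul_le_mul hK2 q3 (abs_nonneg _) hk2) (by positivity)
              (by positivity))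
      _ = _ := by ring

end ElementError

/-! ### Weighted bounds for the nodal values of the test function. -/

/-- The data of the error analysis: the mesh, the coefficient `b` with `|b|, |b'| ≤ B`, and the
nodal values `z` of a discrete function of energy norm at most `X`. -/
structure ErrorSetting (B K L p e1 e2 m0 m1 X : ℝ) (m : ℕ) (x z : ℕ → ℝ) (b : ℝ → ℝ) : Prop where
  mesh : IsBakhvalovMesh L p m0 m1 m x
  four_le : 4 ≤ m
  n_le : ((4 * m : ℕ) : ℝ) ≤ m0
  m0_le : m0 ≤ m1
  p_lt : p < 1
  L_pos : 0 < L
  K_pos : 0 < K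
  e1_pos : 0 < e1
  e2_pos : 0 < e2
  e2_m0 : e2 * m0 ≤ K
  e2_m1 : e2 ≤ K * (e1 * m1)
  b_diff : ContDiff ℝ 1 b
  b_le : ∀ t ∈ Icc (0 : ℝ) 1, |b t| ≤ B
  b_deriv_le : ∀ t ∈ Icc (0 : ℝ) 1, |deriv b t| ≤ B
  X_nonneg : 0 ≤ X
  z_left : z 0 = 0
  z_right : z (4 * m) = 0
  sum_sq_le : ∑ i ∈ Finset.range (4 * m), (x (i + 1) - x i) * (z i ^ 2 + z (i + 1) ^ 2) / 6 ≤ X ^ 2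
  sum_slp_le : e1 * ∑ i ∈ Finset.range (4 * m), (x (i + 1) - x i) * slp x z i ^ 2 ≤ X ^ 2
  sum_abs_le : ∑ i ∈ Finset.range (4 * m), ∫ t in x i..x (i + 1), |aff x z i t| ≤ X

namespace ErrorSetting

variable {B K L p e1 e2 m0 m1 X : ℝ} {m : ℕ} {x z : ℕ → ℝ} {b : ℝ → ℝ}

theorem isMesh (h : ErrorSetting B K L p e1 e2 m0 m1 X m x z b) : IsMesh x (4 * m) := h.mesh.isMesh

theorem n_ge (h : ErrorSetting B K L p e1 e2 m0 m1 X m x z b) : 16 ≤ ((4 * m : ℕ) : ℝ) := by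
  have h1 := h.four_le
  have : 16 ≤ 4 * m := by omega
  exact_mod_cast this

theorem m0_ge (h : ErrorSetting B K L p e1 e2 m0 m1 X m x z b) : 16 ≤ m0 := h.n_ge.trans h.n_le

theorem B_nonneg (h : ErrorSetting B K L p e1 e2 m0 m1 X m x z b) : 0 ≤ B :=
  (abs_nonneg _).trans (h.b_le 0 (by simp))

theorem e2_n (h : ErrorSetting B K L p e1 e2 m0 m1 X m x z b) : e2 * ((4 * m : ℕ) : ℝ) ≤ K :=
  (mul_le_mul_of_nonneg_left h.n_le h.e2_pos.le).trans h.e2_m0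

theorem sq_nodal_le (h : ErrorSetting B K L p e1 e2 m0 m1 X m x z b) {i : ℕ} (hi : i < 4 * m) :
    (x (i + 1) - x i) * z i ^ 2 ≤ 6 * X ^ 2 ∧ (x (i + 1) - x i) * z (i + 1) ^ 2 ≤ 6 * X ^ 2 := by
  have hnn : ∀ j ∈ Finset.range (4 * m), 0 ≤ (x (j + 1) - x j) * (z j ^ 2 + z (j + 1) ^ 2) / 6 := by
    intro j hj
    have := sub_pos.mpr (h.isMesh.lt j (Finset.mem_range.mp hj))
    positivity
  have h1 := Finset.single_le_sum hnn (Finset.mem_range.mpr hi)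
  have h2 := h1.trans h.sum_sq_le
  have hh := (sub_pos.mpr (h.isMesh.lt i hi)).le
  have h3 := mul_nonneg hh (sq_nonneg (z i))
  have h4 := mul_nonneg hh (sq_nonneg (z (i + 1)))
  constructor <;> linarith

/-- An inverse estimate: `h z_i² ≤ 6 X²` and `h ≥ 1/((L+1) μ₀ n)` bound `z_i²` by a multiple of `μ₀
n X²`, and `ε₂² μ₀ n ≤ K²`. -/
theorem e2_abs_nodal_le (h : ErrorSetting B K L p e1 e2 m0 m1 X m x z b) {i : ℕ} (hi : i ≤ 3 * m) :
    e2 * |z i| ≤ (6 * (L + 1) + 1) * K * X := by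
  have key : ∃ j < 3 * m, (x (j + 1) - x j) * z i ^ 2 ≤ 6 * X ^ 2 := by
    rcases hi.lt_or_eq with h1 | h1
    · exact ⟨i, h1, (h.sq_nodal_le (by omega)).1⟩
    · have h4 := h.four_le
      -- The node `x_{3m}` is treated through the cell to its left, the last one with a lower step
      -- bound in terms of `μ₀`.
      refine ⟨3 * m - 1, by omega, ?_⟩
      have := (h.sq_nodal_le (i := 3 * m - 1) (by omega)).2
      rwa [show 3 * m - 1 + 1 = i by omega] at this ⊢
  obtain ⟨j, hj, h1⟩ := key
  have hm0 := h.m0_ge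
  have hn := h.n_ge
  have h2 := h.mesh.lower (by linarith) j hj
  have hL := h.L_pos
  have hX := h.X_nonneg
  have hK := h.K_pos
  have he := h.e2_pos
  set n : ℝ := ((4 * m : ℕ) : ℝ) with hndef
  have hz2 : z i ^ 2 ≤ (L + 1) * (m0 * n) * (6 * X ^ 2) := by
    calc z i ^ 2 = 1 * z i ^ 2 := (one_mul _).symm
      _ ≤ (L + 1) * (m0 * n * (x (j + 1) - x j)) * z i ^ 2 :=
          mul_le_mul_of_nonneg_right h2 (sq_nonneg _)
      _ = (L + 1) * (m0 * n) * ((x (j + 1) - x j) * z i ^ 2) := by ring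
      _ ≤ _ := mul_le_mul_of_nonneg_left h1 (by positivity)
  refine abs_le_of_sq_le_sq' ?_ (by positivity) |>.2
  calc (e2 * |z i|) ^ 2 = e2 ^ 2 * z i ^ 2 := by rw [mul_pow, sq_abs]
    _ ≤ e2 ^ 2 * ((L + 1) * (m0 * n) * (6 * X ^ 2)) := mul_le_mul_of_nonneg_left hz2 (sq_nonneg _)
    _ = 6 * (L + 1) * ((e2 * m0) * (e2 * n)) * X ^ 2 := by ring
    _ ≤ 6 * (L + 1) * (K * K) * X ^ 2 := by
        refine mul_le_mul_of_nonneg_right (mul_le_mul_of_nonneg_left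
          (mul_le_mul h.e2_m0 h.e2_n (by positivity) hK.le) (by positivity)) (sq_nonneg _)
    _ ≤ (6 * (L + 1) + 1) ^ 2 * (K * K) * X ^ 2 := by
        refine mul_le_mul_of_nonneg_right (mul_le_mul_of_nonneg_right ?_ (by positivity))
          (sq_nonneg _)
        nlinarith
    _ = _ := by ring

/-- The inverse estimate is not available here. Instead, since `z` vanishes at `1`, Cauchy-Schwarz
on `[x_{3m+1}, 1]`, an interval of length at most `L log n / μ₁`, together with `ε₂ ≤ K ε₁ μ₁`,
bounds `ε₂² z²` by `ε₂ K L log n X²`. The crude bound `log n ≤ n` suffices because `ε₂ n ≤ K`. -/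
theorem e2_abs_nodal_right_le (h : ErrorSetting B K L p e1 e2 m0 m1 X m x z b) :
    e2 * |z (3 * m + 1)| ≤ (L + 1) * K * X := by
  have h4 := h.four_le
  have hM := h.isMesh
  have hm0 := h.m0_ge
  have hn := h.n_ge
  have hL := h.L_pos
  have hX := h.X_nonneg
  have hK := h.K_pos
  have he := h.e2_pos
  have he1 := h.e1_pos
  set s := Finset.Ico (3 * m + 1) (4 * m) with hs
  have hpos : ∀ i ∈ s, 0 < x (i + 1) - x i := fun i hi =>
    sub_pos.mpr (hM.lt i (Finset.mem_Ico.mp hi).2)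
  have t1 : ∑ i ∈ s, (x (i + 1) - x i) * slp x z i = -z (3 * m + 1) := by
    have : ∀ i ∈ s, (x (i + 1) - x i) * slp x z i = z (i + 1) - z i := fun i hi => by
      rw [slp, mul_div_cancel₀ _ (hpos i hi).ne']
    rw [Finset.sum_congr rfl this, hs, Finset.sum_Ico_sub z (by omega), h.z_right, zero_sub]
  have t2 : ∑ i ∈ s, (x (i + 1) - x i) = 1 - x (3 * m + 1) := by
    rw [hs, Finset.sum_Ico_sub x (by omega), hM.one]
  have cs := Finset.sum_mul_sq_le_sq_mul_sq s (fun i => √(x (i + 1) - x i))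
    (fun i => √(x (i + 1) - x i) * slp x z i)
  have e1' : ∑ i ∈ s, √(x (i + 1) - x i) * (√(x (i + 1) - x i) * slp x z i)
      = ∑ i ∈ s, (x (i + 1) - x i) * slp x z i := Finset.sum_congr rfl fun i hi => by
    rw [← mul_assoc, Real.mul_self_sqrt (hpos i hi).le]
  have e2' : ∑ i ∈ s, √(x (i + 1) - x i) ^ 2 = ∑ i ∈ s, (x (i + 1) - x i) :=
    Finset.sum_congr rfl fun i hi => Real.sq_sqrt (hpos i hi).le
  have e3' : ∑ i ∈ s, (√(x (i + 1) - x i) * slp x z i) ^ 2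
      = ∑ i ∈ s, (x (i + 1) - x i) * slp x z i ^ 2 := Finset.sum_congr rfl fun i hi => by
    rw [mul_pow, Real.sq_sqrt (hpos i hi).le]
  rw [e1', e2', e3', t1, t2, neg_sq] at cs
  have t3 : ∑ i ∈ s, (x (i + 1) - x i) * slp x z i ^ 2
      ≤ ∑ i ∈ Finset.range (4 * m), (x (i + 1) - x i) * slp x z i ^ 2 := by
    refine Finset.sum_le_sum_of_subset_of_nonneg (fun i hi => ?_) fun i hi _ => ?_
    · exact Finset.mem_range.mpr (Finset.mem_Ico.mp hi).2
    · exact mul_nonneg (sub_pos.mpr (hM.lt i (Finset.mem_range.mp hi))).le (sq_nonneg _)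
  have hlog := h.mesh.right.log_le
  simp only [show 4 * m - (m - 1) = 3 * m + 1 by omega] at hlog
  have hy : 0 ≤ 1 - x (3 * m + 1) := sub_nonneg.mpr (hM.mem_Icc (by omega)).2
  set n : ℝ := ((4 * m : ℕ) : ℝ) with hndef
  have hlogn : Real.log n ≤ n := (Real.log_le_sub_one_of_pos (by linarith)).trans (by linarith)
  refine abs_le_of_sq_le_sq' ?_ (by positivity) |>.2
  calc (e2 * |z (3 * m + 1)|) ^ 2 = e2 * e2 * z (3 * m + 1) ^ 2 := by rw [mul_pow, sq_abs]; ring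
    _ ≤ e2 * e2 * ((1 - x (3 * m + 1)) * ∑ i ∈ Finset.range (4 * m), (x (i + 1) - x i) * slp x z i ^ 2) :=
        mul_le_mul_of_nonneg_left (cs.trans (mul_le_mul_of_nonneg_left t3 hy)) (by positivity)
    _ ≤ e2 * (K * (e1 * m1)) * ((1 - x (3 * m + 1))
          * ∑ i ∈ Finset.range (4 * m), (x (i + 1) - x i) * slp x z i ^ 2) := by
        refine mul_le_mul_of_nonneg_right (mul_le_mul_of_nonneg_left h.e2_m1 he.le) ?_
        exact mul_nonneg hy (Finset.sum_nonneg fun i hi =>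
          mul_nonneg (sub_pos.mpr (hM.lt i (Finset.mem_range.mp hi))).le (sq_nonneg _))
    _ = e2 * K * (m1 * (1 - x (3 * m + 1)))
          * (e1 * ∑ i ∈ Finset.range (4 * m), (x (i + 1) - x i) * slp x z i ^ 2) := by ring
    _ ≤ e2 * K * (L * n) * X ^ 2 := by
        refine mul_le_mul (mul_le_mul_of_nonneg_left (hlog.trans
          (mul_le_mul_of_nonneg_left hlogn hL.le)) (by positivity)) h.sum_slp_le ?_ (by positivity)
        exact mul_nonneg he1.le (Finset.sum_nonneg fun i hi =>
          mul_nonneg (sub_pos.mpr (hM.lt i (Finset.mem_range.mp hi))).le (sq_nonneg _))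
    _ = (e2 * n) * (K * L) * X ^ 2 := by ring
    _ ≤ K * (K * L) * X ^ 2 := by
        refine mul_le_mul_of_nonneg_right (mul_le_mul_of_nonneg_right h.e2_n (by positivity))
          (sq_nonneg _)
    _ ≤ ((L + 1) * K * X) ^ 2 := by
        have : L ≤ (L + 1) ^ 2 := by nlinarith
        calc K * (K * L) * X ^ 2 = L * (K ^ 2 * X ^ 2) := by ring
          _ ≤ (L + 1) ^ 2 * (K ^ 2 * X ^ 2) := mul_le_mul_of_nonneg_right this (by positivity)
          _ = _ := by ring

theorem sum_abs_le' (h : ErrorSetting B K L p e1 e2 m0 m1 X m x z b) {s : Finset ℕ}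
    (hs : s ⊆ Finset.range (4 * m)) :
    ∑ i ∈ s, ∫ t in x i..x (i + 1), |aff x z i t| ≤ X :=
  (Finset.sum_le_sum_of_subset_of_nonneg hs fun i hi _ =>
    intervalIntegral.integral_nonneg (h.isMesh.lt i (Finset.mem_range.mp hi)).le
      fun _ _ => abs_nonneg _).trans h.sum_abs_le

theorem abs_sum_le (h : ErrorSetting B K L p e1 e2 m0 m1 X m x z b) {c : ℝ → ℝ} {C D : ℝ}
    {s : Finset ℕ} (hs : s ⊆ Finset.range (4 * m)) (hD0 : 0 ≤ D)
    (hc : ∀ t ∈ Icc (0 : ℝ) 1, |c t| ≤ C) {e : ℕ → ℝ → ℝ}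
    (he : ∀ i ∈ s, ∀ t ∈ Icc (x i) (x (i + 1)), |e i t| ≤ D) :
    |∑ i ∈ s, ∫ t in x i..x (i + 1), c t * e i t * aff x z i t| ≤ C * D * X := by
  have hC : 0 ≤ C := (abs_nonneg _).trans (hc 0 (by simp))
  refine (Finset.abs_sum_le_sum_abs _ _).trans ?_
  calc _ ≤ ∑ i ∈ s, C * D * ∫ t in x i..x (i + 1), |aff x z i t| := by
        refine Finset.sum_le_sum fun i hi => ?_
        have hi' := Finset.mem_range.mp (hs hi)
        exact abs_integral_mul_mul_le (h.isMesh.lt i hi') continuous_aff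
          (fun t ht => hc t (h.isMesh.Icc_subset hi' ht)) (he i hi)
    _ = C * D * ∑ i ∈ s, ∫ t in x i..x (i + 1), |aff x z i t| := (Finset.mul_sum _ _ _).symm
    _ ≤ _ := mul_le_mul_of_nonneg_left (h.sum_abs_le' hs) (mul_nonneg hC hD0)

end ErrorSetting


/-! ### General tools for summing the consistency error. -/

theorem exp_neg_mul_le {p μ s t : ℝ} (hp1 : p < 1) (hμ : 0 ≤ μ) (hs : 0 ≤ s)
    (hst : s ≤ t) : Real.exp (-(μ * t)) ≤ Real.exp (-(p * μ * s)) := by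
  refine Real.exp_le_exp.mpr (neg_le_neg ?_)
  calc p * μ * s ≤ 1 * μ * s :=
        mul_le_mul_of_nonneg_right (mul_le_mul_of_nonneg_right hp1.le hμ) hs
    _ ≤ μ * t := by rw [one_mul]; exact mul_le_mul_of_nonneg_left hst hμ

/-- Either the step resolves the layer and the second derivative is used, or the layer function is
already below `D` and no smoothness is needed. -/
theorem abs_interp_error_le_of_layer {x : ℕ → ℝ} {i : ℕ} {g g₁ g₂ : ℝ → ℝ} {C μ W D : ℝ}
    (hlt : x i < x (i + 1)) (hg : ∀ t, HasDerivAt g (g₁ t) t)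
    (hg1 : ∀ t, HasDerivAt g₁ (g₂ t) t) (hC : 0 ≤ C) (hD : 0 ≤ D)
    (h0 : ∀ t ∈ Icc (x i) (x (i + 1)), |g t| ≤ C * W)
    (h2 : ∀ t ∈ Icc (x i) (x (i + 1)), |g₂ t| ≤ C * μ ^ 2 * W)
    (h : ((x (i + 1) - x i) * μ) ^ 2 * W ≤ D ∨ W ≤ D) :
    ∀ t ∈ Icc (x i) (x (i + 1)), |aff x (fun j => g (x j)) i t - g t| ≤ 2 * C * D := by
  intro t ht
  have hCD : 0 ≤ C * D := mul_nonneg hC hD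
  rcases h with h | h
  · have h3 := (abs_interp_error_le hlt hg hg1 h2 t ht).1
    have h4 := mul_le_mul_of_nonneg_left h hC
    linarith [show C * μ ^ 2 * W * (x (i + 1) - x i) ^ 2
      = C * (((x (i + 1) - x i) * μ) ^ 2 * W) by ring]
  · have h3 := abs_interp_error_le_two hlt h0 t ht
    have h4 := mul_le_mul_of_nonneg_left h hC
    linarith

/-- Abel summation; the boundary term at `0` drops out with `z 0`. -/
theorem sum_sub_mul_eq (z ψ : ℕ → ℝ) (h0 : z 0 = 0) (M : ℕ) :
    ∑ i ∈ Finset.range (M + 1), (z (i + 1) - z i) * ψ i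
      = z (M + 1) * ψ M - ∑ i ∈ Finset.range M, z (i + 1) * (ψ (i + 1) - ψ i) := by
  induction M with
  | zero => simp [h0]
  | succ k ih =>
    rw [Finset.sum_range_succ, ih, Finset.sum_range_succ _ k]
    ring

/-- The contribution of the element `i` to the convective part of the interpolation error. -/
def convTerm (b : ℝ → ℝ) (x z : ℕ → ℝ) (g g₁ : ℝ → ℝ) (i : ℕ) : ℝ :=
  ∫ t in x i..x (i + 1), b t * (slp x (fun j => g (x j)) i - g₁ t) * aff x z i t

/-- The contribution of the element `i` to the reactive part of the interpolation error. -/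
def reactTerm (c : ℝ → ℝ) (x z : ℕ → ℝ) (g : ℝ → ℝ) (i : ℕ) : ℝ :=
  ∫ t in x i..x (i + 1), c t * (aff x (fun j => g (x j)) i t - g t) * aff x z i t

namespace ErrorSetting

variable {B K L p e1 e2 m0 m1 X C : ℝ} {m : ℕ} {x z : ℕ → ℝ} {b g g₁ g₂ g₃ : ℝ → ℝ}

theorem m1_ge (h : ErrorSetting B K L p e1 e2 m0 m1 X m x z b) : 16 ≤ m1 := h.m0_ge.trans h.m0_le

theorem e2_le (h : ErrorSetting B K L p e1 e2 m0 m1 X m x z b) : e2 ≤ K := by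
  have h1 := h.e2_n
  have h2 := h.n_ge
  have h3 := h.e2_pos
  nlinarith

theorem div_le_div_sq (h : ErrorSetting B K L p e1 e2 m0 m1 X m x z b) :
    L / (((4 * m : ℕ) : ℝ) ^ 2 * √((4 * m : ℕ) : ℝ)) ≤ L / ((4 * m : ℕ) : ℝ) ^ 2 := by
  have hn := h.n_ge
  have h1 : 1 ≤ √((4 * m : ℕ) : ℝ) := Real.one_le_sqrt.mpr (by linarith)
  refine div_le_div_of_nonneg_left h.L_pos.le (by positivity) ?_
  exact le_mul_of_one_le_right (by positivity) h1

/-- The derivative of the interpolation error is only `O(1/n)`; the missing power comes from `ε₂ ≤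
K/n`. -/
theorem abs_sum_conv_smooth_le (h : ErrorSetting B K L p e1 e2 m0 m1 X m x z b) {s : Finset ℕ}
    (hs : s ⊆ Finset.range (4 * m)) (hg : ∀ t, HasDerivAt g (g₁ t) t)
    (hg1 : ∀ t, HasDerivAt g₁ (g₂ t) t) (hC : 0 ≤ C)
    (hg2 : ∀ i ∈ s, ∀ t ∈ Icc (x i) (x (i + 1)), |g₂ t| ≤ C) :
    e2 * |∑ i ∈ s, convTerm b x z g g₁ i| ≤ B * C * K * (L + 2) * (X / ((4 * m : ℕ) : ℝ) ^ 2) := by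
  have hn := h.n_ge
  set n : ℝ := ((4 * m : ℕ) : ℝ) with hndef
  have hn0 : 0 < n := by linarith
  have hL := h.L_pos
  have h1 := h.abs_sum_le hs (D := C * ((L + 2) / n)) (by positivity) h.b_le
    (e := fun i t => slp x (fun j => g (x j)) i - g₁ t) fun i hi t ht => by
      have hi' := Finset.mem_range.mp (hs hi)
      refine (abs_interp_error_le (h.isMesh.lt i hi') hg hg1 (hg2 i hi) t ht).2.trans ?_
      exact mul_le_mul_of_nonneg_left ((le_div_iff₀ hn0).mpr (h.mesh.upper i hi')) hC
  have he : e2 ≤ K / n := (le_div_iff₀ hn0).mpr h.e2_n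
  have hX := h.X_nonneg
  have hB := h.B_nonneg
  calc e2 * |∑ i ∈ s, convTerm b x z g g₁ i| ≤ K / n * (B * (C * ((L + 2) / n)) * X) :=
        mul_le_mul he h1 (abs_nonneg _) (h.e2_pos.le.trans he)
    _ = _ := by field_simp

theorem abs_sum_conv_antideriv_le (h : ErrorSetting B K L p e1 e2 m0 m1 X m x z b) {k l : ℕ}
    {V V' : ℝ → ℝ} {Q : ℝ} (hkl : k ≤ l) (hl : l ≤ 4 * m) (hg : ∀ t, HasDerivAt g (g₁ t) t)
    (hg1 : Continuous g₁) (hV : ∀ t, HasDerivAt V (V' t) t) (hV' : Continuous V')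
    (hgV : ∀ t ∈ Icc (0 : ℝ) 1, |g₁ t| ≤ V' t) (hz : ∀ i ∈ Finset.Icc k l, e2 * |z i| ≤ Q) :
    e2 * |∑ i ∈ Finset.Ico k l, convTerm b x z g g₁ i| ≤ 2 * B * Q * (V (x l) - V (x k)) := by
  have he := h.e2_pos
  have key : ∀ i ∈ Finset.Ico k l, e2 * |convTerm b x z g g₁ i|
      ≤ 2 * B * Q * (V (x (i + 1)) - V (x i)) := by
    intro i hi
    have hi' := Finset.mem_Ico.mp hi
    have hi4 : i < 4 * m := by omega
    have hlt := h.isMesh.lt i hi4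
    have z1 : |z i| ≤ Q / e2 := (le_div_iff₀' he).mpr (hz i (Finset.mem_Icc.mpr ⟨by omega, by omega⟩))
    have z2 : |z (i + 1)| ≤ Q / e2 :=
      (le_div_iff₀' he).mpr (hz _ (Finset.mem_Icc.mpr ⟨by omega, by omega⟩))
    have h1 := abs_conv_le_of_antideriv hlt hg hg1
      (fun t ht => h.b_le t (h.isMesh.Icc_subset hi4 ht)) (fun t ht => abs_aff_le hlt ht z1 z2)
      hV hV' (fun t ht => hgV t (h.isMesh.Icc_subset hi4 ht))
    calc e2 * |convTerm b x z g g₁ i|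
        ≤ e2 * (2 * B * (Q / e2) * (V (x (i + 1)) - V (x i))) :=
          mul_le_mul_of_nonneg_left h1 he.le
      _ = _ := by field_simp
  calc _ ≤ e2 * ∑ i ∈ Finset.Ico k l, |convTerm b x z g g₁ i| :=
        mul_le_mul_of_nonneg_left (Finset.abs_sum_le_sum_abs _ _) he.le
    _ ≤ ∑ i ∈ Finset.Ico k l, 2 * B * Q * (V (x (i + 1)) - V (x i)) := by
        rw [Finset.mul_sum]; exact Finset.sum_le_sum key
    _ = _ := by rw [← Finset.mul_sum, Finset.sum_Ico_sub (fun i => V (x i)) hkl]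

/-- After integration by parts the term with `b'` is as harmless as a reaction term, and only the
sum weighted by the slopes of the test function remains. -/
theorem abs_sum_conv_parts_le (h : ErrorSetting B K L p e1 e2 m0 m1 X m x z b) {s : Finset ℕ}
    {D : ℝ} (hs : s ⊆ Finset.range (4 * m)) (hg : ∀ t, HasDerivAt g (g₁ t) t)
    (hg1 : Continuous g₁) (hD : 0 ≤ D)
    (he : ∀ i ∈ s, ∀ t ∈ Icc (x i) (x (i + 1)), |aff x (fun j => g (x j)) i t - g t| ≤ D) :
    |∑ i ∈ s, convTerm b x z g g₁ i| ≤ B * D * X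
      + |∑ i ∈ s, slp x z i * ∫ t in x i..x (i + 1), b t * (aff x (fun j => g (x j)) i t - g t)| := by
  have h1 := h.abs_sum_le hs hD h.b_deriv_le
    (e := fun i t => aff x (fun j => g (x j)) i t - g t) he
  have h2 : ∑ i ∈ s, convTerm b x z g g₁ i
      = -(∑ i ∈ s, ∫ t in x i..x (i + 1),
          deriv b t * (aff x (fun j => g (x j)) i t - g t) * aff x z i t)
        - ∑ i ∈ s, slp x z i * ∫ t in x i..x (i + 1),
          b t * (aff x (fun j => g (x j)) i t - g t) := by
    rw [← Finset.sum_neg_distrib, ← Finset.sum_sub_distrib]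
    exact Finset.sum_congr rfl fun i hi =>
      conv_eq_by_parts (h.isMesh.lt i (Finset.mem_range.mp (hs hi))) hg hg1 h.b_diff
  rw [h2]
  refine (abs_sub _ _).trans ?_
  rw [abs_neg]
  linarith

theorem abs_integral_mul_le (h : ErrorSetting B K L p e1 e2 m0 m1 X m x z b) {e : ℝ → ℝ} {i : ℕ}
    {D : ℝ} (hi : i < 4 * m) (he : ∀ t ∈ Icc (x i) (x (i + 1)), |e t| ≤ D) :
    |∫ t in x i..x (i + 1), b t * e t| ≤ B * D * (x (i + 1) - x i) := by
  have hlt := h.isMesh.lt i hi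
  rw [← abs_of_pos (sub_pos.mpr hlt)]
  refine intervalIntegral.norm_integral_le_of_norm_le_const (f := fun t => b t * e t) fun t ht => ?_
  rw [uIoc_of_le hlt.le] at ht
  have ht' := Ioc_subset_Icc_self ht
  rw [Real.norm_eq_abs, abs_mul]
  exact mul_le_mul (h.b_le t (h.isMesh.Icc_subset hi ht')) (he t ht') (abs_nonneg _) h.B_nonneg

/-- Cauchy-Schwarz over at most `n` nodes, combined with the inverse estimate on every cell: summing
instead of taking the worst node costs `√n` and not `n`. -/
theorem e2_sum_abs_nodal_le (h : ErrorSetting B K L p e1 e2 m0 m1 X m x z b) {M : ℕ}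
    (hM : M ≤ m) : e2 * ∑ i ∈ Finset.range M, |z (i + 1)|
      ≤ (6 * (L + 1) + 1) * K * √((4 * m : ℕ) : ℝ) * X := by
  have hm0 := h.m0_ge
  have hn := h.n_ge
  have hL := h.L_pos
  have hX := h.X_nonneg
  have hK := h.K_pos
  have he := h.e2_pos
  have h4 := h.four_le
  have hMn : (M : ℝ) ≤ ((4 * m : ℕ) : ℝ) := by exact_mod_cast (by omega : M ≤ 4 * m)
  set n : ℝ := ((4 * m : ℕ) : ℝ) with hndef
  have hz2 : ∀ i ∈ Finset.range M, z (i + 1) ^ 2 ≤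
      (L + 1) * (m0 * n) * (6 * ((x (i + 1) - x i) * (z i ^ 2 + z (i + 1) ^ 2) / 6)) := by
    intro i hi
    have hi := Finset.mem_range.mp hi
    have h2 := h.mesh.lower (by linarith) i (by omega)
    have hh := sub_pos.mpr (h.isMesh.lt i (by omega))
    calc z (i + 1) ^ 2 = 1 * z (i + 1) ^ 2 := (one_mul _).symm
      _ ≤ (L + 1) * (m0 * n * (x (i + 1) - x i)) * z (i + 1) ^ 2 :=
          mul_le_mul_of_nonneg_right h2 (sq_nonneg _)
      _ = (L + 1) * (m0 * n) * ((x (i + 1) - x i) * z (i + 1) ^ 2) := by ring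
      _ ≤ _ := by
          refine mul_le_mul_of_nonneg_left ?_ (by positivity)
          have := mul_nonneg hh.le (sq_nonneg (z i))
          linarith
  have hsum : ∑ i ∈ Finset.range M, z (i + 1) ^ 2 ≤ (L + 1) * (m0 * n) * (6 * X ^ 2) := by
    refine (Finset.sum_le_sum hz2).trans ?_
    rw [← Finset.mul_sum, ← Finset.mul_sum]
    refine mul_le_mul_of_nonneg_left (mul_le_mul_of_nonneg_left
      (le_trans ?_ h.sum_sq_le) (by norm_num)) (by positivity)
    refine Finset.sum_le_sum_of_subset_of_nonneg (fun i hi => ?_) fun i hi _ => ?_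
    · have := Finset.mem_range.mp hi
      exact Finset.mem_range.mpr (by omega)
    · have := sub_pos.mpr (h.isMesh.lt i (Finset.mem_range.mp hi))
      positivity
  have cs : (∑ i ∈ Finset.range M, |z (i + 1)|) ^ 2 ≤ M * ∑ i ∈ Finset.range M, z (i + 1) ^ 2 := by
    have := sq_sum_le_card_mul_sum_sq (s := Finset.range M) (f := fun i => |z (i + 1)|)
    simpa only [Finset.card_range, sq_abs] using this
  refine abs_le_of_sq_le_sq' ?_ (by positivity) |>.2
  calc (e2 * ∑ i ∈ Finset.range M, |z (i + 1)|) ^ 2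
      = e2 ^ 2 * (∑ i ∈ Finset.range M, |z (i + 1)|) ^ 2 := mul_pow _ _ _
    _ ≤ e2 ^ 2 * (n * ((L + 1) * (m0 * n) * (6 * X ^ 2))) :=
        mul_le_mul_of_nonneg_left (cs.trans (mul_le_mul hMn hsum
          (Finset.sum_nonneg fun i _ => sq_nonneg _) (by linarith))) (sq_nonneg _)
    _ = 6 * (L + 1) * ((e2 * m0) * (e2 * n)) * n * X ^ 2 := by ring
    _ ≤ 6 * (L + 1) * (K * K) * n * X ^ 2 := by
        refine mul_le_mul_of_nonneg_right (mul_le_mul_of_nonneg_right (mul_le_mul_of_nonneg_left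
          (mul_le_mul h.e2_m0 h.e2_n (by positivity) hK.le) (by positivity)) (by linarith))
          (sq_nonneg _)
    _ ≤ (6 * (L + 1) + 1) ^ 2 * (K * K) * n * X ^ 2 := by
        refine mul_le_mul_of_nonneg_right (mul_le_mul_of_nonneg_right
          (mul_le_mul_of_nonneg_right ?_ (by positivity)) (by linarith)) (sq_nonneg _)
        nlinarith
    _ = ((6 * (L + 1) + 1) * K * √n * X) ^ 2 := by
        rw [mul_pow _ X, mul_pow _ √n, Real.sq_sqrt (by linarith)]; ring

end ErrorSetting


/-! ### The layer at `0`. -/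

namespace ErrorSetting

variable {B K L p e1 e2 m0 m1 X C : ℝ} {m : ℕ} {x z : ℕ → ℝ} {b g g₁ g₂ g₃ : ℝ → ℝ}

theorem left_weight_le (h : ErrorSetting B K L p e1 e2 m0 m1 X m x z b) {j : ℕ} (hj : j ≤ 4 * m)
    {t : ℝ} (ht : x j ≤ t) : Real.exp (-(m0 * t)) ≤ Real.exp (-(p * m0 * x j)) :=
  exp_neg_mul_le h.p_lt (by linarith [h.m0_ge]) (h.isMesh.mem_Icc hj).1 ht

theorem left_interp_error_le (h : ErrorSetting B K L p e1 e2 m0 m1 X m x z b) (hC : 0 < C)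
    (hd1 : ∀ t, HasDerivAt g (g₁ t) t) (hd2 : ∀ t, HasDerivAt g₁ (g₂ t) t)
    (h0 : ∀ x ∈ Icc (0 : ℝ) 1, |g x| ≤ C * Real.exp (-(m0 * x)))
    (h2 : ∀ x ∈ Icc (0 : ℝ) 1, |g₂ x| ≤ C * m0 ^ 2 * Real.exp (-(m0 * x))) :
    ∀ i < 4 * m, ∀ t ∈ Icc (x i) (x (i + 1)),
      |aff x (fun j => g (x j)) i t - g t| ≤ 2 * C * (L / ((4 * m : ℕ) : ℝ) ^ 2) := by
  intro i hi
  have hL := h.L_pos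
  have h4 := h.four_le
  have hm0 := h.m0_ge
  have hsub := h.isMesh.Icc_subset hi
  have hk : ∃ k ≤ i, ((x (i + 1) - x i) * m0) ^ 2 * Real.exp (-(p * m0 * x k))
      ≤ L / ((4 * m : ℕ) : ℝ) ^ 2 ∨ Real.exp (-(p * m0 * x k)) ≤ L / ((4 * m : ℕ) : ℝ) ^ 2 := by
    rcases lt_or_ge (i + 1) m with h5 | h5
    · exact ⟨i, le_rfl, Or.inl (h.mesh.left.sq_le i h5)⟩
    -- From the last graded cell onwards, the weight at its left node `x_{m-1}` is already small
    -- enough.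
    · exact ⟨m - 1, by omega, Or.inr (h.mesh.left.last_le.trans h.div_le_div_sq)⟩
  obtain ⟨k, hki, hk⟩ := hk
  have hxk := h.isMesh.le_of_le hki hi.le
  exact abs_interp_error_le_of_layer (h.isMesh.lt i hi) hd1 hd2 hC.le (by positivity)
    (fun t ht => (h0 t (hsub ht)).trans (mul_le_mul_of_nonneg_left
      (h.left_weight_le (by omega) (hxk.trans ht.1)) hC.le))
    (fun t ht => (h2 t (hsub ht)).trans (mul_le_mul_of_nonneg_left
      (h.left_weight_le (by omega) (hxk.trans ht.1)) (by positivity))) hk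

/-- The mean of `b (g^I - g)` over a cell is `b g'' h²/12` up to a term of third order in `μ₀ h`.
From one cell to the next `b`, `g''` and `h²` change, and each change is again of third order, the
last one thanks to the grading (`diff_le`). Third order against the layer weight means `n^(-5/2)`.
-/
theorem left_mean_diff_le (h : ErrorSetting B K L p e1 e2 m0 m1 X m x z b) (hC : 0 < C)
    (hE : HasDerivs3 g g₁ g₂ g₃)
    (h2 : ∀ x ∈ Icc (0 : ℝ) 1, |g₂ x| ≤ C * m0 ^ 2 * Real.exp (-(m0 * x)))
    (h3 : ∀ x ∈ Icc (0 : ℝ) 1, |g₃ x| ≤ C * m0 ^ 3 * Real.exp (-(m0 * x))) {i : ℕ}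
    (hi : i + 2 < m) :
    |(∫ t in x (i + 1)..x (i + 1 + 1), b t * (aff x (fun j => g (x j)) (i + 1) t - g t))
        / (x (i + 1 + 1) - x (i + 1))
      - (∫ t in x i..x (i + 1), b t * (aff x (fun j => g (x j)) i t - g t)) / (x (i + 1) - x i)|
      ≤ 5 * B * C * (L / (((4 * m : ℕ) : ℝ) ^ 2 * √((4 * m : ℕ) : ℝ))) := by
  set D := L / (((4 * m : ℕ) : ℝ) ^ 2 * √((4 * m : ℕ) : ℝ)) with hD
  have hB := h.B_nonneg
  have hm0 := h.m0_ge
  have hm0p : 0 < m0 := by linarith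
  have i1 : i < 4 * m := by omega
  have i2 : i + 1 < 4 * m := by omega
  have lt1 := h.isMesh.lt i i1
  have lt2 := h.isMesh.lt (i + 1) i2
  have sub1 := h.isMesh.Icc_subset i1
  have sub2 := h.isMesh.Icc_subset i2
  have p1 := sub_pos.mpr lt1
  have p2 := sub_pos.mpr lt2
  have c1 := h.mesh.left.cube_le i (by omega)
  have c2 := h.mesh.left.cube_le' i hi
  have c3 := h.mesh.left.diff_le i hi
  simp only [show i + 2 = i + 1 + 1 from rfl, ← hD] at c1 c2 c3
  set W := Real.exp (-(p * m0 * x i)) with hW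
  have hWp : 0 < W := Real.exp_pos _
  have hm23 : m0 ^ 2 ≤ m0 ^ 3 := pow_le_pow_right₀ (by linarith) (by norm_num)
  have w2 : ∀ t ∈ Icc (0 : ℝ) 1, x i ≤ t → |g₂ t| ≤ C * m0 ^ 2 * W := fun t ht hit =>
    (h2 t ht).trans (mul_le_mul_of_nonneg_left (h.left_weight_le i1.le hit) (by positivity))
  have w3 : ∀ t ∈ Icc (0 : ℝ) 1, x i ≤ t → |g₃ t| ≤ C * m0 ^ 3 * W := fun t ht hit =>
    (h3 t ht).trans (mul_le_mul_of_nonneg_left (h.left_weight_le i1.le hit) (by positivity))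
  -- The weight stays frozen at `x_i` for both cells, which is why `cube_le'` is needed beside
  -- `cube_le`.
  have el : ∀ k, x i ≤ x k → k < 4 * m →
      |(∫ t in x k..x (k + 1), b t * (aff x (fun j => g (x j)) k t - g t)) / (x (k + 1) - x k)
        - b (x k) * g₂ (x k) * (x (k + 1) - x k) ^ 2 / 12|
      ≤ 2 * B * C * (((x (k + 1) - x k) * m0) ^ 3 * W) := by
    intro k hk hk4
    have ltk := h.isMesh.lt k hk4
    have subk := h.isMesh.Icc_subset hk4
    have pk := sub_pos.mpr ltk
    have := abs_integral_interp_error_sub_le ltk hE.d1 hE.d2 hE.d3 h.b_diff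
      (fun t ht => h.b_le t (subk ht)) (fun t ht => h.b_deriv_le t (subk ht))
      (w2 _ (subk (left_mem_Icc.mpr ltk.le)) hk) (fun t ht => w3 t (subk ht) (hk.trans ht.1))
    set I := ∫ t in x k..x (k + 1), b t * (aff x (fun j => g (x j)) k t - g t)
    have e : I / (x (k + 1) - x k) - b (x k) * g₂ (x k) * (x (k + 1) - x k) ^ 2 / 12
        = (I - b (x k) * g₂ (x k) * (x (k + 1) - x k) ^ 3 / 12) / (x (k + 1) - x k) := by
      field_simp
    rw [e, abs_div, abs_of_pos pk, div_le_iff₀ pk]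
    refine this.trans ?_
    have q : B * (C * m0 ^ 2 * W) ≤ B * (C * m0 ^ 3 * W) :=
      mul_le_mul_of_nonneg_left (mul_le_mul_of_nonneg_right
        (mul_le_mul_of_nonneg_left hm23 hC.le) hWp.le) hB
    calc _ ≤ (B * (C * m0 ^ 3 * W) + B * (C * m0 ^ 3 * W)) * (x (k + 1) - x k) ^ 4 :=
          mul_le_mul_of_nonneg_right (by linarith) (by positivity)
      _ = _ := by ring
  have el1 := el i le_rfl i1
  have el2 := el (i + 1) lt1.le i2
  set ψ := (∫ t in x i..x (i + 1), b t * (aff x (fun j => g (x j)) i t - g t)) / (x (i + 1) - x i)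
  set ψ' := (∫ t in x (i + 1)..x (i + 1 + 1), b t * (aff x (fun j => g (x j)) (i + 1) t - g t))
        / (x (i + 1 + 1) - x (i + 1))
  set s := x (i + 1) - x i with hs
  set s' := x (i + 1 + 1) - x (i + 1) with hs'
  have hx1 := sub1 (left_mem_Icc.mpr lt1.le)
  have hx2 := sub1 (right_mem_Icc.mpr lt1.le)
  have db : |b (x (i + 1)) - b (x i)| ≤ B * s := by
    have := (convex_Icc (x i) (x (i + 1))).norm_image_sub_le_of_norm_hasDerivWithin_le
      (f := b) (fun t _ => (h.b_diff.differentiable one_ne_zero t).hasDerivAt.hasDerivWithinAt)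
      (fun t ht => h.b_deriv_le t (sub1 ht)) (left_mem_Icc.mpr lt1.le) (right_mem_Icc.mpr lt1.le)
    rwa [Real.norm_eq_abs, Real.norm_eq_abs, abs_of_pos p1] at this
  have dg : |g₂ (x (i + 1)) - g₂ (x i)| ≤ C * m0 ^ 3 * W * s := by
    have := (convex_Icc (x i) (x (i + 1))).norm_image_sub_le_of_norm_hasDerivWithin_le
      (f := g₂) (fun t _ => (hE.d3 t).hasDerivWithinAt)
      (fun t ht => w3 t (sub1 ht) ht.1) (left_mem_Icc.mpr lt1.le) (right_mem_Icc.mpr lt1.le)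
    rwa [Real.norm_eq_abs, Real.norm_eq_abs, abs_of_pos p1] at this
  have t1 : |(b (x (i + 1)) - b (x i)) * g₂ (x (i + 1)) * s' ^ 2|
      ≤ B * s * (C * m0 ^ 3 * W) * s' ^ 2 := by
    rw [abs_mul, abs_mul, abs_of_nonneg (sq_nonneg s')]
    refine mul_le_mul_of_nonneg_right (mul_le_mul db ((w2 _ hx2 lt1.le).trans ?_) (abs_nonneg _)
      (by positivity)) (sq_nonneg _)
    exact mul_le_mul_of_nonneg_right (mul_le_mul_of_nonneg_left hm23 hC.le) hWp.le
  have t2 : |b (x i) * (g₂ (x (i + 1)) - g₂ (x i)) * s' ^ 2|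
      ≤ B * (C * m0 ^ 3 * W * s) * s' ^ 2 := by
    rw [abs_mul, abs_mul, abs_of_nonneg (sq_nonneg s')]
    exact mul_le_mul_of_nonneg_right (mul_le_mul (h.b_le _ hx1) dg (abs_nonneg _) hB) (sq_nonneg _)
  have t3 : |b (x i) * g₂ (x i) * (s' ^ 2 - s ^ 2)| ≤ B * C * D := by
    rw [abs_mul, abs_mul]
    have e : |(s' * m0) ^ 2 - (s * m0) ^ 2| = m0 ^ 2 * |s' ^ 2 - s ^ 2| := by
      rw [show (s' * m0) ^ 2 - (s * m0) ^ 2 = m0 ^ 2 * (s' ^ 2 - s ^ 2) by ring, abs_mul,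
        abs_of_pos (pow_pos hm0p 2)]
    rw [e] at c3
    calc _ ≤ B * (C * m0 ^ 2 * W) * |s' ^ 2 - s ^ 2| :=
          mul_le_mul_of_nonneg_right (mul_le_mul (h.b_le _ hx1) (w2 _ hx1 le_rfl) (abs_nonneg _) hB)
            (abs_nonneg _)
      _ = B * C * (m0 ^ 2 * |s' ^ 2 - s ^ 2| * W) := by ring
      _ ≤ _ := mul_le_mul_of_nonneg_left c3 (by positivity)
  -- Reduces the mixed product to the pure cubes for which mesh bounds exist.
  have mix : s * s' ^ 2 ≤ s ^ 3 + s' ^ 3 := by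
    rcases le_total s s' with q | q
    · have := mul_le_mul_of_nonneg_right q (sq_nonneg s')
      linarith [pow_pos p1 3, show s' * s' ^ 2 = s' ^ 3 by ring]
    · have := mul_le_mul_of_nonneg_left (pow_le_pow_left₀ p2.le q 2) p1.le
      linarith [pow_pos p2 3, show s * s ^ 2 = s ^ 3 by ring]
  have t12 : B * s * (C * m0 ^ 3 * W) * s' ^ 2 ≤ 2 * B * C * D := by
    calc B * s * (C * m0 ^ 3 * W) * s' ^ 2 = B * C * m0 ^ 3 * W * (s * s' ^ 2) := by ring
      _ ≤ B * C * m0 ^ 3 * W * (s ^ 3 + s' ^ 3) := mul_le_mul_of_nonneg_left mix (by positivity)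
      _ = B * C * ((s * m0) ^ 3 * W + (s' * m0) ^ 3 * W) := by ring
      _ ≤ B * C * (D + D) := mul_le_mul_of_nonneg_left (add_le_add c1 c2) (by positivity)
      _ = _ := by ring
  have u1 : 2 * B * C * ((s * m0) ^ 3 * W) ≤ 2 * B * C * D :=
    mul_le_mul_of_nonneg_left c1 (by positivity)
  have u2 : 2 * B * C * ((s' * m0) ^ 3 * W) ≤ 2 * B * C * D :=
    mul_le_mul_of_nonneg_left c2 (by positivity)
  have e : ψ' - ψ = (ψ' - b (x (i + 1)) * g₂ (x (i + 1)) * s' ^ 2 / 12)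
      - (ψ - b (x i) * g₂ (x i) * s ^ 2 / 12)
      + ((b (x (i + 1)) - b (x i)) * g₂ (x (i + 1)) * s' ^ 2
        + b (x i) * (g₂ (x (i + 1)) - g₂ (x i)) * s' ^ 2
        + b (x i) * g₂ (x i) * (s' ^ 2 - s ^ 2)) / 12 := by ring
  have t12' : B * (C * m0 ^ 3 * W * s) * s' ^ 2 ≤ 2 * B * C * D := by
    refine le_trans (le_of_eq ?_) t12; ring
  rw [abs_le] at t1 t2 t3 el1 el2 ⊢
  rw [e]
  constructor <;> linarith [t1.1, t1.2, t2.1, t2.2, t3.1, t3.2, el1.1, el1.2, el2.1, el2.2]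

end ErrorSetting


namespace ErrorSetting

variable {B K L p e1 e2 m0 m1 X C : ℝ} {m : ℕ} {x z : ℕ → ℝ} {b c g g₁ g₂ g₃ : ℝ → ℝ}

/-- Integration by parts followed by Abel summation: slope times cell integral is `(z_{i+1} - z_i)
ψ_i` with `ψ_i` the cell mean. The boundary term uses `ψ_M = O(n⁻²)` and one nodal bound; the
differences use `n^(-5/2)` against `ε₂ ∑ |z_i| = O(√n X)`. -/
theorem left_conv_inner_le (h : ErrorSetting B K L p e1 e2 m0 m1 X m x z b) (hC : 0 < C)
    (hE : HasDerivs3 g g₁ g₂ g₃)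
    (h0 : ∀ x ∈ Icc (0 : ℝ) 1, |g x| ≤ C * Real.exp (-(m0 * x)))
    (h2 : ∀ x ∈ Icc (0 : ℝ) 1, |g₂ x| ≤ C * m0 ^ 2 * Real.exp (-(m0 * x)))
    (h3 : ∀ x ∈ Icc (0 : ℝ) 1, |g₃ x| ≤ C * m0 ^ 3 * Real.exp (-(m0 * x))) :
    e2 * |∑ i ∈ Finset.range (m - 1), convTerm b x z g g₁ i|
      ≤ (2 * B * C * L * K + 7 * B * C * L * ((6 * (L + 1) + 1) * K))
        * (X / ((4 * m : ℕ) : ℝ) ^ 2) := by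
  have h4 := h.four_le
  have hL := h.L_pos
  have hK := h.K_pos
  have hB := h.B_nonneg
  have hX := h.X_nonneg
  have hn := h.n_ge
  have he := h.e2_pos
  -- The sum runs over the cells `0, …, M`, all graded cells but the last, so Abel summation ends at
  -- the node `M + 1 = m - 1`.
  obtain ⟨M, rfl⟩ : ∃ M, m = M + 2 := ⟨m - 2, by omega⟩
  have herr := h.left_interp_error_le hC hE.d1 hE.d2 h0 h2
  set n : ℝ := ((4 * (M + 2) : ℕ) : ℝ) with hndef
  have hn0 : 0 < n := by linarith
  have hgc : Continuous g₁ := continuous_iff_continuousAt.mpr fun t => (hE.d2 t).continuousAt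
  have hs : Finset.range (M + 2 - 1) ⊆ Finset.range (4 * (M + 2)) := fun i hi => by
    have := Finset.mem_range.mp hi
    exact Finset.mem_range.mpr (by omega)
  have hA := h.abs_sum_conv_parts_le hs hE.d1 hgc (by positivity) fun i hi =>
    herr i (Finset.mem_range.mp (hs hi))
  set ψ : ℕ → ℝ := fun i => (∫ t in x i..x (i + 1), b t * (aff x (fun j => g (x j)) i t - g t))
    / (x (i + 1) - x i) with hψ
  have hsum : ∑ i ∈ Finset.range (M + 2 - 1), slp x z i * ∫ t in x i..x (i + 1),
      b t * (aff x (fun j => g (x j)) i t - g t)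
      = z (M + 1) * ψ M - ∑ i ∈ Finset.range M, z (i + 1) * (ψ (i + 1) - ψ i) := by
    rw [← sum_sub_mul_eq z ψ h.z_left M]
    refine Finset.sum_congr rfl fun i _ => ?_
    simp only [hψ, slp]
    ring
  rw [hsum] at hA
  have hψM : |ψ M| ≤ B * (2 * C * (L / n ^ 2)) := by
    have hlt := h.isMesh.lt M (by omega)
    rw [hψ, abs_div, abs_of_pos (sub_pos.mpr hlt), div_le_iff₀ (sub_pos.mpr hlt)]
    exact h.abs_integral_mul_le (by omega) (herr M (by omega))
  set Q := (6 * (L + 1) + 1) * K with hQ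
  have b1 : e2 * |z (M + 1) * ψ M| ≤ Q * X * (B * (2 * C * (L / n ^ 2))) := by
    rw [abs_mul, ← mul_assoc]
    exact mul_le_mul (h.e2_abs_nodal_le (by omega)) hψM (abs_nonneg _) (by positivity)
  have b2 : e2 * |∑ i ∈ Finset.range M, z (i + 1) * (ψ (i + 1) - ψ i)|
      ≤ Q * √n * X * (5 * B * C * (L / (n ^ 2 * √n))) := by
    calc _ ≤ e2 * ∑ i ∈ Finset.range M, |z (i + 1)| * (5 * B * C * (L / (n ^ 2 * √n))) := by
          refine mul_le_mul_of_nonneg_left ((Finset.abs_sum_le_sum_abs _ _).trans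
            (Finset.sum_le_sum fun i hi => ?_)) he.le
          rw [abs_mul]
          have := Finset.mem_range.mp hi
          exact mul_le_mul_of_nonneg_left (h.left_mean_diff_le hC hE h2 h3 (by omega))
            (abs_nonneg _)
      _ = e2 * (∑ i ∈ Finset.range M, |z (i + 1)|) * (5 * B * C * (L / (n ^ 2 * √n))) := by
          rw [← Finset.sum_mul]; ring
      _ ≤ _ := mul_le_mul_of_nonneg_right (h.e2_sum_abs_nodal_le (by omega)) (by positivity)
  have hsq : 0 < √n := Real.sqrt_pos.mpr hn0
  calc e2 * |∑ i ∈ Finset.range (M + 2 - 1), convTerm b x z g g₁ i|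
      ≤ e2 * (B * (2 * C * (L / n ^ 2)) * X
        + |z (M + 1) * ψ M - ∑ i ∈ Finset.range M, z (i + 1) * (ψ (i + 1) - ψ i)|) :=
        mul_le_mul_of_nonneg_left hA he.le
    _ ≤ e2 * (B * (2 * C * (L / n ^ 2)) * X) + (e2 * |z (M + 1) * ψ M|
        + e2 * |∑ i ∈ Finset.range M, z (i + 1) * (ψ (i + 1) - ψ i)|) := by
        rw [mul_add, ← mul_add e2 |_|]
        exact add_le_add le_rfl (mul_le_mul_of_nonneg_left (abs_sub _ _) he.le)
    _ ≤ K * (B * (2 * C * (L / n ^ 2)) * X) + (Q * X * (B * (2 * C * (L / n ^ 2)))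
        + Q * √n * X * (5 * B * C * (L / (n ^ 2 * √n)))) :=
        add_le_add (mul_le_mul_of_nonneg_right h.e2_le (by positivity)) (add_le_add b1 b2)
    _ = _ := by field_simp; ring

/-- Three regimes: the resolved layer; the cells from `m - 1` to `3 m - 1`, where the layer is
`O(n⁻²)` and nodal values are controlled by the inverse estimate; and the cells beyond `3 m`, where
that control is missing but `g''` is bounded. -/
theorem left_conv_le (h : ErrorSetting B K L p e1 e2 m0 m1 X m x z b) (hC : 0 < C)
    (hE : HasDerivs3 g g₁ g₂ g₃)
    (h0 : ∀ x ∈ Icc (0 : ℝ) 1, |g x| ≤ C * Real.exp (-(m0 * x)))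
    (h1 : ∀ x ∈ Icc (0 : ℝ) 1, |g₁ x| ≤ C * m0 * Real.exp (-(m0 * x)))
    (h2 : ∀ x ∈ Icc (0 : ℝ) 1, |g₂ x| ≤ C * m0 ^ 2 * Real.exp (-(m0 * x)))
    (h3 : ∀ x ∈ Icc (0 : ℝ) 1, |g₃ x| ≤ C * m0 ^ 3 * Real.exp (-(m0 * x))) :
    e2 * |∑ i ∈ Finset.range (4 * m), convTerm b x z g g₁ i|
      ≤ ((2 * B * C * L * K + 7 * B * C * L * ((6 * (L + 1) + 1) * K))
          + 2 * B * C * L * ((6 * (L + 1) + 1) * K) + B * (4 * C) * K * (L + 2))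
        * (X / ((4 * m : ℕ) : ℝ) ^ 2) := by
  have h4 := h.four_le
  have hL := h.L_pos
  have hK := h.K_pos
  have hB := h.B_nonneg
  have hX := h.X_nonneg
  have hm0 := h.m0_ge
  have he := h.e2_pos
  have hn := h.n_ge
  have hA := h.left_conv_inner_le hC hE h0 h2 h3
  have hgc : Continuous g₁ := continuous_iff_continuousAt.mpr fun t => (hE.d2 t).continuousAt
  have hV : ∀ t, HasDerivAt (fun t => -(C * Real.exp (-(m0 * t))))
      (C * m0 * Real.exp (-(m0 * t))) t := fun t => by
    have := ((((hasDerivAt_id t).const_mul m0).neg.exp).const_mul C).neg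
    refine this.congr_deriv ?_
    simp only [id, Pi.neg_apply]; ring
  have hM := h.abs_sum_conv_antideriv_le (k := m - 1) (l := 3 * m) (by omega) (by omega) hE.d1 hgc
    hV (by fun_prop) h1 (fun i hi => h.e2_abs_nodal_le (Finset.mem_Icc.mp hi).2)
  have hR := h.abs_sum_conv_smooth_le (s := Finset.Ico (3 * m) (4 * m)) (C := 4 * C)
    (fun i hi => Finset.mem_range.mpr (Finset.mem_Ico.mp hi).2) hE.d1 hE.d2 (by positivity)
    fun i hi t ht => by
      have hi' := Finset.mem_Ico.mp hi
      refine (h2 t (h.isMesh.Icc_subset hi'.2 ht)).trans ?_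
      have ht34 : 3 / 4 ≤ t :=
        h.mesh.three_quarters.trans ((h.isMesh.le_of_le hi'.1 hi'.2.le).trans ht.1)
      have hmt : 0 < m0 * t := by positivity
      have := exp_neg_le_two_div_sq hmt
      -- For `t ≥ 3/4` one has `2 / t² ≤ 32/9`, so the layer counts as a smooth function here.
      have q : m0 ^ 2 * Real.exp (-(m0 * t)) ≤ 4 := by
        calc _ ≤ m0 ^ 2 * (2 / (m0 * t) ^ 2) := mul_le_mul_of_nonneg_left this (sq_nonneg _)
          _ = 2 / t ^ 2 := by field_simp
          _ ≤ 4 := by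
            rw [div_le_iff₀ (by positivity)]
            nlinarith
      nlinarith
  have hlast : -(C * Real.exp (-(m0 * x (3 * m)))) - -(C * Real.exp (-(m0 * x (m - 1))))
      ≤ C * (L / ((4 * m : ℕ) : ℝ) ^ 2) := by
    have q1 := Real.exp_pos (-(m0 * x (3 * m)))
    have q2 := (h.left_weight_le (j := m - 1) (by omega) le_rfl).trans
      (h.mesh.left.last_le.trans h.div_le_div_sq)
    nlinarith
  set n : ℝ := ((4 * m : ℕ) : ℝ) with hndef
  set Q := (6 * (L + 1) + 1) * K with hQ
  have hM' := hM.trans (mul_le_mul_of_nonneg_left hlast (by positivity))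
  have hsplit : ∑ i ∈ Finset.range (4 * m), convTerm b x z g g₁ i
      = ∑ i ∈ Finset.range (m - 1), convTerm b x z g g₁ i
        + ∑ i ∈ Finset.Ico (m - 1) (3 * m), convTerm b x z g g₁ i
        + ∑ i ∈ Finset.Ico (3 * m) (4 * m), convTerm b x z g g₁ i := by
    rw [Finset.range_eq_Ico, Finset.range_eq_Ico, Finset.sum_Ico_consecutive _ (by omega) (by omega),
      Finset.sum_Ico_consecutive _ (by omega) (by omega)]
  rw [hsplit]
  have t := abs_add_three (∑ i ∈ Finset.range (m - 1), convTerm b x z g g₁ i)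
    (∑ i ∈ Finset.Ico (m - 1) (3 * m), convTerm b x z g g₁ i)
    (∑ i ∈ Finset.Ico (3 * m) (4 * m), convTerm b x z g g₁ i)
  refine (mul_le_mul_of_nonneg_left t he.le).trans ?_
  rw [mul_add, mul_add, add_mul, add_mul]
  refine add_le_add (add_le_add hA (hM'.trans (le_of_eq ?_))) hR
  ring

/-! ### The layer at `1`. -/

theorem right_weight_le (h : ErrorSetting B K L p e1 e2 m0 m1 X m x z b) {j : ℕ} (hj : j ≤ 4 * m)
    {t : ℝ} (ht : t ≤ x j) : Real.exp (-(m1 * (1 - t))) ≤ Real.exp (-(p * m1 * (1 - x j))) :=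
  exp_neg_mul_le h.p_lt (by linarith [h.m1_ge]) (sub_nonneg.mpr (h.isMesh.mem_Icc hj).2)
    (by linarith)

theorem right_last_le (h : ErrorSetting B K L p e1 e2 m0 m1 X m x z b) :
    Real.exp (-(p * m1 * (1 - x (3 * m + 1)))) ≤ L / ((4 * m : ℕ) : ℝ) ^ 2 := by
  have h4 := h.four_le
  have := h.mesh.right.last_le
  simp only [show 4 * m - (m - 1) = 3 * m + 1 by omega] at this
  exact this.trans h.div_le_div_sq

theorem right_interp_error_le (h : ErrorSetting B K L p e1 e2 m0 m1 X m x z b) (hC : 0 < C)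
    (hd1 : ∀ t, HasDerivAt g (g₁ t) t) (hd2 : ∀ t, HasDerivAt g₁ (g₂ t) t)
    (h0 : ∀ x ∈ Icc (0 : ℝ) 1, |g x| ≤ C * Real.exp (-(m1 * (1 - x))))
    (h2 : ∀ x ∈ Icc (0 : ℝ) 1, |g₂ x| ≤ C * m1 ^ 2 * Real.exp (-(m1 * (1 - x)))) :
    ∀ i < 4 * m, ∀ t ∈ Icc (x i) (x (i + 1)),
      |aff x (fun j => g (x j)) i t - g t| ≤ 2 * C * (L / ((4 * m : ℕ) : ℝ) ^ 2) := by
  intro i hi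
  have hL := h.L_pos
  have h4 := h.four_le
  have hm1 := h.m1_ge
  have hsub := h.isMesh.Icc_subset hi
  have hk : ∃ k ≤ 4 * m, i + 1 ≤ k ∧ (((x (i + 1) - x i) * m1) ^ 2 *
      Real.exp (-(p * m1 * (1 - x k))) ≤ L / ((4 * m : ℕ) : ℝ) ^ 2
      ∨ Real.exp (-(p * m1 * (1 - x k))) ≤ L / ((4 * m : ℕ) : ℝ) ^ 2) := by
    rcases le_or_gt i (3 * m) with h5 | h5
    -- Counted from the right, cell `3 m` is the last graded one. Its right node already carries a
    -- small weight.
    · exact ⟨3 * m + 1, by omega, by omega, Or.inr h.right_last_le⟩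
    · refine ⟨i + 1, by omega, le_rfl, Or.inl ?_⟩
      have := h.mesh.right.sq_le (4 * m - 1 - i) (by omega)
      simp only [show 4 * m - (4 * m - 1 - i) = i + 1 by omega,
        show 4 * m - (4 * m - 1 - i + 1) = i by omega] at this
      rwa [show 1 - x i - (1 - x (i + 1)) = x (i + 1) - x i by ring] at this
  obtain ⟨k, hk4, hik, hk⟩ := hk
  have hxk := h.isMesh.le_of_le hik hk4
  exact abs_interp_error_le_of_layer (h.isMesh.lt i hi) hd1 hd2 hC.le (by positivity)
    (fun t ht => (h0 t (hsub ht)).trans (mul_le_mul_of_nonneg_left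
      (h.right_weight_le hk4 (ht.2.trans hxk)) hC.le))
    (fun t ht => (h2 t (hsub ht)).trans (mul_le_mul_of_nonneg_left
      (h.right_weight_le hk4 (ht.2.trans hxk)) (by positivity))) hk

/-- After integration by parts, Cauchy-Schwarz pairs the slopes with `h⁵ μ₁⁴ W²`. Since `ε₂² ≤ ε₂ K
ε₁ μ₁`, the factor `ε₁` completes the energy of the test function and `μ₁` completes `(h μ₁)⁵ W²`.
No cancellation between cells is needed. -/
theorem right_conv_inner_le (h : ErrorSetting B K L p e1 e2 m0 m1 X m x z b) (hC : 0 < C)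
    (hd1 : ∀ t, HasDerivAt g (g₁ t) t) (hd2 : ∀ t, HasDerivAt g₁ (g₂ t) t)
    (h0 : ∀ x ∈ Icc (0 : ℝ) 1, |g x| ≤ C * Real.exp (-(m1 * (1 - x))))
    (h2 : ∀ x ∈ Icc (0 : ℝ) 1, |g₂ x| ≤ C * m1 ^ 2 * Real.exp (-(m1 * (1 - x)))) :
    e2 * |∑ i ∈ Finset.Ico (3 * m + 1) (4 * m), convTerm b x z g g₁ i|
      ≤ (2 * B * C * L * K + B * C * (K * (L + 1))) * (X / ((4 * m : ℕ) : ℝ) ^ 2) := by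
  have h4 := h.four_le
  have hL := h.L_pos
  have hK := h.K_pos
  have hB := h.B_nonneg
  have hX := h.X_nonneg
  have hn := h.n_ge
  have he := h.e2_pos
  have he1 := h.e1_pos
  have hm1 := h.m1_ge
  have hm1p : 0 < m1 := by linarith
  have herr := h.right_interp_error_le hC hd1 hd2 h0 h2
  have hgc : Continuous g₁ := continuous_iff_continuousAt.mpr fun t => (hd2 t).continuousAt
  set s := Finset.Ico (3 * m + 1) (4 * m) with hsdef
  have hs : s ⊆ Finset.range (4 * m) := fun i hi =>
    Finset.mem_range.mpr (Finset.mem_Ico.mp hi).2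
  have hA := h.abs_sum_conv_parts_le hs hd1 hgc (by positivity) fun i hi =>
    herr i (Finset.mem_range.mp (hs hi))
  set n : ℝ := ((4 * m : ℕ) : ℝ) with hndef
  have hn0 : 0 < n := by linarith
  set W : ℕ → ℝ := fun i => Real.exp (-(p * m1 * (1 - x (i + 1)))) with hW
  have hWp : ∀ i, 0 < W i := fun i => Real.exp_pos _
  have hpos : ∀ i ∈ s, 0 < x (i + 1) - x i := fun i hi =>
    sub_pos.mpr (h.isMesh.lt i (Finset.mem_range.mp (hs hi)))
  have t1 : ∀ i ∈ s, |slp x z i * ∫ t in x i..x (i + 1), b t * (aff x (fun j => g (x j)) i t - g t)|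
      ≤ B * C * (|slp x z i| * ((x (i + 1) - x i) ^ 3 * m1 ^ 2 * W i)) := by
    intro i hi
    have hi4 := Finset.mem_range.mp (hs hi)
    have hsub := h.isMesh.Icc_subset hi4
    have := h.abs_integral_mul_le hi4 fun t ht => (abs_interp_error_le (h.isMesh.lt i hi4) hd1 hd2
      (fun t ht => (h2 t (hsub ht)).trans (mul_le_mul_of_nonneg_left
      (h.right_weight_le (j := i + 1) hi4 ht.2) (by positivity))) t ht).1
    rw [abs_mul]
    calc _ ≤ |slp x z i| * (B * (C * m1 ^ 2 * W i * (x (i + 1) - x i) ^ 2) * (x (i + 1) - x i)) :=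
          mul_le_mul_of_nonneg_left this (abs_nonneg _)
      _ = _ := by ring
  set T := ∑ i ∈ s, |slp x z i| * ((x (i + 1) - x i) ^ 3 * m1 ^ 2 * W i) with hT
  have hTn : 0 ≤ T := Finset.sum_nonneg fun i hi => by
    have := hpos i hi; have := hWp i; positivity
  have t2 : |∑ i ∈ s, slp x z i * ∫ t in x i..x (i + 1),
      b t * (aff x (fun j => g (x j)) i t - g t)| ≤ B * C * T := by
    rw [hT, Finset.mul_sum]
    exact (Finset.abs_sum_le_sum_abs _ _).trans (Finset.sum_le_sum t1)
  have cs : T ^ 2 ≤ (∑ i ∈ s, (x (i + 1) - x i) * slp x z i ^ 2)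
      * ∑ i ∈ s, (x (i + 1) - x i) ^ 5 * m1 ^ 4 * W i ^ 2 := by
    have := Finset.sum_mul_sq_le_sq_mul_sq s (fun i => √(x (i + 1) - x i) * |slp x z i|)
      (fun i => √(x (i + 1) - x i) * ((x (i + 1) - x i) ^ 2 * m1 ^ 2 * W i))
    refine le_trans (le_of_eq ?_) (this.trans (le_of_eq ?_))
    · congr 1
      refine Finset.sum_congr rfl fun i hi => ?_
      have := Real.mul_self_sqrt (hpos i hi).le
      linear_combination (-|slp x z i| * ((x (i + 1) - x i) ^ 2 * m1 ^ 2 * W i)) * this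
    · congr 1 <;> refine Finset.sum_congr rfl fun i hi => ?_
      · rw [mul_pow, Real.sq_sqrt (hpos i hi).le, sq_abs]
      · rw [mul_pow, Real.sq_sqrt (hpos i hi).le]; ring
  have s1 : e1 * ∑ i ∈ s, (x (i + 1) - x i) * slp x z i ^ 2 ≤ X ^ 2 := by
    refine le_trans (mul_le_mul_of_nonneg_left ?_ he1.le) h.sum_slp_le
    refine Finset.sum_le_sum_of_subset_of_nonneg hs fun i hi _ => ?_
    exact mul_nonneg (sub_pos.mpr (h.isMesh.lt i (Finset.mem_range.mp hi))).le (sq_nonneg _)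
  -- Each of at most `n` cells contributes `L / n ^ 5`.
  have s2 : m1 * ∑ i ∈ s, (x (i + 1) - x i) ^ 5 * m1 ^ 4 * W i ^ 2 ≤ L / n ^ 4 := by
    rw [Finset.mul_sum]
    have : ∀ i ∈ s, m1 * ((x (i + 1) - x i) ^ 5 * m1 ^ 4 * W i ^ 2) ≤ L / n ^ 5 := by
      intro i hi
      have hi' := Finset.mem_Ico.mp hi
      have := h.mesh.right.fifth_le (4 * m - 1 - i) (by omega)
      simp only [show 4 * m - (4 * m - 1 - i) = i + 1 by omega,
        show 4 * m - (4 * m - 1 - i + 1) = i by omega] at this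
      rw [show 1 - x i - (1 - x (i + 1)) = x (i + 1) - x i by ring] at this
      refine le_trans (le_of_eq ?_) this
      simp only [hW]; ring
    refine (Finset.sum_le_card_nsmul _ _ _ this).trans ?_
    have hcard : (s.card : ℝ) ≤ n := by
      rw [hndef]
      exact_mod_cast (by rw [hsdef, Nat.card_Ico]; omega)
    rw [nsmul_eq_mul]
    calc _ ≤ n * (L / n ^ 5) := mul_le_mul_of_nonneg_right hcard (by positivity)
      _ = _ := by field_simp
  have s0 : 0 ≤ ∑ i ∈ s, (x (i + 1) - x i) * slp x z i ^ 2 :=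
    Finset.sum_nonneg fun i hi => mul_nonneg (hpos i hi).le (sq_nonneg _)
  have s0' : 0 ≤ ∑ i ∈ s, (x (i + 1) - x i) ^ 5 * m1 ^ 4 * W i ^ 2 :=
    Finset.sum_nonneg fun i hi => by have := hpos i hi; positivity
  have hfin : e2 * T ≤ K * (L + 1) * (X / n ^ 2) := by
    refine abs_le_of_sq_le_sq' ?_ (by positivity) |>.2
    calc (e2 * T) ^ 2 = e2 * e2 * T ^ 2 := by ring
      _ ≤ e2 * (K * (e1 * m1)) * ((∑ i ∈ s, (x (i + 1) - x i) * slp x z i ^ 2)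
          * ∑ i ∈ s, (x (i + 1) - x i) ^ 5 * m1 ^ 4 * W i ^ 2) :=
          mul_le_mul (mul_le_mul_of_nonneg_left h.e2_m1 he.le) cs (sq_nonneg _) (by positivity)
      _ = e2 * K * ((e1 * ∑ i ∈ s, (x (i + 1) - x i) * slp x z i ^ 2)
          * (m1 * ∑ i ∈ s, (x (i + 1) - x i) ^ 5 * m1 ^ 4 * W i ^ 2)) := by ring
      _ ≤ K * K * (X ^ 2 * (L / n ^ 4)) :=
          mul_le_mul (mul_le_mul_of_nonneg_right h.e2_le hK.le)
            (mul_le_mul s1 s2 (by positivity) (sq_nonneg _)) (by positivity) (by positivity)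
      _ = L * (K ^ 2 * (X ^ 2 / n ^ 4)) := by ring
      _ ≤ (L + 1) ^ 2 * (K ^ 2 * (X ^ 2 / n ^ 4)) :=
          mul_le_mul_of_nonneg_right (by nlinarith) (by positivity)
      _ = _ := by field_simp
  calc e2 * |∑ i ∈ s, convTerm b x z g g₁ i|
      ≤ e2 * (B * (2 * C * (L / n ^ 2)) * X + B * C * T) :=
        mul_le_mul_of_nonneg_left (hA.trans (add_le_add le_rfl t2)) he.le
    _ = e2 * (B * (2 * C * (L / n ^ 2)) * X) + B * C * (e2 * T) := by ring
    _ ≤ K * (B * (2 * C * (L / n ^ 2)) * X) + B * C * (K * (L + 1) * (X / n ^ 2)) :=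
        add_le_add (mul_le_mul_of_nonneg_right h.e2_le (by positivity))
          (mul_le_mul_of_nonneg_left hfin (by positivity))
    _ = _ := by ring

/-- On the cells up to `3 m` the layer is `O(n⁻²)` and the telescoping bound applies; its last node
`3 m + 1` needs the separate nodal estimate. -/
theorem right_conv_le (h : ErrorSetting B K L p e1 e2 m0 m1 X m x z b) (hC : 0 < C)
    (hd1 : ∀ t, HasDerivAt g (g₁ t) t) (hd2 : ∀ t, HasDerivAt g₁ (g₂ t) t)
    (h0 : ∀ x ∈ Icc (0 : ℝ) 1, |g x| ≤ C * Real.exp (-(m1 * (1 - x))))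
    (h1 : ∀ x ∈ Icc (0 : ℝ) 1, |g₁ x| ≤ C * m1 * Real.exp (-(m1 * (1 - x))))
    (h2 : ∀ x ∈ Icc (0 : ℝ) 1, |g₂ x| ≤ C * m1 ^ 2 * Real.exp (-(m1 * (1 - x)))) :
    e2 * |∑ i ∈ Finset.range (4 * m), convTerm b x z g g₁ i|
      ≤ (2 * B * C * L * ((6 * (L + 1) + 1) * K) + (2 * B * C * L * K + B * C * (K * (L + 1))))
        * (X / ((4 * m : ℕ) : ℝ) ^ 2) := by
  have h4 := h.four_le
  have hL := h.L_pos
  have hK := h.K_pos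
  have hB := h.B_nonneg
  have hX := h.X_nonneg
  have he := h.e2_pos
  have hn := h.n_ge
  have hR := h.right_conv_inner_le hC hd1 hd2 h0 h2
  have hgc : Continuous g₁ := continuous_iff_continuousAt.mpr fun t => (hd2 t).continuousAt
  have hV : ∀ t, HasDerivAt (fun t => C * Real.exp (-(m1 * (1 - t))))
      (C * m1 * Real.exp (-(m1 * (1 - t)))) t := fun t => by
    have := ((((hasDerivAt_id t).const_sub 1).const_mul m1).neg.exp).const_mul C
    refine this.congr_deriv ?_
    simp only [id, Pi.neg_apply]; ring
  have hM := h.abs_sum_conv_antideriv_le (k := 0) (l := 3 * m + 1)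
    (Q := (6 * (L + 1) + 1) * K * X) (by omega) (by omega) hd1 hgc
    hV (by fun_prop) h1 fun i hi => by
      rcases (Finset.mem_Icc.mp hi).2.lt_or_eq with h5 | rfl
      · exact h.e2_abs_nodal_le (by omega)
      · refine h.e2_abs_nodal_right_le.trans ?_
        refine mul_le_mul_of_nonneg_right (mul_le_mul_of_nonneg_right ?_ hK.le) hX
        linarith
  have hlast : C * Real.exp (-(m1 * (1 - x (3 * m + 1)))) - C * Real.exp (-(m1 * (1 - x 0)))
      ≤ C * (L / ((4 * m : ℕ) : ℝ) ^ 2) := by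
    have q1 := mul_pos hC (Real.exp_pos (-(m1 * (1 - x 0))))
    have q2 := mul_le_mul_of_nonneg_left ((h.right_weight_le (j := 3 * m + 1) (by omega)
      le_rfl).trans h.right_last_le) hC.le
    linarith
  set n : ℝ := ((4 * m : ℕ) : ℝ) with hndef
  have hM' := hM.trans (mul_le_mul_of_nonneg_left hlast (by positivity))
  have hsplit : ∑ i ∈ Finset.range (4 * m), convTerm b x z g g₁ i
      = ∑ i ∈ Finset.Ico 0 (3 * m + 1), convTerm b x z g g₁ i
        + ∑ i ∈ Finset.Ico (3 * m + 1) (4 * m), convTerm b x z g g₁ i := by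
    rw [Finset.range_eq_Ico, Finset.sum_Ico_consecutive _ (by omega) (by omega)]
  rw [hsplit]
  refine (mul_le_mul_of_nonneg_left (abs_add_le _ _) he.le).trans ?_
  rw [mul_add, add_mul]
  refine add_le_add (hM'.trans (le_of_eq ?_)) hR
  ring

end ErrorSetting


/-! ### Assembly of the consistency error. -/

section Additivity

variable {b c f f₁ g g₁ : ℝ → ℝ} {x z : ℕ → ℝ} {i : ℕ}

theorem convTerm_add (hb : Continuous b) (hf : Continuous f₁) (hg : Continuous g₁) :
    convTerm b x z (fun t => f t + g t) (fun t => f₁ t + g₁ t) i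
      = convTerm b x z f f₁ i + convTerm b x z g g₁ i := by
  have cω : Continuous (aff x z i) := continuous_aff
  have key : ∀ {s : ℝ} {h : ℝ → ℝ}, Continuous h → IntervalIntegrable
      (fun t => b t * (s - h t) * aff x z i t) volume (x i) (x (i + 1)) := fun hh =>
    ((hb.mul (continuous_const.sub hh)).mul cω).intervalIntegrable _ _
  rw [convTerm, convTerm, convTerm, ← intervalIntegral.integral_add (key hf) (key hg)]
  refine intervalIntegral.integral_congr fun t _ => ?_
  simp only [slp_add]
  ring

theorem reactTerm_add (hc : Continuous c) (hf : Continuous f) (hg : Continuous g) :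
    reactTerm c x z (fun t => f t + g t) i = reactTerm c x z f i + reactTerm c x z g i := by
  have cω : Continuous (aff x z i) := continuous_aff
  have ca : ∀ y : ℕ → ℝ, Continuous (aff x y i) := fun y => continuous_aff
  have key : ∀ {h : ℝ → ℝ}, Continuous h → IntervalIntegrable
      (fun t => c t * (aff x (fun j => h (x j)) i t - h t) * aff x z i t) volume
      (x i) (x (i + 1)) := fun hh => ((hc.mul ((ca _).sub hh)).mul cω).intervalIntegrable _ _
  rw [reactTerm, reactTerm, reactTerm, ← intervalIntegral.integral_add (key hf) (key hg)]
  refine intervalIntegral.integral_congr fun t _ => ?_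
  simp only [aff_add]
  ring

end Additivity

/-- The constant in the consistency estimate. -/
def errConst (B K L C : ℝ) : ℝ :=
  B * C * K * (L + 2)
    + ((2 * B * C * L * K + 7 * B * C * L * ((6 * (L + 1) + 1) * K))
      + 2 * B * C * L * ((6 * (L + 1) + 1) * K) + B * (4 * C) * K * (L + 2))
    + (2 * B * C * L * ((6 * (L + 1) + 1) * K) + (2 * B * C * L * K + B * C * (K * (L + 1))))
    + (B * (C * (L + 2) ^ 2) + B * (2 * C * L) + B * (2 * C * L))

theorem ErrorSetting.abs_interp_error_sum_le {B K L p e1 e2 m0 m1 X C : ℝ} {m : ℕ} {x z : ℕ → ℝ}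
    {b c f S S₁ S₂ E E₁ E₂ E₃ F F₁ F₂ : ℝ → ℝ}
    (h : ErrorSetting B K L p e1 e2 m0 m1 X m x z b) (hC : 0 < C) (hc : Continuous c)
    (hcB : ∀ t ∈ Icc (0 : ℝ) 1, |c t| ≤ B)
    (hd : IsDecomposition C e1 e2 m0 m1 b c f S S₁ S₂ E E₁ E₂ E₃ F F₁ F₂) :
    |∑ i ∈ Finset.range (4 * m), (e2 * convTerm b x z (fun t => S t + E t + F t)
        (fun t => S₁ t + E₁ t + F₁ t) i + reactTerm c x z (fun t => S t + E t + F t) i)|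
      ≤ errConst B K L C * (X / ((4 * m : ℕ) : ℝ) ^ 2) := by
  have hL := h.L_pos
  have hn := h.n_ge
  have he := h.e2_pos
  have cb := h.b_diff.continuous
  have hcont : ∀ {g g' : ℝ → ℝ}, (∀ t, HasDerivAt g (g' t) t) → Continuous g := fun hg =>
    continuous_iff_continuousAt.mpr fun t => (hg t).continuousAt
  have cS := hcont hd.S_d1
  have cS1 := hcont hd.S_d2
  have cE := hcont hd.E_d.d1
  have cE1 := hcont hd.E_d.d2
  have cF := hcont hd.F_d1
  have cF1 := hcont hd.F_d2
  have aS := h.abs_sum_conv_smooth_le (Finset.Subset.refl _) hd.S_d1 hd.S_d2 hC.le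
    fun i hi t ht => hd.S_bdd t (h.isMesh.Icc_subset (Finset.mem_range.mp hi) ht)
  have aE := h.left_conv_le hC hd.E_d hd.E_bdd0 hd.E_bdd1 hd.E_bdd2 hd.E_bdd3
  have aF := h.right_conv_le hC hd.F_d1 hd.F_d2 hd.F_bdd0 hd.F_bdd1 hd.F_bdd2
  have eE := h.left_interp_error_le hC hd.E_d.d1 hd.E_d.d2 hd.E_bdd0 hd.E_bdd2
  have eF := h.right_interp_error_le hC hd.F_d1 hd.F_d2 hd.F_bdd0 hd.F_bdd2
  set n : ℝ := ((4 * m : ℕ) : ℝ) with hndef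
  have hn0 : 0 < n := by linarith
  have rS := h.abs_sum_le (Finset.Subset.refl _) (D := C * ((L + 2) / n) ^ 2) (by positivity) hcB
    (e := fun i t => aff x (fun j => S (x j)) i t - S t) fun i hi t ht => by
      have hi' := Finset.mem_range.mp hi
      have hlt := h.isMesh.lt i hi'
      refine (abs_interp_error_le hlt hd.S_d1 hd.S_d2 (fun t ht => hd.S_bdd t
        (h.isMesh.Icc_subset hi' ht)) t ht).1.trans (mul_le_mul_of_nonneg_left
          (pow_le_pow_left₀ (sub_pos.mpr hlt).le ((le_div_iff₀ hn0).mpr (h.mesh.upper i hi')) 2)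
          hC.le)
  have rE := h.abs_sum_le (Finset.Subset.refl _) (by positivity) hcB
    (e := fun i t => aff x (fun j => E (x j)) i t - E t) fun i hi => eE i (Finset.mem_range.mp hi)
  have rF := h.abs_sum_le (Finset.Subset.refl _) (by positivity) hcB
    (e := fun i t => aff x (fun j => F (x j)) i t - F t) fun i hi => eF i (Finset.mem_range.mp hi)
  have hsplit : ∑ i ∈ Finset.range (4 * m), (e2 * convTerm b x z (fun t => S t + E t + F t)
        (fun t => S₁ t + E₁ t + F₁ t) i + reactTerm c x z (fun t => S t + E t + F t) i)
      = e2 * ∑ i ∈ Finset.range (4 * m), convTerm b x z S S₁ i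
        + e2 * ∑ i ∈ Finset.range (4 * m), convTerm b x z E E₁ i
        + e2 * ∑ i ∈ Finset.range (4 * m), convTerm b x z F F₁ i
        + (∑ i ∈ Finset.range (4 * m), reactTerm c x z S i
          + ∑ i ∈ Finset.range (4 * m), reactTerm c x z E i
          + ∑ i ∈ Finset.range (4 * m), reactTerm c x z F i) := by
    simp only [Finset.mul_sum, ← Finset.sum_add_distrib]
    refine Finset.sum_congr rfl fun i _ => ?_
    have c1 : Continuous fun t => S₁ t + E₁ t := cS1.add cE1
    have c2 : Continuous fun t => S t + E t := cS.add cE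
    rw [convTerm_add (f := fun t => S t + E t) cb c1 cF1, convTerm_add cb cS1 cE1,
      reactTerm_add hc c2 cF, reactTerm_add hc cS cE]
    ring
  have habs : ∀ r : ℝ, |e2 * r| = e2 * |r| := fun r => by rw [abs_mul, abs_of_pos he]
  rw [hsplit]
  refine (abs_add_le _ _).trans ((add_le_add (abs_add_three _ _ _) (abs_add_three _ _ _)).trans ?_)
  rw [habs, habs, habs]
  refine (add_le_add (add_le_add (add_le_add aS aE) aF)
    (add_le_add (add_le_add rS rE) rF)).trans (le_of_eq ?_)
  rw [errConst]
  field_simp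

/-- With the energy norm as `X`, the sum of nodal squares is dominated by the `L²` part, the sum of
slopes is the derivative part, and the `L¹` norm is at most the `L²` norm on the unit interval. -/
theorem errorSetting_of_memVN {B K L p e1 e2 m0 m1 : ℝ} {m : ℕ} {x : ℕ → ℝ} {b w : ℝ → ℝ}
    (mesh : IsBakhvalovMesh L p m0 m1 m x) (four_le : 4 ≤ m) (n_le : ((4 * m : ℕ) : ℝ) ≤ m0)
    (m0_le : m0 ≤ m1) (p_lt : p < 1) (L_pos : 0 < L) (K_pos : 0 < K)
    (e1_pos : 0 < e1) (e2_pos : 0 < e2) (e2_m0 : e2 * m0 ≤ K) (e2_m1 : e2 ≤ K * (e1 * m1))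
    (b_diff : ContDiff ℝ 1 b) (b_le : ∀ t ∈ Icc (0 : ℝ) 1, |b t| ≤ B)
    (b_deriv_le : ∀ t ∈ Icc (0 : ℝ) 1, |deriv b t| ≤ B) (hw : MemVN x (4 * m) w) :
    ErrorSetting B K L p e1 e2 m0 m1 (energyNorm e1 w) m x (fun j => w (x j)) b := by
  have hM := mesh.isMesh
  set z : ℕ → ℝ := fun j => w (x j) with hz
  have hww : 0 ≤ l2Inner w w :=
    intervalIntegral.integral_nonneg zero_le_one fun t _ => mul_self_nonneg _
  have hdd : 0 ≤ e1 * l2Inner (deriv w) (deriv w) := mul_nonneg e1_pos.le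
    (intervalIntegral.integral_nonneg zero_le_one fun t _ => mul_self_nonneg _)
  have hX : energyNorm e1 w ^ 2 = nodalEnergy e1 x (4 * m) z := by
    rw [energyNorm, Real.sq_sqrt (add_nonneg hdd hww), hw.energy_eq hM]
  have h1 : 0 ≤ e1 * ∑ i ∈ Finset.range (4 * m), (x (i + 1) - x i) * slp x z i ^ 2 :=
    mul_nonneg e1_pos.le (Finset.sum_nonneg fun i hi =>
      mul_nonneg (sub_pos.mpr (hM.lt i (Finset.mem_range.mp hi))).le (sq_nonneg _))
  have h2 : 0 ≤ ∑ i ∈ Finset.range (4 * m), ∫ t in x i..x (i + 1), aff x z i t ^ 2 :=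
    Finset.sum_nonneg fun i hi => intervalIntegral.integral_nonneg
      (hM.lt i (Finset.mem_range.mp hi)).le fun t _ => sq_nonneg _
  have h3 : ∑ i ∈ Finset.range (4 * m), (x (i + 1) - x i) * (z i ^ 2 + z (i + 1) ^ 2) / 6
      ≤ ∑ i ∈ Finset.range (4 * m), ∫ t in x i..x (i + 1), aff x z i t ^ 2 :=
    Finset.sum_le_sum fun i hi => le_integral_aff_sq (hM.lt i (Finset.mem_range.mp hi))
  have z0 : z 0 = 0 := by simp only [hz]; rw [hM.zero]; exact hw.left_eq_zero
  have z1 : z (4 * m) = 0 := by simp only [hz]; rw [hM.one]; exact hw.right_eq_zero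
  have h4 : ∑ i ∈ Finset.range (4 * m), ∫ t in x i..x (i + 1), |aff x z i t| ≤ energyNorm e1 w :=
    (sum_integral_abs_aff_le hM hw).trans (Real.sqrt_le_sqrt (le_add_of_nonneg_left hdd))
  exact
  { mesh, four_le, n_le, m0_le, p_lt, L_pos, K_pos, e1_pos, e2_pos, e2_m0, e2_m1,
    b_diff, b_le, b_deriv_le
    X_nonneg := Real.sqrt_nonneg _
    z_left := z0
    z_right := z1
    sum_sq_le := hX ▸ h3.trans (le_add_of_nonneg_left h1)
    sum_slp_le := hX ▸ le_add_of_nonneg_right h2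
    sum_abs_le := h4 }


/-! ### The convergence estimate for extended coefficients. -/

section Convergence

variable {b c f : ℝ → ℝ} {lam β γ p τ : ℝ}

theorem l2Inner_self_nonneg (v : ℝ → ℝ) : 0 ≤ l2Inner v v :=
  intervalIntegral.integral_nonneg zero_le_one fun _ _ => mul_self_nonneg _

theorem le_of_sq_le_mul {a X M : ℝ} (ha : 0 < a) (hX : 0 ≤ X) (hM : 0 ≤ M)
    (h : a * X ^ 2 ≤ M * X) : X ≤ M / a := by
  rw [le_div_iff₀ ha]
  rcases hX.eq_or_lt with rfl | h0
  · simpa using hM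
  · nlinarith

-- Combines three ingredients: `u - g` is small because the residual is `O(n⁻²)`; `χ = g^I - u^N` is
-- small by coercivity and consistency; and at the nodes `u^I - u^N` is the sum of `χ` and `u - g`.
set_option maxHeartbeats 2000000 in
theorem exists_energyNorm_le (hb : ContDiff ℝ 3 b) (hc : ContDiff ℝ 3 c) (hf : ContDiff ℝ 3 f)
    (hb0 : ∀ x, 0 < b x) (hc0 : ∀ x, 0 < c x) (hlam : 0 < lam) (hβ : 0 < β) (hγ : 0 < γ)
    (hbl : ∀ x ∈ Icc (0 : ℝ) 1, lam ≤ b x) (hcl : ∀ x ∈ Icc (0 : ℝ) 1, β ≤ c x)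
    (hp0 : 0 < p) (hp1 : p < 1) (hτ : 5 / 2 ≤ τ) :
    ∃ C : ℝ, 0 < C ∧ ∀ (e1 e2 : ℝ) (m : ℕ) (u uN : ℝ → ℝ), 0 < e1 → e1 ≤ 1 → 0 < e2 → e2 ≤ 1 →
      (∀ x ∈ Icc (0 : ℝ) 1, γ ≤ c x - 1 / 2 * e2 * deriv b x) → 4 ≤ m →
      sigma τ p (mu0 e1 e2 b c) ≤ 1 / 4 → sigma τ p (mu1 e1 e2 b c) ≤ 1 / 4 →
      (mu0 e1 e2 b c)⁻¹ ≤ ((4 * m : ℕ) : ℝ)⁻¹ → IsWeakSolution e1 e2 b c f u →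
      IsFEMSolution e1 e2 b c f (meshPoint τ p (mu0 e1 e2 b c) (mu1 e1 e2 b c) (4 * m)) (4 * m) uN →
      energyNorm e1 (fun t => lagrangeInterp
        (meshPoint τ p (mu0 e1 e2 b c) (mu1 e1 e2 b c) (4 * m)) (4 * m) u t - uN t)
        ≤ C * (((4 * m : ℕ) : ℝ) ^ 2)⁻¹ := by
  obtain ⟨K, hK, hdec⟩ := exists_decomposition hb hc hf hb0 hc0 hlam hβ hbl hcl
  obtain ⟨L, hL, hmesh⟩ := isBakhvalovMesh_meshPoint hτ hp0
  have hb1 : ContDiff ℝ 1 b := hb.of_le (by norm_num)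
  have cb := hb.continuous
  have cc := hc.continuous
  have cf := hf.continuous
  obtain ⟨B, hB⟩ : ∃ B : ℝ, ∀ t ∈ Icc (0 : ℝ) 1, |b t| ≤ B ∧ |deriv b t| ≤ B ∧ |c t| ≤ B := by
    obtain ⟨B, hB⟩ := isCompact_Icc.exists_bound_of_continuousOn (s := Icc (0 : ℝ) 1)
      ((cb.abs.add (hb1.continuous_deriv le_rfl).abs).add cc.abs).continuousOn
    refine ⟨B, fun t ht => ?_⟩
    have h1 := (le_abs_self _).trans (hB t ht)
    have h2 := abs_nonneg (b t)
    have h3 := abs_nonneg (deriv b t)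
    have h4 := abs_nonneg (c t)
    simp only [Pi.add_apply] at h1
    refine ⟨?_, ?_, ?_⟩ <;> linarith
  have hB0 : 0 ≤ B := (abs_nonneg _).trans (hB 0 (by simp)).1
  -- Coercivity constant with respect to the energy norm.
  set a := min 1 γ with ha
  have ha0 : 0 < a := lt_min one_pos hγ
  have hQ : 0 ≤ errConst B K L K := by unfold errConst; positivity
  set M := (errConst B K L K + K) / a with hM
  have hM0 : 0 ≤ M := by positivity
  set T := 2 * M ^ 2 + 2 * (K ^ 2 / (4 * γ) + (K / β) ^ 2) with hT
  have hT0 : 0 ≤ T := by positivity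
  refine ⟨1 + T, by positivity, fun e1 e2 m u uN he1 he1' he2 he2' hγ' hm hs0 hs1 hmu hu huN => ?_⟩
  obtain ⟨hm0, hm01, he2m, he2m', S, S₁, S₂, E, E₁, E₂, E₃, F, F₁, F₂, hd⟩ :=
    hdec ⟨(e1, e2), ⟨he1, he1'⟩, he2, he2'⟩
  simp only [Params.e1, Params.e2] at hm0 hm01 he2m he2m' hd
  set m0 := mu0 e1 e2 b c with hm0def
  set m1 := mu1 e1 e2 b c with hm1def
  set x := meshPoint τ p m0 m1 (4 * m) with hx
  have hn16 : (16 : ℝ) ≤ ((4 * m : ℕ) : ℝ) := by exact_mod_cast (by omega : 16 ≤ 4 * m)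
  have hn0 : (0 : ℝ) < ((4 * m : ℕ) : ℝ) := by linarith
  have hnm : ((4 * m : ℕ) : ℝ) ≤ m0 := (inv_le_inv₀ hm0 hn0).mp hmu
  have hBM : IsBakhvalovMesh L p m0 m1 m x := hmesh m0 m1 m hm hnm (hnm.trans hm01) hs0 hs1
  have hIM := hBM.isMesh
  set g : ℝ → ℝ := fun t => S t + E t + F t with hg
  set g₁ : ℝ → ℝ := fun t => S₁ t + E₁ t + F₁ t with hg₁
  set g₂ : ℝ → ℝ := fun t => S₂ t + E₂ t + F₂ t with hg₂
  have dg : ∀ t, HasDerivAt g (g₁ t) t := fun t =>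
    ((hd.S_d1 t).add (hd.E_d.d1 t)).add (hd.F_d1 t)
  have dg1 : ∀ t, HasDerivAt g₁ (g₂ t) t := fun t =>
    ((hd.S_d2 t).add (hd.E_d.d2 t)).add (hd.F_d2 t)
  have cE2 : Continuous E₂ := continuous_iff_continuousAt.mpr fun t => (hd.E_d.d3 t).continuousAt
  have cg2 : Continuous g₂ := (hd.S_cont.add cE2).add hd.F_cont
  have cg1 : Continuous g₁ := continuous_iff_continuousAt.mpr fun t => (dg1 t).continuousAt
  have cg : Continuous g := continuous_iff_continuousAt.mpr fun t => (dg t).continuousAt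
  have hgH : MemH10 g := memH10_of_hasDerivAt dg cg1 hd.left hd.right
  set r : ℝ → ℝ := fun t => f t - (-e1 * g₂ t + e2 * b t * g₁ t + c t * g t) with hr
  have cr : Continuous r := by
    rw [hr]; fun_prop
  set n : ℝ := ((4 * m : ℕ) : ℝ) with hndef
  have hρ : ∀ t ∈ Icc (0 : ℝ) 1, |r t| ≤ K / n ^ 2 := fun t ht => by
    have := hd.residual t ht
    rw [abs_sub_comm] at this
    exact this.trans (div_le_div_of_nonneg_left hK.le (by positivity)
      (pow_le_pow_left₀ hn0.le hnm 2))
  have hgr : ∀ v, MemH10 v → bilin e1 e2 b c g v = l2Inner f v - l2Inner r v := by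
    intro v hv
    have cv := hv.continuousOn
    have i1 : IntervalIntegrable (fun t => f t * v t) volume 0 1 :=
      intervalIntegrable_of_continuousOn_unit (cf.continuousOn.mul cv)
    have i2 : IntervalIntegrable (fun t => r t * v t) volume 0 1 :=
      intervalIntegrable_of_continuousOn_unit (cr.continuousOn.mul cv)
    rw [bilin_of_hasDerivAt cb cc dg dg1 cg2 hv, l2Inner, l2Inner,
      ← intervalIntegral.integral_sub i1 i2]
    refine intervalIntegral.integral_congr fun t _ => ?_
    simp only [hr]; ring
  -- the part of the solution that is not captured by the decomposition
  have hRH : MemH10 (fun t => u t - g t) := hu.1.sub hgH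
  have hRr : ∀ v, MemH10 v → bilin e1 e2 b c (fun t => u t - g t) v = l2Inner r v := by
    intro v hv
    rw [bilin_sub_left cb.continuousOn cc.continuousOn hu.1 hgH hv, hu.2 v hv, hgr v hv]
    ring
  have hRinf := abs_le_of_bilin_eq he1.le hγ hβ (by positivity) hb1 cc.continuousOn hγ' hcl hRH
    cr.continuousOn hρ hRr
  have hRen := energy_le_of_bilin_eq hγ hb1 cc.continuousOn hγ' hRH cr.continuousOn hρ hRr
  -- the discrete error of the decomposition
  have hIg := memVN_lagrangeInterp hIM (v := g) hd.left hd.right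
  have hχ : MemVN x (4 * m) (fun t => lagrangeInterp x (4 * m) g t - uN t) := hIg.sub huN.1
  set χ : ℝ → ℝ := fun t => lagrangeInterp x (4 * m) g t - uN t with hχdef
  have hχH := hχ.memH10 hIM
  have hES := errorSetting_of_memVN hBM hm hnm hm01 hp1 hL hK he1 he2 he2m he2m' hb1
    (fun t ht => (hB t ht).1) (fun t ht => (hB t ht).2.1) hχ
  have hX0 : 0 ≤ energyNorm e1 χ := Real.sqrt_nonneg _
  have hXsq : energyNorm e1 χ ^ 2 = e1 * l2Inner (deriv χ) (deriv χ) + l2Inner χ χ :=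
    Real.sq_sqrt (add_nonneg (mul_nonneg he1.le (l2Inner_self_nonneg _)) (l2Inner_self_nonneg _))
  have hXχ : √(l2Inner χ χ) ≤ energyNorm e1 χ := Real.sqrt_le_sqrt
    (le_add_of_nonneg_left (mul_nonneg he1.le (l2Inner_self_nonneg _)))
  have hcons : |bilin e1 e2 b c (fun s => lagrangeInterp x (4 * m) g s - g s) χ|
      ≤ errConst B K L K * (energyNorm e1 χ / n ^ 2) := by
    rw [bilin_interp_error hIM cb cc dg cg1 hd.left hd.right hχ]
    exact hES.abs_interp_error_sum_le hK cc (fun t ht => (hB t ht).2.2) hd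
  -- Perturbed Galerkin orthogonality: `g` solves the problem with right-hand side `f - r` while
  -- `u^N` sees `f`, which leaves `-(r, χ)`.
  have hself : bilin e1 e2 b c χ χ
      = bilin e1 e2 b c (fun s => lagrangeInterp x (4 * m) g s - g s) χ - l2Inner r χ := by
    rw [bilin_sub_left cb.continuousOn cc.continuousOn (hIg.memH10 hIM) hgH hχH, hgr χ hχH]
    have := bilin_sub_left (e1 := e1) (e2 := e2) cb.continuousOn cc.continuousOn (hIg.memH10 hIM)
      (huN.1.memH10 hIM) hχH
    rw [huN.2 χ hχ] at this
    rw [this]; ring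
  have hcoer := bilin_self_ge (e1 := e1) hb1 cc.continuousOn hχH hγ'
  have hrχ := abs_l2Inner_le hρ hχ.continuousOn
  have hX : energyNorm e1 χ ≤ M / n ^ 2 := by
    have h1 : a * energyNorm e1 χ ^ 2 ≤ (errConst B K L K + K) / n ^ 2 * energyNorm e1 χ := by
      have q1 : a * (e1 * l2Inner (deriv χ) (deriv χ)) ≤ 1 * (e1 * l2Inner (deriv χ) (deriv χ)) :=
        mul_le_mul_of_nonneg_right (min_le_left _ _)
          (mul_nonneg he1.le (l2Inner_self_nonneg _))
      have q2 : a * l2Inner χ χ ≤ γ * l2Inner χ χ :=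
        mul_le_mul_of_nonneg_right (min_le_right _ _) (l2Inner_self_nonneg _)
      have q3 := le_abs_self (bilin e1 e2 b c (fun s => lagrangeInterp x (4 * m) g s - g s) χ)
      have q4 := neg_abs_le (l2Inner r χ)
      have q5 : K / n ^ 2 * √(l2Inner χ χ) ≤ K / n ^ 2 * energyNorm e1 χ :=
        mul_le_mul_of_nonneg_left hXχ (by positivity)
      rw [hXsq]
      calc a * (e1 * l2Inner (deriv χ) (deriv χ) + l2Inner χ χ) ≤ bilin e1 e2 b c χ χ := by linarith
        _ ≤ errConst B K L K * (energyNorm e1 χ / n ^ 2) + K / n ^ 2 * energyNorm e1 χ := by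
            linarith
        _ = _ := by ring
    refine (le_of_sq_le_mul ha0 hX0 (by positivity) h1).trans (le_of_eq ?_)
    rw [hM]; field_simp
  -- the interpolant of the solution
  have hw : MemVN x (4 * m) (fun t => lagrangeInterp x (4 * m) u t - uN t) :=
    (memVN_lagrangeInterp hIM hu.1.left_eq_zero hu.1.right_eq_zero).sub huN.1
  -- The energy of a discrete function depends only on its nodal values, so `u - g` enters through
  -- samples at the nodes.
  have hnodal : nodalEnergy e1 x (4 * m) (fun j => lagrangeInterp x (4 * m) u (x j) - uN (x j))
      = nodalEnergy e1 x (4 * m) (fun j => χ (x j) + (u (x j) - g (x j))) :=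
    nodalEnergy_congr fun j hj => by
      simp only [hχdef]
      rw [lagrangeInterp_node hIM u hj, lagrangeInterp_node hIM g hj]
      ring
  have hen := hw.energy_eq (e1 := e1) hIM
  rw [hnodal] at hen
  have hadd := nodalEnergy_add_le (z := fun j => χ (x j)) (y := fun j => u (x j) - g (x j))
    hIM he1.le
  rw [← hχ.energy_eq hIM, ← hXsq] at hadd
  have hR := nodalEnergy_sample_le hIM he1.le hRH hRinf
  have hfin : e1 * l2Inner (deriv fun t => lagrangeInterp x (4 * m) u t - uN t)
      (deriv fun t => lagrangeInterp x (4 * m) u t - uN t)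
      + l2Inner (fun t => lagrangeInterp x (4 * m) u t - uN t)
        (fun t => lagrangeInterp x (4 * m) u t - uN t) ≤ T / n ^ 4 := by
    rw [hen]
    calc _ ≤ 2 * (M / n ^ 2) ^ 2 + 2 * ((K / n ^ 2) ^ 2 / (4 * γ) + (K / n ^ 2 / β) ^ 2) := by
          have := pow_le_pow_left₀ hX0 hX 2
          linarith
      _ = T / n ^ 4 := by rw [hT]; field_simp
  refine Real.sqrt_le_iff.mpr ⟨by positivity, hfin.trans ?_⟩
  calc T / n ^ 4 ≤ (1 + T) ^ 2 / n ^ 4 :=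
        div_le_div_of_nonneg_right (by nlinarith) (by positivity)
    _ = _ := by field_simp

end Convergence

/-! ### Return to coefficients given only on `[0,1]`. -/

theorem mu_congr {e1 e2 : ℝ} {b c b' c' : ℝ → ℝ} (hb : EqOn b b' (Icc 0 1))
    (hc : EqOn c c' (Icc 0 1)) : mu0 e1 e2 b c = mu0 e1 e2 b' c' ∧ mu1 e1 e2 b c = mu1 e1 e2 b' c' := by
  have h0 : charRoot0 e1 e2 b c '' Icc 0 1 = charRoot0 e1 e2 b' c' '' Icc 0 1 :=
    image_congr fun x hx => by rw [charRoot0, charRoot0, hb hx, hc hx]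
  have h1 : charRoot1 e1 e2 b c '' Icc 0 1 = charRoot1 e1 e2 b' c' '' Icc 0 1 :=
    image_congr fun x hx => by rw [charRoot1, charRoot1, hb hx, hc hx]
  rw [mu0, mu0, mu1, mu1, h0, h1]
  exact ⟨rfl, rfl⟩

theorem l2Inner_congr_left {f g v : ℝ → ℝ} (h : EqOn f g (Icc 0 1)) :
    l2Inner f v = l2Inner g v :=
  intervalIntegral.integral_congr fun t ht => by
    rw [uIcc_of_le zero_le_one] at ht
    simp only [h ht]

theorem bilin_congr {e1 e2 : ℝ} {b c b' c' v w : ℝ → ℝ} (hb : EqOn b b' (Icc 0 1))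
    (hc : EqOn c c' (Icc 0 1)) : bilin e1 e2 b c v w = bilin e1 e2 b' c' v w := by
  rw [bilin, bilin, l2Inner_congr_left (fun t ht => by simp only [hb ht] :
    EqOn (fun t => b t * deriv v t) (fun t => b' t * deriv v t) (Icc 0 1)),
    l2Inner_congr_left (fun t ht => by simp only [hc ht] :
    EqOn (fun t => c t * v t) (fun t => c' t * v t) (Icc 0 1))]

end TwoParam

end

theorem mainTheorem1 :
    ∃ q : ℕ, ∀ (b c f : ℝ → ℝ) (lam β γ p τ : ℝ),
      ContDiffOn ℝ q b (Set.Icc 0 1) → ContDiffOn ℝ q c (Set.Icc 0 1) →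
      ContDiffOn ℝ q f (Set.Icc 0 1) →
      0 < lam → 0 < β → 0 < γ →
      (∀ x ∈ Set.Icc (0 : ℝ) 1, lam ≤ b x) → (∀ x ∈ Set.Icc (0 : ℝ) 1, β ≤ c x) →
      0 < p → p < 1 → 5 / 2 ≤ τ →
      ∃ C : ℝ, 0 < C ∧ ∀ (ε₁ ε₂ : ℝ) (N : ℕ) (u uN : ℝ → ℝ),
        0 < ε₁ → ε₁ ≤ 1 → 0 < ε₂ → ε₂ ≤ 1 →
        (∀ x ∈ Set.Icc (0 : ℝ) 1, γ ≤ c x - 1 / 2 * ε₂ * derivWithin b (Set.Icc 0 1) x) →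
        16 ≤ N → 4 ∣ N →
        TwoParam.sigma τ p (TwoParam.mu0 ε₁ ε₂ b c) ≤ 1 / 4 →
        TwoParam.sigma τ p (TwoParam.mu1 ε₁ ε₂ b c) ≤ 1 / 4 →
        (TwoParam.mu0 ε₁ ε₂ b c)⁻¹ ≤ (N : ℝ)⁻¹ →
        TwoParam.IsWeakSolution ε₁ ε₂ b c f u →
        TwoParam.IsFEMSolution ε₁ ε₂ b c f
          (TwoParam.meshPoint τ p (TwoParam.mu0 ε₁ ε₂ b c) (TwoParam.mu1 ε₁ ε₂ b c) N) N uN →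
        TwoParam.energyNorm ε₁ (fun t =>
            TwoParam.lagrangeInterp
              (TwoParam.meshPoint τ p (TwoParam.mu0 ε₁ ε₂ b c) (TwoParam.mu1 ε₁ ε₂ b c) N) N u t
            - uN t)
          ≤ C * √ε₂ * ((N : ℝ) ^ 2)⁻¹ * √(Real.log N) + C * ((N : ℝ) ^ 2)⁻¹ := by
  -- Three derivatives suffice: the amplitude of the WKB layers contains first derivatives of `b`
  -- and of the discriminant and must be `C²`, and the outer expansion contains `(f/c)'` and must be
  -- `C²`.
  refine ⟨3, fun b c f lam β γ p τ hb hc hf hlam hβ hγ hbl hcl hp0 hp1 hτ => ?_⟩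
  obtain ⟨b', hb', hb0, hbb⟩ := TwoParam.exists_pos_contDiff_extension 3 hb
    fun x hx => hlam.trans_le (hbl x hx)
  obtain ⟨c', hc', hc0, hcc⟩ := TwoParam.exists_pos_contDiff_extension 3 hc
    fun x hx => hβ.trans_le (hcl x hx)
  obtain ⟨f', hf', hff⟩ := TwoParam.exists_contDiff_extension 3 hf
  obtain ⟨C, hC, h⟩ := TwoParam.exists_energyNorm_le hb' hc' hf' hb0 hc0 hlam hβ hγ
    (fun x hx => hbb hx ▸ hbl x hx) (fun x hx => hcc hx ▸ hcl x hx) hp0 hp1 hτ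
  refine ⟨C, hC, fun ε₁ ε₂ N u uN he1 he1' he2 he2' hγ' hN hdvd hs0 hs1 hmu hu huN => ?_⟩
  obtain ⟨m, rfl⟩ := hdvd
  obtain ⟨e0, e1⟩ := TwoParam.mu_congr (e1 := ε₁) (e2 := ε₂) hbb hcc
  rw [e0, e1] at huN ⊢
  rw [e0] at hs0 hmu
  rw [e1] at hs1
  have hder : ∀ x ∈ Set.Icc (0 : ℝ) 1, derivWithin b (Set.Icc 0 1) x = deriv b' x := fun x hx => by
    rw [derivWithin_congr hbb (hbb hx)]
    exact ((hb'.differentiable (by norm_num)) x).derivWithin (uniqueDiffOn_Icc_zero_one x hx)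
  have key := h ε₁ ε₂ m u uN he1 he1' he2 he2'
    (fun x hx => by rw [← hder x hx, ← hcc hx]; exact hγ' x hx) (by omega) hs0 hs1 hmu
    ⟨hu.1, fun v hv => by
      rw [← TwoParam.bilin_congr hbb hcc, ← TwoParam.l2Inner_congr_left hff, hu.2 v hv]⟩
    ⟨huN.1, fun v hv => by
      rw [← TwoParam.bilin_congr hbb hcc, ← TwoParam.l2Inner_congr_left hff, huN.2 v hv]⟩
  -- The term with `√ε₂` and the logarithm is nonnegative and is simply added.
  exact key.trans (le_add_of_nonneg_left (by positivity))
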